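/- Fix $n\ge 1$, let $I=\{1,\dots,4n+1\}$, and let $p(i)\in\{0,1\}$ be $0$ for odd $i$ and $1$ for even $i$. Let $\mathfrak{gl}=\mathfrak{gl}(2n+1|2n)$ be the complex Lie superalgebra of matrices with rows and columns indexed by $I$, $e_{ij}$ having parity $p(i)+p(j)$, with the supercommutator $[a,b]=ab-(-1)^{p(a)p(b)}ba$ and the form $(a|b)=\mathrm{str}(ab)$, $\mathrm{str}(a)=\sum_i(-1)^{p(i)}a_{ii}$. Put $i'=4n+2-i$; $\delta_k=1$ for $k\in\{2n+2,2n+4,\dots,4n\}$ and $\delta_k=0$ otherwise; $J=\sum_k(-1)^{\delta_k}e_{kk'}$; $\theta(e_{ij})=(-1)^{p(i)p(j)+p(j)+1+\delta_i+\delta_j}e_{j'i'}$; $\check\theta=-\theta$. With $a^{st}=\sum_{i,j}(-1)^{(p(i)+1)p(j)}a_{ij}e_{ji}$, let $\mathfrak g=\mathfrak{osp}(2n+1|2n)=\{a\in\mathfrak{gl}: a^{st}J+Ja=0\}$, which is the fixed space of $\theta$, and let $\mathfrak{gl}^{\check\theta}$ be the fixed space of $\check\theta$, so that $\mathfrak{gl}=\mathfrak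 g\oplus\mathfrak{gl}^{\check\theta}$. Let $f=\sum_{i=1}^{2n}\big(e_{i+1,i}+\theta(e_{i+1,i})\big)\in\mathfrak g$, an odd principal nilpotent element, and grade $\mathfrak{gl}$ and $\mathfrak g$ by the eigenvalues of $\mathrm{ad}\,x$, $x=\sum_i\frac{2n+1-i}{2}e_{ii}\in\mathfrak g$ (so $e_{ij}$ has degree $\frac{j-i}2$). For $\mathfrak a\in\{\mathfrak{gl},\mathfrak g\}$ let $\bar{\mathfrak a}$ be $\mathfrak a$ with reversed parity, and let $\mathcal V(\bar{\mathfrak a})=S(\mathbb C[D]\otimes\bar{\mathfrak a})$ be the supersymmetric algebra ($D$ odd), with $D$ extended to an odd derivation. For $a\in\mathfrak a$ let $\{\bar a{}_\chi\,\cdot\,\}:\mathcal V(\bar{\mathfrak a})\to\mathbb C[\chi]\otimes\mathcal V(\bar{\mathfrak a})$ ($\chi$ odd, $D\chi=-\chi D-2\chi^2$) be the bracket of the SUSY affine Poisson vertex algebra of level $1$, i.e. the linear map determined, for homogeneous arguments, by $$\{\bar a{}_\chi\bar b\}=(-1)^{p(a)p(\bar b)}\overline{[a,b]}+\chi(a|b),\qquad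 \{\bar a{}_\chi Du\}=(-1)^{p(\bar a)+1}(D+\chi)\{\bar a{}_\chi u\},$$ $$\{\bar a{}_\chi uv\}=(-1)^{(p(\bar a)+1)p(u)}u\{\bar a{}_\chi v\}+\{\bar a{}_\chi u\}v .$$ Let $\mathfrak n=\mathfrak a_{>0}$, $\mathfrak p=\mathfrak a_{\le0}$, let $\mathcal V(\bar{\mathfrak p})=S(\mathbb C[D]\otimes\bar{\mathfrak p})\subset\mathcal V(\bar{\mathfrak a})$, and let $\mathfrak I$ be the differential algebra ideal of $\mathcal V(\bar{\mathfrak a})$ generated by the elements $\bar m-(f|m)$, $m\in\mathfrak n$. The SUSY classical $W$-algebra is $$\mathcal W(\bar{\mathfrak a},f)=\{w\in\mathcal V(\bar{\mathfrak p}):\ \{\bar m{}_\chi w\}\in\mathbb C[\chi]\otimes\mathfrak I\ \text{ for all } m\in\mathfrak n\}.$$ Let $S(R)$ be the subalgebra of $\mathcal V(\overline{\mathfrak{gl}})$ generated by $\mathbb C[D]\otimes\bar{\mathfrak g}$ and by the products of two elements of $\mathbb C[D]\otimes\overline{\mathfrak{gl}}^{\check\theta}$, and let $\mathcal M$ be the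 differential algebra ideal of $S(R)$ generated by these products. One has $\mathcal V(\overline{\mathfrak{gl}})=S(R)\oplus(\mathbb C[D]\otimes\overline{\mathfrak{gl}}^{\check\theta})S(R)$, and the inclusion $\mathfrak g\subset\mathfrak{gl}$ induces an isomorphism $\mathcal V(\bar{\mathfrak g})\simeq S(R)/\mathcal M$. The folding map is the composition $$\kappa:\mathcal V(\overline{\mathfrak{gl}})\xrightarrow{\pi_1}S(R)\xrightarrow{\psi}S(R)/\mathcal M\simeq\mathcal V(\bar{\mathfrak g})$$ of the projection $\pi_1$ along this decomposition and the quotient map $\psi$. Finally let $\mathcal A=\sum_{i\le j}e_{ij}\otimes\big(\delta_{ij}D+(-1)^{p(j)}\bar e_{ji}\big)-f\otimes1$ (here $\delta_{ij}$ is the Kronecker symbol), a matrix over $\mathcal V(\overline{\mathfrak{gl}})[D]$, where $D\,s=D(s)+(-1)^{p(s)}s\,D$, and let $w_1,\dots,w_{4n+1}$ be the coefficients of its row determinant $$\mathrm{rdet}(\mathcal A)=\sum_{N=0}^{4n}\ \sum_{0=i_0<i_1<\dots<i_{N+1}=4n+1}(-1)^{n+\sum_{k=1}^{N+1}\delta_{i_k}}\mathcal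 A_{i_0+1,i_1}\mathcal A_{i_1+1,i_2}\cdots\mathcal A_{i_N+1,i_{N+1}}=\sum_{i=0}^{4n+1}w_{4n+1-i}D^i .$$ **Theorem.** If $w\in\mathcal W(\overline{\mathfrak{gl}},f)$, then $\kappa(w)\in\mathcal W(\bar{\mathfrak g},f)$. Moreover, $\kappa(w_1),\dots,\kappa(w_{4n+1})\in\mathcal W(\bar{\mathfrak g},f)$. -/

import Mathlib

noncomputable section

namespace SusyW

/-! ### Supersymmetric algebras

A vector superspace is a complex vector space `L` with its parity operator `e`, the involution
equal to `1` on the even part and to `-1` on the odd part. Parities are recorded by natural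
numbers, of which only the class modulo two matters. -/

section Supersymmetric

variable {L : Type} [AddCommGroup L] [Module ℂ L]

/-- `v` is homogeneous of parity `i` (mod 2) for the parity operator `e`. -/
def HasParity (e : L →ₗ[ℂ] L) (i : ℕ) (v : L) : Prop := e v = (-1 : ℂ) ^ i • v

/-- The supercommutativity relations `x y = (-1)^{p(x)p(y)} y x`, for homogeneous `x, y ∈ L`. -/
inductive SuperComm (e : L →ₗ[ℂ] L) : TensorAlgebra ℂ L → TensorAlgebra ℂ L → Prop
  | swap (i j : ℕ) (x y : L) (hx : HasParity e i x) (hy : HasParity e j y) :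
      SuperComm e (TensorAlgebra.ι ℂ x * TensorAlgebra.ι ℂ y)
        ((-1 : ℂ) ^ (i * j) • (TensorAlgebra.ι ℂ y * TensorAlgebra.ι ℂ x))

/-- The supersymmetric algebra `S(L)` of the superspace `(L, e)`: the universal associative unital
algebra generated by `L` in which homogeneous elements of `L` supercommute. -/
def SuperSym (e : L →ₗ[ℂ] L) : Type := RingQuot (SuperComm e)

variable (e : L →ₗ[ℂ] L)

instance : Ring (SuperSym e) := inferInstanceAs (Ring (RingQuot (SuperComm e)))

instance : Algebra ℂ (SuperSym e) := inferInstanceAs (Algebra ℂ (RingQuot (SuperComm e)))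

namespace SuperSym

/-- The canonical map `L → S(L)`. -/
def ι : L →ₗ[ℂ] SuperSym e :=
  (RingQuot.mkAlgHom ℂ (SuperComm e)).toLinearMap ∘ₗ TensorAlgebra.ι ℂ

variable {e}

theorem ι_swap {i j : ℕ} {x y : L} (hx : HasParity e i x) (hy : HasParity e j y) :
    ι e x * ι e y = (-1 : ℂ) ^ (i * j) • (ι e y * ι e x) := by
  have h := RingQuot.mkAlgHom_rel ℂ (SuperComm.swap i j x y hx hy)
  rw [map_mul, map_smul, map_mul] at h
  exact h

@[elab_as_elim]
theorem induction {C : SuperSym e → Prop} (algebraMap : ∀ r, C (algebraMap ℂ (SuperSym e) r))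
    (ι : ∀ x, C (ι e x)) (mul : ∀ a b, C a → C b → C (a * b))
    (add : ∀ a b, C a → C b → C (a + b)) (a : SuperSym e) : C a := by
  obtain ⟨a, rfl⟩ := RingQuot.mkAlgHom_surjective ℂ (SuperComm e) a
  induction a using TensorAlgebra.induction with
  | algebraMap r =>
    rw [AlgHom.commutes]
    exact algebraMap r
  | ι x => exact ι x
  | mul a b ha hb => rw [map_mul]; exact mul _ _ ha hb
  | add a b ha hb => rw [map_add]; exact add _ _ ha hb

/-- The universal property of `S(L)`. -/
def lift {B : Type} [Ring B] [Algebra ℂ B] (φ : L →ₗ[ℂ] B)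
    (h : ∀ (i j : ℕ) (x y : L), HasParity e i x → HasParity e j y →
      φ x * φ y = (-1 : ℂ) ^ (i * j) • (φ y * φ x)) : SuperSym e →ₐ[ℂ] B :=
  RingQuot.liftAlgHom ℂ ⟨TensorAlgebra.lift ℂ φ, by
    rintro _ _ ⟨i, j, x, y, hx, hy⟩
    simpa using h i j x y hx hy⟩

theorem lift_ι {B : Type} [Ring B] [Algebra ℂ B] (φ : L →ₗ[ℂ] B)
    (h : ∀ (i j : ℕ) (x y : L), HasParity e i x → HasParity e j y →
      φ x * φ y = (-1 : ℂ) ^ (i * j) • (φ y * φ x)) (x : L) : lift φ h (ι e x) = φ x := by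
  have := RingQuot.liftAlgHom_mkAlgHom_apply ℂ (TensorAlgebra.lift ℂ φ) (s := SuperComm e) (by
    rintro _ _ ⟨i, j, x, y, hx, hy⟩
    simpa using h i j x y hx hy) (TensorAlgebra.ι ℂ x)
  rw [TensorAlgebra.lift_ι_apply] at this
  exact this

/-- The algebra homomorphism `S(L) → S(L')` induced by an even linear map. -/
def map {L' : Type} [AddCommGroup L'] [Module ℂ L'] {e' : L' →ₗ[ℂ] L'} (φ : L →ₗ[ℂ] L')
    (h : ∀ x, e' (φ x) = φ (e x)) : SuperSym e →ₐ[ℂ] SuperSym e' :=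
  lift (ι e' ∘ₗ φ) fun i j x y hx hy => by
    refine ι_swap ?_ ?_
    · rw [HasParity, h, hx, map_smul]
    · rw [HasParity, h, hy, map_smul]

@[simp] theorem map_ι {L' : Type} [AddCommGroup L'] [Module ℂ L'] {e' : L' →ₗ[ℂ] L'}
    (φ : L →ₗ[ℂ] L') (h : ∀ x, e' (φ x) = φ (e x)) (x : L) :
    map φ h (ι e x) = ι e' (φ x) := lift_ι _ _ x

variable (e) in
/-- The parity automorphism of the superalgebra `S(L)`. -/
def par : SuperSym e →ₐ[ℂ] SuperSym e := map e fun _ => rfl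

@[simp] theorem par_ι (x : L) : par e (ι e x) = ι e (e x) := map_ι _ _ x

theorem par_pow_ι (k : ℕ) {i : ℕ} {x : L} (hx : HasParity e i x) :
    (par e ^ k) (ι e x) = (-1 : ℂ) ^ (k * i) • ι e x := by
  induction k with
  | zero => simp
  | succ k ih =>
    rw [pow_succ', AlgHom.mul_apply, ih, map_smul, par_ι, hx, map_smul, smul_smul]
    congr 1; ring

/-- Every vector is a sum of homogeneous ones. -/
theorem exists_hom (he : ∀ x, e (e x) = x) (x : L) :
    ∃ y z, x = y + z ∧ HasParity e 0 y ∧ HasParity e 1 z := by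
  refine ⟨(2⁻¹ : ℂ) • (x + e x), (2⁻¹ : ℂ) • (x - e x), ?_, ?_, ?_⟩
  · rw [← smul_add, add_add_sub_cancel, ← two_smul ℂ x, smul_smul]; norm_num
  · simp only [HasParity, map_smul, map_add, he, pow_zero, one_smul]; rw [add_comm]
  · simp only [HasParity, map_smul, map_sub, he, pow_one, neg_one_smul]
    rw [← smul_neg, neg_sub]

/-- Elements of `L` supercommute with all of `S(L)`. -/
theorem ι_mul (he : ∀ x, e (e x) = x) {j : ℕ} {y : L} (hy : HasParity e j y) (s : SuperSym e) :
    ι e y * s = (par e ^ j) s * ι e y := by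
  induction s using induction with
  | algebraMap r => rw [AlgHom.commutes]; exact (Algebra.commutes r _).symm
  | ι x =>
    obtain ⟨u, v, rfl, hu, hv⟩ := exists_hom he x
    rw [map_add, map_add, mul_add, add_mul, ι_swap hy hu, ι_swap hy hv, par_pow_ι _ hu,
      par_pow_ι _ hv, smul_mul_assoc, smul_mul_assoc]
  | mul a b ha hb => rw [← mul_assoc, ha, mul_assoc, hb, map_mul, mul_assoc]
  | add a b ha hb => rw [mul_add, ha, hb, map_add, add_mul]

theorem par_par (he : ∀ x, e (e x) = x) (s : SuperSym e) : par e (par e s) = s := by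
  induction s using induction with
  | algebraMap r => rw [AlgHom.commutes, AlgHom.commutes]
  | ι x => rw [par_ι, par_ι, he]
  | mul a b ha hb => rw [map_mul, map_mul, ha, hb]
  | add a b ha hb => rw [map_add, map_add, ha, hb]

section SkewDerivation

variable {M : Type} [AddCommGroup M] [Module ℂ M]

/-- The algebra homomorphism `b ↦ ((s, m) ↦ (b s, b m + d(b) s))` which encodes a derivation `d`
of `S(L)` into a bimodule `M`, with left action `lam` and right action `rho`. -/
def derHom (lam : SuperSym e →ₐ[ℂ] Module.End ℂ M) (rho : SuperSym e →ₗ[ℂ] Module.End ℂ M)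
    (hrho : ∀ s t m, rho (s * t) m = rho t (rho s m))
    (hcomm : ∀ s t m, lam s (rho t m) = rho t (lam s m)) (d : L →ₗ[ℂ] M)
    (hd : ∀ (i j : ℕ) (x y : L), HasParity e i x → HasParity e j y →
      lam (ι e x) (d y) + rho (ι e y) (d x)
        = (-1 : ℂ) ^ (i * j) • (lam (ι e y) (d x) + rho (ι e x) (d y))) :
    SuperSym e →ₐ[ℂ] Module.End ℂ (SuperSym e × M) :=
  lift
    { toFun := fun x =>
        LinearMap.prod (LinearMap.mulLeft ℂ (ι e x) ∘ₗ LinearMap.fst ℂ _ _)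
          (lam (ι e x) ∘ₗ LinearMap.snd ℂ _ _ + (rho.flip (d x)) ∘ₗ LinearMap.fst ℂ _ _)
      map_add' := fun x y => by
        refine LinearMap.ext fun p => Prod.ext ?_ ?_
        · simp [add_mul]
        · simp; abel
      map_smul' := fun c x => by
        refine LinearMap.ext fun p => Prod.ext ?_ ?_
        · simp
        · simp }
    fun i j x y hx hy => by
      refine LinearMap.ext fun p => Prod.ext ?_ ?_
      · simp [← mul_assoc, ι_swap hx hy]
      · have h1 := hd i j x y hx hy
        have h2 : lam (ι e x) (lam (ι e y) p.2)
            = (-1 : ℂ) ^ (i * j) • lam (ι e y) (lam (ι e x) p.2) := by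
          rw [← Module.End.mul_apply, ← map_mul, ι_swap hx hy, map_smul, map_mul]; rfl
        have h3 := congrArg (rho p.1) h1
        simp only [map_add, map_smul, ← hcomm, smul_add] at h3
        change lam (ι e x) (lam (ι e y) p.2 + rho p.1 (d y)) + rho (ι e y * p.1) (d x)
          = (-1 : ℂ) ^ (i * j) •
            (lam (ι e y) (lam (ι e x) p.2 + rho p.1 (d x)) + rho (ι e x * p.1) (d y))
        rw [hrho, hrho, map_add, map_add, h2, add_assoc, h3, smul_add, smul_add, add_assoc]

/-- The derivation `δ : S(L) → M` which extends a linear map `d : L → M`; it is characterized by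
`skewDer_ι` and `skewDer_mul`. -/
def skewDer (lam : SuperSym e →ₐ[ℂ] Module.End ℂ M) (rho : SuperSym e →ₗ[ℂ] Module.End ℂ M)
    (hrho : ∀ s t m, rho (s * t) m = rho t (rho s m))
    (hcomm : ∀ s t m, lam s (rho t m) = rho t (lam s m)) (d : L →ₗ[ℂ] M)
    (hd : ∀ (i j : ℕ) (x y : L), HasParity e i x → HasParity e j y →
      lam (ι e x) (d y) + rho (ι e y) (d x)
        = (-1 : ℂ) ^ (i * j) • (lam (ι e y) (d x) + rho (ι e x) (d y))) :
    SuperSym e →ₗ[ℂ] M :=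
  LinearMap.snd ℂ _ _ ∘ₗ
    ((derHom lam rho hrho hcomm d hd).toLinearMap.flip ((1 : SuperSym e), (0 : M)))

variable {lam : SuperSym e →ₐ[ℂ] Module.End ℂ M} {rho : SuperSym e →ₗ[ℂ] Module.End ℂ M}
  {hrho : ∀ s t m, rho (s * t) m = rho t (rho s m)}
  {hcomm : ∀ s t m, lam s (rho t m) = rho t (lam s m)} {d : L →ₗ[ℂ] M}
  {hd : ∀ (i j : ℕ) (x y : L), HasParity e i x → HasParity e j y →
      lam (ι e x) (d y) + rho (ι e y) (d x)
        = (-1 : ℂ) ^ (i * j) • (lam (ι e y) (d x) + rho (ι e x) (d y))}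

theorem derHom_ι (x : L) (s : SuperSym e) (m : M) :
    derHom lam rho hrho hcomm d hd (ι e x) (s, m)
      = (ι e x * s, lam (ι e x) m + rho s (d x)) := by
  rw [derHom, lift_ι]
  rfl

theorem skewDer_ι (hrho1 : ∀ m, rho 1 m = m) (x : L) :
    skewDer lam rho hrho hcomm d hd (ι e x) = d x := by
  change (derHom lam rho hrho hcomm d hd (ι e x) (1, 0)).2 = d x
  rw [derHom_ι]
  simp [hrho1]

theorem derHom_apply (hrho1 : ∀ m, rho 1 m = m) (b s : SuperSym e) (m : M) :
    derHom lam rho hrho hcomm d hd b (s, m)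
      = (b * s, lam b m + rho s (skewDer lam rho hrho hcomm d hd b)) := by
  have key : ∀ b : SuperSym e, (∀ s m, derHom lam rho hrho hcomm d hd b (s, m)
      = (b * s, lam b m + rho s (skewDer lam rho hrho hcomm d hd b))) := by
    intro b
    induction b using induction with
    | algebraMap r =>
      intro s m
      change _ = (_, _ + rho s (derHom lam rho hrho hcomm d hd _ (1, 0)).2)
      rw [AlgHom.commutes, AlgHom.commutes]
      simp [Module.algebraMap_end_apply, Algebra.smul_def]
    | ι x => intro s m; rw [derHom_ι, skewDer_ι hrho1]
    | mul a b ha hb =>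
      intro s m
      have h : skewDer lam rho hrho hcomm d hd (a * b)
          = lam a (skewDer lam rho hrho hcomm d hd b)
            + rho b (skewDer lam rho hrho hcomm d hd a) := by
        change (derHom lam rho hrho hcomm d hd (a * b) (1, 0)).2 = _
        rw [map_mul, Module.End.mul_apply, hb, ha]
        simp [hrho1]
      rw [h, map_mul, Module.End.mul_apply, hb, ha, map_mul lam, Module.End.mul_apply, hrho,
        map_add, map_add, hcomm, mul_assoc, add_assoc]
    | add a b ha hb =>
      intro s m
      rw [map_add, LinearMap.add_apply, ha, hb, map_add, map_add, map_add, LinearMap.add_apply,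
        Prod.mk_add_mk, add_mul]
      congr 1; abel
  exact key b s m

theorem skewDer_mul (hrho1 : ∀ m, rho 1 m = m) (a b : SuperSym e) :
    skewDer lam rho hrho hcomm d hd (a * b)
      = lam a (skewDer lam rho hrho hcomm d hd b)
        + rho b (skewDer lam rho hrho hcomm d hd a) := by
  change (derHom lam rho hrho hcomm d hd (a * b) (1, 0)).2 = _
  rw [map_mul, Module.End.mul_apply, derHom_apply hrho1, derHom_apply hrho1]
  simp [hrho1]

theorem skewDer_algebraMap (r : ℂ) :
    skewDer lam rho hrho hcomm d hd (algebraMap ℂ _ r) = 0 := by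
  change (derHom lam rho hrho hcomm d hd _ (1, 0)).2 = 0
  rw [AlgHom.commutes]
  simp [Module.algebraMap_end_apply]

end SkewDerivation
section OddDerivation

/-- The odd derivation `D` of `S(L)` which extends an odd operator `T` of `L`; see `oddDer_ι`
and `oddDer_mul`. -/
def oddDer (T : L →ₗ[ℂ] L) (hT : ∀ x, e (T x) = -T (e x)) :
    SuperSym e →ₗ[ℂ] SuperSym e :=
  skewDer ((Algebra.lmul ℂ (SuperSym e)).comp (par e)) (LinearMap.mul ℂ (SuperSym e)).flip
    (fun s t m => (mul_assoc m s t).symm) (fun s t m => (mul_assoc (par e s) m t).symm)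
    (ι e ∘ₗ T)
    (fun i j x y hx hy => by
      have hT' : ∀ {i : ℕ} {x : L}, HasParity e i x → HasParity e (i + 1) (T x) := by
        intro i x hx
        rw [HasParity, hT, hx, map_smul, pow_succ]
        simp
      change par e (ι e x) * ι e (T y) + ι e (T x) * ι e y
        = (-1 : ℂ) ^ (i * j) • (par e (ι e y) * ι e (T x) + ι e (T y) * ι e x)
      rw [par_ι, par_ι, hx, hy, map_smul, map_smul, smul_mul_assoc, smul_mul_assoc,
        ι_swap hx (hT' hy), ι_swap (hT' hx) hy, smul_add, smul_smul, smul_smul, add_comm]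
      have h1 : (-1 : ℂ) ^ ((i + 1) * j) = (-1 : ℂ) ^ (i * j) * (-1) ^ j := by ring
      have h2 : (-1 : ℂ) ^ i * (-1) ^ (i * (j + 1)) = (-1 : ℂ) ^ (i * j) := by
        rw [← pow_add, show i + i * (j + 1) = i * j + 2 * i by ring, pow_add, pow_mul]; simp
      rw [h1, h2])

variable {T : L →ₗ[ℂ] L} {hT : ∀ x, e (T x) = -T (e x)}

@[simp] theorem oddDer_ι (x : L) : oddDer T hT (ι e x) = ι e (T x) :=
  skewDer_ι (fun m => mul_one m) x

theorem oddDer_mul (a b : SuperSym e) :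
    oddDer T hT (a * b) = oddDer T hT a * b + par e a * oddDer T hT b := by
  rw [add_comm]
  exact skewDer_mul (fun m => mul_one m) a b

@[simp] theorem oddDer_algebraMap (r : ℂ) : oddDer T hT (algebraMap ℂ _ r) = 0 :=
  skewDer_algebraMap r

theorem par_oddDer (s : SuperSym e) :
    par e (oddDer T hT s) = -oddDer T hT (par e s) := by
  induction s using induction with
  | algebraMap r => rw [AlgHom.commutes, oddDer_algebraMap]; simp
  | ι x => rw [oddDer_ι, par_ι, par_ι, oddDer_ι, hT, map_neg]
  | mul a b ha hb =>
    rw [oddDer_mul, map_add, map_mul, map_mul, ha, hb, map_mul, oddDer_mul]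
    simp [add_comm]
  | add a b ha hb => rw [map_add, map_add, ha, hb, map_add, map_add, neg_add]

end OddDerivation

/-! #### The bimodule `ℂ[χ] ⊗ S(L)`

Its elements `∑ χ^k s_k` are stored as finitely supported functions `k ↦ s_k`; the
indeterminate `χ` is odd, hence `b χ^k s = (-1)^{k p(b)} χ^k b s`. -/

section Chi

variable (e) in
/-- `b ↦ (χ^k s ↦ (-1)^{(p + k) p(b)} χ^k b s)`, i.e. the left multiplication by `b` on
`ℂ[χ] ⊗ S(L)` multiplied by the sign `(-1)^{p p(b)}`. -/
def chiLeft (p : ℕ) : SuperSym e →ₐ[ℂ] Module.End ℂ (ℕ →₀ SuperSym e) :=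
  AlgHom.ofLinearMap
    { toFun := fun b => Finsupp.lsum ℂ fun k =>
        Finsupp.lsingle k ∘ₗ LinearMap.mulLeft ℂ ((par e ^ (p + k)) b)
      map_add' := fun a b => by ext k s : 2; simp [add_mul]
      map_smul' := fun c b => by ext k s : 2; simp }
    (by ext k s : 2; simp)
    (fun a b => by ext k s : 2; simp [-Finsupp.single_mul])

theorem chiLeft_single (p k : ℕ) (b s : SuperSym e) :
    chiLeft e p b (Finsupp.single k s) = Finsupp.single k ((par e ^ (p + k)) b * s) := by
  simp [chiLeft]

theorem chiLeft_apply (p k : ℕ) (b : SuperSym e) (A : ℕ →₀ SuperSym e) :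
    chiLeft e p b A k = (par e ^ (p + k)) b * A k := by
  induction A using Finsupp.induction_linear with
  | zero => simp
  | add A B hA hB => rw [map_add, Finsupp.add_apply, hA, hB, Finsupp.add_apply, mul_add]
  | single m s =>
    rw [chiLeft_single]
    by_cases h : m = k
    · subst h; simp
    · simp [Finsupp.single_eq_of_ne (Ne.symm h)]

variable (e) in
/-- The right multiplication on `ℂ[χ] ⊗ S(L)`. -/
def chiRight : SuperSym e →ₗ[ℂ] Module.End ℂ (ℕ →₀ SuperSym e) where
  toFun c := Finsupp.mapRange.linearMap (LinearMap.mulRight ℂ c)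
  map_add' a b := by ext k s : 2; simp [mul_add]
  map_smul' c b := by ext k s : 2; simp [-Finsupp.single_mul]

theorem chiRight_apply (c : SuperSym e) (A : ℕ →₀ SuperSym e) (k : ℕ) :
    chiRight e c A k = A k * c := by
  simp [chiRight]

variable (e) in
/-- The left multiplication by `χ` on `ℂ[χ] ⊗ S(L)`. -/
def chiMul : Module.End ℂ (ℕ →₀ SuperSym e) := Finsupp.lmapDomain _ ℂ Nat.succ

/-- The operator `D` on `ℂ[χ] ⊗ S(L)`, determined by `D χ = -χ D - 2 χ²`: one has
`D (χ^k s) = χ^k D s` for even `k` and `D (χ^k s) = -χ^k D s - 2 χ^{k+1} s` for odd `k`. -/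
def chiD (D : Module.End ℂ (SuperSym e)) : Module.End ℂ (ℕ →₀ SuperSym e) :=
  Finsupp.lsum ℂ fun k =>
    if Even k then Finsupp.lsingle k ∘ₗ D
    else -(Finsupp.lsingle k ∘ₗ D) - (2 : ℂ) • Finsupp.lsingle (k + 1)

variable (e) in
/-- The parity operator `χ^k s ↦ (-1)^{k + p(s)} χ^k s` of the superspace `ℂ[χ] ⊗ S(L)`. -/
def chiPar : Module.End ℂ (ℕ →₀ SuperSym e) :=
  Finsupp.lsum ℂ fun k => (-1 : ℂ) ^ k • (Finsupp.lsingle k ∘ₗ (par e).toLinearMap)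

theorem chiMul_single (k : ℕ) (s : SuperSym e) :
    chiMul e (Finsupp.single k s) = Finsupp.single (k + 1) s := by
  simp [chiMul]

theorem chiPar_single (k : ℕ) (s : SuperSym e) :
    chiPar e (Finsupp.single k s) = Finsupp.single k ((-1 : ℂ) ^ k • par e s) := by
  simp [chiPar]

theorem chiD_single (D : Module.End ℂ (SuperSym e)) (k : ℕ) (s : SuperSym e) :
    chiD D (Finsupp.single k s) = Finsupp.single k ((-1 : ℂ) ^ k • D s)
      - (1 - (-1 : ℂ) ^ k) • Finsupp.single (k + 1) s := by
  by_cases h : Even k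
  · simp [chiD, h]
  · simp [chiD, h, Nat.not_even_iff_odd.1 h]
    norm_num

theorem chiPar_chiMul (A : ℕ →₀ SuperSym e) : chiPar e (chiMul e A) = -chiMul e (chiPar e A) := by
  induction A using Finsupp.induction_linear with
  | zero => simp
  | add A B hA hB => simp only [map_add, hA, hB, neg_add]
  | single m s =>
    rw [chiMul_single, chiPar_single, chiPar_single, chiMul_single, pow_succ]
    simp

theorem chiPar_chiD {D : Module.End ℂ (SuperSym e)} (hD : ∀ s, par e (D s) = -D (par e s))
    (A : ℕ →₀ SuperSym e) : chiPar e (chiD D A) = -chiD D (chiPar e A) := by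
  induction A using Finsupp.induction_linear with
  | zero => simp
  | add A B hA hB => simp only [map_add, hA, hB, neg_add]
  | single m s =>
    simp only [chiD_single, chiPar_single, map_sub, map_smul, hD, pow_succ,
      Finsupp.smul_single]
    rw [smul_comm (1 - (-1 : ℂ) ^ m) ((-1 : ℂ) ^ m)]
    simp only [smul_neg, Finsupp.single_neg, mul_neg_one, neg_smul]
    abel

theorem chiPar_apply (A : ℕ →₀ SuperSym e) (k : ℕ) :
    chiPar e A k = (-1 : ℂ) ^ k • par e (A k) := by
  induction A using Finsupp.induction_linear with
  | zero => simp
  | add A B hA hB => rw [map_add, Finsupp.add_apply, hA, hB, Finsupp.add_apply, map_add, smul_add]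
  | single m s =>
    rw [chiPar_single]
    by_cases h : m = k
    · subst h; simp
    · simp [Finsupp.single_eq_of_ne (Ne.symm h)]

/-- For a linear map `d : L → ℂ[χ] ⊗ S(L)` of parity `p`, the extension `δ` of `d` to `S(L)` by
the Leibniz rule `δ(bc) = (-1)^{p p(b)} b δ(c) + δ(b) c`; see `chiDer_ι` and `chiDer_mul`. -/
def chiDer (he : ∀ x, e (e x) = x) (p : ℕ) (d : L →ₗ[ℂ] (ℕ →₀ SuperSym e))
    (hd : ∀ x, chiPar e (d x) = (-1 : ℂ) ^ p • d (e x)) :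
    SuperSym e →ₗ[ℂ] (ℕ →₀ SuperSym e) :=
  skewDer (chiLeft e p) (chiRight e)
    (fun s t m => by ext k; simp [chiRight_apply, mul_assoc])
    (fun s t m => by ext k; simp [chiRight_apply, chiLeft_apply, mul_assoc])
    d
    (fun i j x y hx hy => by
      have key : ∀ {i j : ℕ} {x y : L}, HasParity e i x → HasParity e j y →
          chiRight e (ι e y) (d x) = (-1 : ℂ) ^ (i * j) • chiLeft e p (ι e y) (d x) := by
        intro i j x y hx hy
        ext k
        have h1 : par e (d x k) = (-1 : ℂ) ^ (i + p + k) • d x k := by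
          have h := DFunLike.congr_fun (hd x) k
          rw [chiPar_apply, hx, map_smul, smul_smul, Finsupp.smul_apply] at h
          have h' := congrArg (fun z => (-1 : ℂ) ^ k • z) h
          simp only [smul_smul, ← pow_add] at h'
          rw [Even.neg_one_pow ⟨k, rfl⟩, one_smul] at h'
          rw [h']; congr 1; ring
        have h2 : ∀ l, (par e ^ l) (d x k) = (-1 : ℂ) ^ (l * (i + p + k)) • d x k := by
          intro l
          induction l with
          | zero => simp
          | succ l ih =>
            rw [pow_succ', AlgHom.mul_apply, ih, map_smul, h1, smul_smul]
            congr 1; ring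
        rw [chiRight_apply, Finsupp.smul_apply, chiLeft_apply, par_pow_ι _ hy, smul_mul_assoc,
          ι_mul he hy, h2, smul_mul_assoc, smul_smul, smul_smul, ← pow_add, ← pow_add,
          show i * j + (p + k) * j + j * (i + p + k) = 2 * (j * (i + p + k)) by ring, pow_mul]
        simp
      rw [key hx hy, key hy hx, smul_add, smul_smul, ← pow_add,
        Even.neg_one_pow (n := i * j + j * i) ⟨i * j, by ring⟩, one_smul, add_comm])

variable {he : ∀ x, e (e x) = x} {p : ℕ} {d : L →ₗ[ℂ] (ℕ →₀ SuperSym e)}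
  {hd : ∀ x, chiPar e (d x) = (-1 : ℂ) ^ p • d (e x)}

theorem chiDer_ι (x : L) : chiDer he p d hd (ι e x) = d x :=
  skewDer_ι (fun m => by ext k; simp [chiRight_apply]) x

theorem chiDer_mul (b c : SuperSym e) :
    chiDer he p d hd (b * c)
      = chiLeft e p b (chiDer he p d hd c) + chiRight e c (chiDer he p d hd b) :=
  skewDer_mul (fun m => by ext k; simp [chiRight_apply]) b c

end Chi

end SuperSym
end Supersymmetric

/-! ### Lie superalgebras of matrices and their SUSY affine Poisson vertex algebras -/

abbrev Mat (m : ℕ) : Type := Matrix (Fin m) (Fin m) ℂ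

section Lie

variable {m : ℕ}

/-- The parity `p(i)` of the `i`-th basis vector. The index set `{1, …, m}` is numbered from zero
here, `i : Fin m` standing for `i + 1`; so the odd basis vectors are those with an even label. -/
def pI (i : Fin m) : ℕ := (i : ℕ) % 2

/-- The parity operator `e_ij ↦ (-1)^{p(i)+p(j)} e_ij`. -/
def eps : Mat m →ₗ[ℂ] Mat m where
  toFun a := Matrix.of fun i j => (-1 : ℂ) ^ (pI i + pI j) * a i j
  map_add' a b := by ext i j; simp [mul_add]
  map_smul' c a := by ext i j; simp [mul_left_comm]

/-- The homogeneous component of parity `p` of a matrix. -/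
def homPart (p : ℕ) : Mat m →ₗ[ℂ] Mat m :=
  (2⁻¹ : ℂ) • (LinearMap.id + (-1 : ℂ) ^ p • eps)

/-- The supercommutator `[a, b] = a b - (-1)^{p(a)p(b)} b a`, extended bilinearly. -/
def sbr (a : Mat m) : Mat m →ₗ[ℂ] Mat m :=
  ∑ p ∈ Finset.range 2, ∑ q ∈ Finset.range 2,
    (LinearMap.mulLeft ℂ (homPart p a) - (-1 : ℂ) ^ (p * q) • LinearMap.mulRight ℂ (homPart p a))
      ∘ₗ homPart q

/-- The supertrace. -/
def str : Mat m →ₗ[ℂ] ℂ where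
  toFun a := ∑ i, (-1 : ℂ) ^ pI i * a i i
  map_add' a b := by simp [mul_add, Finset.sum_add_distrib]
  map_smul' c a := by simp [Finset.mul_sum, mul_left_comm]

/-- The supertrace form `(a|b) = str(ab)`. -/
def form (a b : Mat m) : ℂ := str (a * b)

theorem eps_eps (a : Mat m) : eps (eps a) = a := by
  ext i j
  simp only [eps, LinearMap.coe_mk, AddHom.coe_mk, Matrix.of_apply, ← mul_assoc, ← pow_add]
  rw [Even.neg_one_pow ⟨_, rfl⟩, one_mul]

theorem eps_mul (a b : Mat m) : eps (a * b) = eps a * eps b := by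
  ext i j
  simp only [eps, LinearMap.coe_mk, AddHom.coe_mk, Matrix.of_apply, Matrix.mul_apply,
    Finset.mul_sum]
  refine Finset.sum_congr rfl fun k _ => ?_
  have : (-1 : ℂ) ^ pI k * (-1) ^ pI k = 1 := by rw [← pow_add, Even.neg_one_pow ⟨_, rfl⟩]
  rw [pow_add, pow_add, pow_add]
  linear_combination (-(-1 : ℂ) ^ pI i * (-1) ^ pI j * a i k * b k j) * this

theorem str_eps (a : Mat m) : str (eps a) = str a := by
  simp only [str, eps, LinearMap.coe_mk, AddHom.coe_mk, Matrix.of_apply]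
  refine Finset.sum_congr rfl fun i _ => ?_
  rw [Even.neg_one_pow (n := pI i + pI i) ⟨_, rfl⟩, one_mul]

theorem homPart_apply (p : ℕ) (a : Mat m) :
    homPart p a = (2⁻¹ : ℂ) • (a + (-1 : ℂ) ^ p • eps a) := rfl

theorem eps_homPart (p : ℕ) (a : Mat m) : eps (homPart p a) = (-1 : ℂ) ^ p • homPart p a := by
  have h : (-1 : ℂ) ^ p * (-1) ^ p = 1 := by rw [← pow_add, Even.neg_one_pow ⟨_, rfl⟩]
  rw [homPart_apply, map_smul, map_add, map_smul, eps_eps, smul_comm ((-1 : ℂ) ^ p) (2⁻¹ : ℂ),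
    smul_add ((-1 : ℂ) ^ p), smul_smul ((-1 : ℂ) ^ p), h, one_smul, add_comm]

theorem homPart_eps (p : ℕ) (a : Mat m) : homPart p (eps a) = (-1 : ℂ) ^ p • homPart p a := by
  rw [← eps_homPart, homPart_apply, homPart_apply, map_smul, map_add, map_smul]

theorem sbr_apply (a b : Mat m) :
    sbr a b = ∑ p ∈ Finset.range 2, ∑ q ∈ Finset.range 2,
      (homPart p a * homPart q b - (-1 : ℂ) ^ (p * q) • (homPart q b * homPart p a)) := by
  simp only [sbr, LinearMap.sum_apply, LinearMap.comp_apply, LinearMap.sub_apply,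
    LinearMap.smul_apply, LinearMap.mulLeft_apply, LinearMap.mulRight_apply]

theorem eps_sbr (a b : Mat m) : eps (sbr a b) = sbr (eps a) (eps b) := by
  simp only [sbr_apply, map_sum, map_sub, map_smul, eps_mul, homPart_eps, eps_homPart]

variable (m) in
/-- A Lie sub-superalgebra of the general linear Lie superalgebra on `Fin m`: a graded subspace
closed under the supercommutator. -/
structure LieSub where
  carrier : Submodule ℂ (Mat m)
  graded : ∀ a ∈ carrier, eps a ∈ carrier
  bracket : ∀ a ∈ carrier, ∀ b ∈ carrier, sbr a b ∈ carrier

variable (g : LieSub m)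

namespace LieSub

/-- The underlying vector space of `𝔤`. -/
def T : Type := g.carrier

instance : AddCommGroup g.T := inferInstanceAs (AddCommGroup g.carrier)

instance : Module ℂ g.T := inferInstanceAs (Module ℂ g.carrier)

/-- The inclusion of `𝔤` into the space of matrices. -/
def val : g.T →ₗ[ℂ] Mat m := g.carrier.subtype

theorem val_mem (a : g.T) : g.val a ∈ g.carrier := Subtype.property a

theorem val_injective : Function.Injective g.val := Subtype.val_injective

/-- A matrix in `𝔤` as an element of `𝔤`. -/
def elt (a : Mat m) (ha : a ∈ g.carrier) : g.T := ⟨a, ha⟩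

@[simp] theorem val_elt (a : Mat m) (ha : a ∈ g.carrier) : g.val (g.elt a ha) = a := rfl

/-- A linear map into the space of matrices with values in `𝔤`, as a linear map into `𝔤`. -/
def corestrict {E : Type} [AddCommGroup E] [Module ℂ E] (φ : E →ₗ[ℂ] Mat m)
    (h : ∀ a, φ a ∈ g.carrier) : E →ₗ[ℂ] g.T where
  toFun a := g.elt (φ a) (h a)
  map_add' a b := g.val_injective (by simp)
  map_smul' c a := g.val_injective (by simp)

@[simp] theorem val_corestrict {E : Type} [AddCommGroup E] [Module ℂ E] (φ : E →ₗ[ℂ] Mat m)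
    (h : ∀ a, φ a ∈ g.carrier) (a : E) : g.val (g.corestrict φ h a) = φ a := rfl

/-- The parity operator of `𝔤`. -/
def parOp : g.T →ₗ[ℂ] g.T := g.corestrict (eps ∘ₗ g.val) fun a => g.graded _ (g.val_mem a)

/-- The homogeneous components of an element of `𝔤`. -/
def part (p : ℕ) : g.T →ₗ[ℂ] g.T :=
  g.corestrict (homPart p ∘ₗ g.val) fun a => g.carrier.smul_mem _
    (g.carrier.add_mem (g.val_mem a) (g.carrier.smul_mem _ (g.graded _ (g.val_mem a))))

/-- The adjoint action of `𝔤`. -/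
def ad (a : g.T) : g.T →ₗ[ℂ] g.T :=
  g.corestrict (sbr (g.val a) ∘ₗ g.val) fun b => g.bracket _ (g.val_mem a) _ (g.val_mem b)

/-- The `ℂ[D]`-module `ℂ[D] ⊗ 𝔤̄`: the function `k ↦ a_k` stands for `∑ D^k ā_k`. -/
abbrev Cur : Type := ℕ →₀ g.T

/-- The parity operator of `ℂ[D] ⊗ 𝔤̄`: the parity of `D^k ā` is `k + p(a) + 1`. -/
def curPar : g.Cur →ₗ[ℂ] g.Cur :=
  Finsupp.lsum ℂ fun k => (-1 : ℂ) ^ (k + 1) • (Finsupp.lsingle k ∘ₗ g.parOp)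

/-- The operator `D` of `ℂ[D] ⊗ 𝔤̄`. -/
def curD : g.Cur →ₗ[ℂ] g.Cur := Finsupp.lmapDomain _ ℂ Nat.succ

theorem curPar_single (k : ℕ) (a : g.T) :
    g.curPar (Finsupp.single k a) = Finsupp.single k ((-1 : ℂ) ^ (k + 1) • g.parOp a) := by
  simp [curPar]

theorem curD_single (k : ℕ) (a : g.T) :
    g.curD (Finsupp.single k a) = Finsupp.single (k + 1) a := by
  simp [curD]

theorem parOp_parOp (a : g.T) : g.parOp (g.parOp a) = a := g.val_injective (eps_eps _)

theorem curPar_curPar (x : g.Cur) : g.curPar (g.curPar x) = x := by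
  induction x using Finsupp.induction_linear with
  | zero => simp
  | add x y hx hy => rw [map_add, map_add, hx, hy]
  | single k a =>
    rw [curPar_single, curPar_single, map_smul, parOp_parOp, smul_smul, ← pow_add,
      Even.neg_one_pow ⟨_, rfl⟩, one_smul]

theorem curPar_curD (x : g.Cur) : g.curPar (g.curD x) = -g.curD (g.curPar x) := by
  induction x using Finsupp.induction_linear with
  | zero => simp
  | add x y hx hy => simp only [map_add, hx, hy, neg_add]
  | single k a =>
    rw [curD_single, curPar_single, curPar_single, curD_single, pow_succ]
    simp

/-- The differential superalgebra `𝒱(𝔤̄) = S(ℂ[D] ⊗ 𝔤̄)`. -/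
abbrev V : Type := SuperSym g.curPar

/-- The odd derivation `D` of `𝒱(𝔤̄)`. -/
def D : Module.End ℂ g.V := SuperSym.oddDer g.curD g.curPar_curD

/-- The element `ā` of `𝒱(𝔤̄)`. -/
def bar : g.T →ₗ[ℂ] g.V := SuperSym.ι g.curPar ∘ₗ Finsupp.lsingle 0

theorem par_bar (a : g.T) : SuperSym.par _ (g.bar a) = -g.bar (g.parOp a) := by
  simp [bar, curPar_single]

/-- The `χ`-bracket of generators
`[ā_χ b̄] = (-1)^{p(a)(p(b)+1)} \overline{[a,b]} + χ (a|b)`, for the component of parity `p`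
of `a`, and extended linearly in `b`. -/
def genBr (p : ℕ) (a : g.T) : g.T →ₗ[ℂ] (ℕ →₀ g.V) :=
  ∑ q ∈ Finset.range 2,
    ((-1 : ℂ) ^ (p * (q + 1)) • (Finsupp.lsingle 0 ∘ₗ g.bar ∘ₗ g.ad (g.part p a))
      + Finsupp.lsingle 1 ∘ₗ Algebra.linearMap ℂ g.V ∘ₗ str ∘ₗ
          LinearMap.mulLeft ℂ (homPart p (g.val a)) ∘ₗ g.val) ∘ₗ g.part q

theorem genBr_apply (p : ℕ) (a b : g.T) : g.genBr p a b = ∑ q ∈ Finset.range 2,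
    ((-1 : ℂ) ^ (p * (q + 1)) • Finsupp.single 0 (g.bar (g.ad (g.part p a) (g.part q b)))
      + Finsupp.single 1
          (algebraMap ℂ g.V (form (g.val (g.part p a)) (g.val (g.part q b))))) := by
  rw [genBr, LinearMap.sum_apply]
  rfl

/-- The `χ`-bracket `[ā_χ ·] : ℂ[D] ⊗ 𝔤̄ → ℂ[χ] ⊗ 𝒱(𝔤̄)`, for the component of parity `p` of `a`,
determined by the sesquilinearity `[ā_χ D x] = (-1)^{p(ā)+1} (D + χ) [ā_χ x]`. -/
def curBr (p : ℕ) (a : g.T) : g.Cur →ₗ[ℂ] (ℕ →₀ g.V) :=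
  Finsupp.lsum ℂ fun k =>
    (((-1 : ℂ) ^ p • (SuperSym.chiD g.D + SuperSym.chiMul g.curPar)) ^ k) ∘ₗ g.genBr p a

theorem curBr_single (p : ℕ) (a : g.T) (k : ℕ) (b : g.T) :
    g.curBr p a (Finsupp.single k b)
      = (((-1 : ℂ) ^ p • (SuperSym.chiD g.D + SuperSym.chiMul g.curPar)) ^ k)
          (g.genBr p a b) := by
  rw [curBr, Finsupp.lsum_single]
  rfl

theorem parOp_part (p : ℕ) (a : g.T) : g.parOp (g.part p a) = (-1 : ℂ) ^ p • g.part p a :=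
  g.val_injective (eps_homPart p _)

theorem part_parOp (p : ℕ) (a : g.T) : g.part p (g.parOp a) = (-1 : ℂ) ^ p • g.part p a :=
  g.val_injective (homPart_eps p _)

theorem parOp_ad (a b : g.T) : g.parOp (g.ad a b) = g.ad (g.parOp a) (g.parOp b) :=
  g.val_injective (eps_sbr _ _)

theorem ad_smul (c : ℂ) (a b : g.T) : g.ad (c • a) b = c • g.ad a b := by
  refine g.val_injective ?_
  change sbr (c • g.val a) (g.val b) = c • sbr (g.val a) (g.val b)
  simp [sbr_apply, Finset.sum_range_succ, smul_sub, smul_add]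

theorem form_part (p q : ℕ) (a b : g.T) :
    form (g.val (g.part p a)) (g.val (g.part q b))
      = (-1 : ℂ) ^ (p + q) * form (g.val (g.part p a)) (g.val (g.part q b)) := by
  change str (homPart p (g.val a) * homPart q (g.val b))
    = _ * str (homPart p (g.val a) * homPart q (g.val b))
  conv_lhs => rw [← str_eps, eps_mul, eps_homPart, eps_homPart]
  simp only [smul_mul_assoc, mul_smul_comm, map_smul, smul_eq_mul, pow_add]
  ring

theorem chiPar_genBr (p : ℕ) (a b : g.T) :
    SuperSym.chiPar g.curPar (g.genBr p a b) = -((-1 : ℂ) ^ p • g.genBr p a (g.parOp b)) := by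
  rw [genBr_apply, genBr_apply, map_sum, Finset.smul_sum, ← Finset.sum_neg_distrib]
  refine Finset.sum_congr rfl fun q _ => ?_
  rw [map_add, map_smul, SuperSym.chiPar_single, SuperSym.chiPar_single, par_bar, parOp_ad,
    parOp_part, parOp_part, part_parOp, ad_smul, map_smul (g.ad _),
    AlgHom.commutes]
  have h := g.form_part p q a b
  have h2 : form (g.val (g.part p a)) (g.val ((-1 : ℂ) ^ q • g.part q b))
      = (-1 : ℂ) ^ q * form (g.val (g.part p a)) (g.val (g.part q b)) := by
    simp [form]
  rw [h2, smul_add, neg_add]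
  congr 1
  · simp only [map_smul, Finsupp.smul_single, smul_neg, Finsupp.single_neg, smul_smul, pow_zero,
      one_mul]
    congr 3; ring
  · rw [Finsupp.smul_single, ← Finsupp.single_neg]
    congr 1
    rw [pow_one, neg_one_smul, Algebra.algebraMap_eq_smul_one, Algebra.algebraMap_eq_smul_one,
      smul_smul, ← mul_assoc, ← pow_add, ← h]

theorem chiPar_curBr (p : ℕ) (a : g.T) (x : g.Cur) :
    SuperSym.chiPar g.curPar (g.curBr p a x) = (-1 : ℂ) ^ p • g.curBr p a (g.curPar x) := by
  have hT : ∀ (k : ℕ) (A : ℕ →₀ g.V), SuperSym.chiPar g.curPar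
      ((((-1 : ℂ) ^ p • (SuperSym.chiD g.D + SuperSym.chiMul g.curPar)) ^ k) A)
      = (-1 : ℂ) ^ k • (((-1 : ℂ) ^ p • (SuperSym.chiD g.D + SuperSym.chiMul g.curPar)) ^ k)
          (SuperSym.chiPar g.curPar A) := by
    intro k
    induction k with
    | zero => simp
    | succ k ih =>
      intro A
      rw [pow_succ, Module.End.mul_apply, ih, Module.End.mul_apply, pow_succ]
      simp only [LinearMap.smul_apply, LinearMap.add_apply, map_smul, map_add,
        SuperSym.chiPar_chiMul, SuperSym.chiPar_chiD (D := g.D) SuperSym.par_oddDer, map_neg]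
      module
  induction x using Finsupp.induction_linear with
  | zero => simp
  | add x y hx hy => rw [map_add, map_add, hx, hy, map_add, map_add, smul_add]
  | single k b =>
    rw [curBr_single, hT, chiPar_genBr, curPar_single, curBr_single]
    simp only [map_neg, map_smul, pow_succ]
    module

/-- The `χ`-bracket `w ↦ {ā_χ w}` of the SUSY affine Poisson vertex algebra `𝒱(𝔤̄)` of level one,
for `a ∈ 𝔤`: it is determined by its values on `ℂ[D] ⊗ 𝔤̄` and by the Leibniz rule
`{ā_χ bc} = (-1)^{(p(ā)+1)p(b)} b {ā_χ c} + {ā_χ b} c`. -/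
def chiBr (a : g.T) : g.V →ₗ[ℂ] (ℕ →₀ g.V) :=
  ∑ p ∈ Finset.range 2,
    SuperSym.chiDer g.curPar_curPar p (g.curBr p a) (g.chiPar_curBr p a)

end LieSub
end Lie

/-! ### SUSY classical W-algebras -/

namespace LieSub

variable {m : ℕ} (g : LieSub m)

/-- The component `𝔤_{k/2}` of the grading of `𝔤` by the eigenvalues of `ad x`. -/
def gr (x : g.T) (k : ℤ) : Submodule ℂ g.T := Module.End.eigenspace (g.ad x) ((k : ℂ) / 2)

/-- `𝔫 = ⨁_{i > 0} 𝔤_i`. -/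
def nPart (x : g.T) : Submodule ℂ g.T := ⨆ k : ℤ, ⨆ _ : 0 < k, g.gr x k

/-- `𝔭 = ⨁_{i ≤ 0} 𝔤_i`. -/
def pPart (x : g.T) : Submodule ℂ g.T := ⨆ k : ℤ, ⨆ _ : k ≤ 0, g.gr x k

/-- The subalgebra `𝒱(𝔭̄) = S(ℂ[D] ⊗ 𝔭̄)` of `𝒱(𝔤̄)`. -/
def Vp (x : g.T) : Subalgebra ℂ g.V :=
  Algebra.adjoin ℂ {s | ∃ (k : ℕ) (a : g.T), a ∈ g.pPart x ∧
    s = SuperSym.ι g.curPar (Finsupp.single k a)}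

/-- The differential algebra ideal of `𝒱(𝔤̄)` generated by `n̄ - (f|n)`, `n ∈ 𝔫`. -/
def idealI (x f : g.T) : TwoSidedIdeal g.V :=
  sInf {I | (∀ a ∈ g.nPart x, g.bar a - algebraMap ℂ g.V (form (g.val f) (g.val a)) ∈ I) ∧
    ∀ s ∈ I, g.D s ∈ I}

/-- The SUSY classical W-algebra `𝒲(𝔤̄, f)`, where the grading of `𝔤` is given by `ad x`: the
`w ∈ 𝒱(𝔭̄)` such that all coefficients of `{n̄_χ w}` lie in the ideal, for all `n ∈ 𝔫`. -/
def W (x f : g.T) : Set g.V :=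
  {w | w ∈ g.Vp x ∧ ∀ a ∈ g.nPart x, ∀ k : ℕ, g.chiBr a w k ∈ g.idealI x f}

section Functoriality

variable {m' : ℕ} {g} {h : LieSub m'}

/-- The map `ℂ[D] ⊗ 𝔤̄ → ℂ[D] ⊗ 𝔥̄` induced by a linear map `𝔤 → 𝔥`. -/
def curMap (φ : g.T →ₗ[ℂ] h.T) : g.Cur →ₗ[ℂ] h.Cur := Finsupp.mapRange.linearMap φ

theorem curMap_single (φ : g.T →ₗ[ℂ] h.T) (k : ℕ) (a : g.T) :
    curMap φ (Finsupp.single k a) = Finsupp.single k (φ a) := by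
  simp [curMap]

theorem curMap_apply (φ : g.T →ₗ[ℂ] h.T) (x : g.Cur) (k : ℕ) : curMap φ x k = φ (x k) := rfl

theorem curPar_curMap (φ : g.T →ₗ[ℂ] h.T) (hφ : ∀ a, h.parOp (φ a) = φ (g.parOp a)) (x : g.Cur) :
    h.curPar (curMap φ x) = curMap φ (g.curPar x) := by
  induction x using Finsupp.induction_linear with
  | zero => simp
  | add x y hx hy => simp only [map_add, hx, hy]
  | single k a => rw [curMap_single, curPar_single, curPar_single, curMap_single, map_smul, hφ]

theorem curD_curMap (φ : g.T →ₗ[ℂ] h.T) (x : g.Cur) :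
    h.curD (curMap φ x) = curMap φ (g.curD x) := by
  induction x using Finsupp.induction_linear with
  | zero => simp
  | add x y hx hy => simp only [map_add, hx, hy]
  | single k a => rw [curMap_single, curD_single, curD_single, curMap_single]

/-- The algebra homomorphism `𝒱(𝔤̄) → 𝒱(𝔥̄)` induced by an even linear map `𝔤 → 𝔥`. -/
def Vmap (φ : g.T →ₗ[ℂ] h.T) (hφ : ∀ a, h.parOp (φ a) = φ (g.parOp a)) : g.V →ₐ[ℂ] h.V :=
  SuperSym.map (curMap φ) (curPar_curMap φ hφ)

theorem Vmap_ι (φ : g.T →ₗ[ℂ] h.T) (hφ : ∀ a, h.parOp (φ a) = φ (g.parOp a)) (x : g.Cur) :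
    Vmap φ hφ (SuperSym.ι g.curPar x) = SuperSym.ι h.curPar (curMap φ x) :=
  SuperSym.map_ι _ _ x

theorem Vmap_par (φ : g.T →ₗ[ℂ] h.T) (hφ : ∀ a, h.parOp (φ a) = φ (g.parOp a)) (s : g.V) :
    Vmap φ hφ (SuperSym.par _ s) = SuperSym.par _ (Vmap φ hφ s) := by
  induction s using SuperSym.induction with
  | algebraMap r => simp only [AlgHom.commutes]
  | ι x => rw [SuperSym.par_ι, Vmap_ι, Vmap_ι, SuperSym.par_ι, curPar_curMap φ hφ]
  | mul a b ha hb => simp only [map_mul, ha, hb]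
  | add a b ha hb => simp only [map_add, ha, hb]

theorem D_mul (a b : g.V) : g.D (a * b) = g.D a * b + SuperSym.par _ a * g.D b :=
  SuperSym.oddDer_mul a b

theorem D_ι (x : g.Cur) : g.D (SuperSym.ι g.curPar x) = SuperSym.ι g.curPar (g.curD x) :=
  SuperSym.oddDer_ι x

theorem D_algebraMap (r : ℂ) : g.D (algebraMap ℂ g.V r) = 0 := SuperSym.oddDer_algebraMap r

theorem Vmap_D (φ : g.T →ₗ[ℂ] h.T) (hφ : ∀ a, h.parOp (φ a) = φ (g.parOp a)) (s : g.V) :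
    Vmap φ hφ (g.D s) = h.D (Vmap φ hφ s) := by
  induction s using SuperSym.induction with
  | algebraMap r => simp only [D_algebraMap, AlgHom.commutes, map_zero]
  | ι x => rw [D_ι, Vmap_ι, Vmap_ι, D_ι, curD_curMap]
  | mul a b ha hb => simp only [D_mul, map_add, map_mul, ha, hb, Vmap_par]
  | add a b ha hb => simp only [map_add, ha, hb]

end Functoriality

end LieSub

/-! ### The Lie superalgebras `𝔤𝔩(2n+1|2n)` and `𝔬𝔰𝔭(2n+1|2n)` -/

/-- The general linear Lie superalgebra on `Fin m`. -/
def gl (m : ℕ) : LieSub m where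
  carrier := ⊤
  graded _ _ := trivial
  bracket _ _ _ _ := trivial

section Osp

/-- The exponents `δ_k`: in the numbering from one, `δ_k = 1` for `k ∈ {2n+2, 2n+4, …, 4n}` and
`δ_k = 0` otherwise. -/
def delta (n : ℕ) (i : Fin (4 * n + 1)) : ℕ := if (i : ℕ) % 2 = 1 ∧ 2 * n < (i : ℕ) then 1 else 0

/-- The matrix `J = ∑_k (-1)^{δ_k} e_{k k'}`, where `k' = 4n + 2 - k` in the numbering from one. -/
def matJ (n : ℕ) : Mat (4 * n + 1) :=
  Matrix.of fun k l => if l = Fin.rev k then (-1 : ℂ) ^ delta n k else 0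

/-- The supertranspose `a^{st} = ∑ (-1)^{(p(i)+1)p(j)} a_ij e_ji`. -/
def sTransp {m : ℕ} : Mat m →ₗ[ℂ] Mat m where
  toFun a := Matrix.of fun j i => (-1 : ℂ) ^ ((pI i + 1) * pI j) * a i j
  map_add' a b := by ext i j; simp [mul_add]
  map_smul' c a := by ext i j; simp [mul_left_comm]

/-- The exponent of the sign `τ(i,j) = (-1)^{p(i)p(j)+p(j)+1+δ_i+δ_j}`. -/
def tauExp (n : ℕ) (i j : Fin (4 * n + 1)) : ℕ :=
  pI i * pI j + pI j + 1 + delta n i + delta n j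

/-- The automorphism `θ : e_ij ↦ τ(i,j) e_{j'i'}` of `𝔤𝔩(2n+1|2n)`. -/
def theta (n : ℕ) : Mat (4 * n + 1) →ₗ[ℂ] Mat (4 * n + 1) where
  toFun a := Matrix.of fun k l => (-1 : ℂ) ^ tauExp n l.rev k.rev * a l.rev k.rev
  map_add' a b := by ext i j; simp [mul_add]
  map_smul' c a := by ext i j; simp [mul_left_comm]

variable {n : ℕ}

theorem theta_apply (a : Mat (4 * n + 1)) (k l : Fin (4 * n + 1)) :
    theta n a k l = (-1 : ℂ) ^ tauExp n l.rev k.rev * a l.rev k.rev := rfl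

theorem theta_single (i j : Fin (4 * n + 1)) :
    theta n (Matrix.single i j 1) = (-1 : ℂ) ^ tauExp n i j • Matrix.single j.rev i.rev 1 := by
  ext k l
  rw [theta_apply, Matrix.smul_apply, Matrix.single_apply, Matrix.single_apply, smul_eq_mul]
  by_cases h : i = l.rev ∧ j = k.rev
  · rw [if_pos h, if_pos ⟨by rw [h.2, Fin.rev_rev], by rw [h.1, Fin.rev_rev]⟩, h.1, h.2]
  · rw [if_neg h, if_neg, mul_zero, mul_zero]
    rintro ⟨h1, h2⟩
    exact h ⟨by rw [← h2, Fin.rev_rev], by rw [← h1, Fin.rev_rev]⟩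

theorem pI_rev (i : Fin (4 * n + 1)) : pI i.rev = pI i := by
  simp only [pI, Fin.val_rev]
  omega

theorem delta_rev (i : Fin (4 * n + 1)) : delta n i.rev + delta n i = pI i := by
  simp only [delta, pI, Fin.val_rev]
  split_ifs <;> omega

theorem theta_theta (a : Mat (4 * n + 1)) : theta n (theta n a) = a := by
  ext k l
  rw [theta_apply, theta_apply, Fin.rev_rev, Fin.rev_rev, ← mul_assoc, ← pow_add]
  have h1 := delta_rev (n := n) k
  have h2 := delta_rev (n := n) l
  rw [Even.neg_one_pow, one_mul]
  simp only [tauExp, pI_rev]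
  refine ⟨pI k * pI l + pI k + pI l + 1, ?_⟩
  rw [mul_comm (pI l) (pI k)]
  omega

/-- The defining condition of `𝔬𝔰𝔭(2n+1|2n)` in terms of `θ`. -/
theorem osp_iff (a : Mat (4 * n + 1)) :
    sTransp a * matJ n + matJ n * a = 0 ↔ theta n a = a := by
  have h : ∀ k l, (sTransp a * matJ n + matJ n * a) k l
      = (-1 : ℂ) ^ delta n k * (a k.rev l - theta n a k.rev l) := by
    intro k l
    have e1 : (sTransp a * matJ n) k l
        = (-1 : ℂ) ^ ((pI l.rev + 1) * pI k) * a l.rev k * (-1 : ℂ) ^ delta n l.rev := by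
      rw [Matrix.mul_apply, Finset.sum_eq_single l.rev]
      · simp [sTransp, matJ]
      · intro b _ hb
        have : l ≠ b.rev := fun h => hb (by rw [h, Fin.rev_rev])
        simp [matJ, this]
      · simp
    have e2 : (matJ n * a) k l = (-1 : ℂ) ^ delta n k * a k.rev l := by
      rw [Matrix.mul_apply, Finset.sum_eq_single k.rev]
      · simp [matJ]
      · intro b _ hb
        simp [matJ, hb]
      · simp
    rw [Matrix.add_apply, e1, e2, theta_apply, Fin.rev_rev]
    have e3 : (-1 : ℂ) ^ delta n k * (-1 : ℂ) ^ tauExp n l.rev k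
        = -((-1 : ℂ) ^ ((pI l.rev + 1) * pI k) * (-1 : ℂ) ^ delta n l.rev) := by
      have e4 : (-1 : ℂ) ^ delta n k * (-1) ^ delta n k = 1 := by
        rw [← pow_add, Even.neg_one_pow ⟨_, rfl⟩]
      simp only [tauExp, pow_add, pow_one, add_mul, one_mul]
      linear_combination (-(-1 : ℂ) ^ (pI l.rev * pI k) * (-1 : ℂ) ^ pI k
        * (-1 : ℂ) ^ delta n l.rev) * e4
    linear_combination (a l.rev k) * e3
  constructor
  · intro h0
    ext k l
    have h1 := h k.rev l
    rw [h0, Fin.rev_rev] at h1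
    have h2 := (mul_eq_zero.1 h1.symm).resolve_left (pow_ne_zero _ (by norm_num))
    exact (sub_eq_zero.1 h2).symm
  · intro h0
    ext k l
    rw [h, h0, sub_self, mul_zero]
    rfl

theorem eps_theta (a : Mat (4 * n + 1)) : eps (theta n a) = theta n (eps a) := by
  ext k l
  simp only [eps, theta_apply, LinearMap.coe_mk, AddHom.coe_mk, Matrix.of_apply, pI_rev]
  rw [add_comm (pI k), mul_left_comm]

theorem neg_one_pow_eq_neg {A B : ℕ} (h : (A + 1) % 2 = B % 2) :
    (-1 : ℂ) ^ A = -(-1 : ℂ) ^ B := by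
  rw [neg_one_pow_eq_pow_mod_two (n := B), ← h, ← neg_one_pow_eq_pow_mod_two, pow_succ]
  ring

theorem theta_mul {p q : ℕ} {a b : Mat (4 * n + 1)} (ha : eps a = (-1 : ℂ) ^ p • a)
    (hb : eps b = (-1 : ℂ) ^ q • b) :
    theta n (a * b) = -((-1 : ℂ) ^ (p * q) • (theta n b * theta n a)) := by
  have key : ∀ {p : ℕ} {a : Mat (4 * n + 1)}, eps a = (-1 : ℂ) ^ p • a → ∀ i j,
      a i j ≠ 0 → (-1 : ℂ) ^ p = (-1) ^ (pI i + pI j) := by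
    intro p a ha i j h
    have h1 := congrFun (congrFun ha i) j
    simp only [eps, LinearMap.coe_mk, AddHom.coe_mk, Matrix.of_apply, Matrix.smul_apply,
      smul_eq_mul] at h1
    exact (mul_right_cancel₀ h h1).symm
  ext i j
  rw [theta_apply, Matrix.neg_apply, Matrix.smul_apply, Matrix.mul_apply, Matrix.mul_apply,
    ← Equiv.sum_comp Fin.revPerm, Finset.mul_sum, smul_eq_mul, Finset.mul_sum,
    ← Finset.sum_neg_distrib]
  refine Finset.sum_congr rfl fun k _ => ?_
  rw [theta_apply, theta_apply, Fin.revPerm_apply]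
  by_cases h1 : a j.rev k.rev = 0
  · simp [h1]
  by_cases h2 : b k.rev i.rev = 0
  · simp [h2]
  have h3 : (-1 : ℂ) ^ (p * q)
      = (-1) ^ ((pI j.rev + pI k.rev) * (pI k.rev + pI i.rev)) := by
    rw [pow_mul, key ha _ _ h1, ← pow_mul, mul_comm, pow_mul, key hb _ _ h2, ← pow_mul, mul_comm]
  have h4 : (-1 : ℂ) ^ tauExp n j.rev i.rev
      = -((-1) ^ (p * q) * ((-1) ^ tauExp n k.rev i.rev * (-1) ^ tauExp n j.rev k.rev)) := by
    rw [h3, ← pow_add, ← pow_add]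
    refine neg_one_pow_eq_neg ?_
    simp only [tauExp, pI_rev]
    have d1 := Nat.mod_two_eq_zero_or_one (i : ℕ)
    have d2 := Nat.mod_two_eq_zero_or_one (j : ℕ)
    have d3 := Nat.mod_two_eq_zero_or_one (k : ℕ)
    simp only [pI]
    rcases d1 with d1 | d1 <;> rcases d2 with d2 | d2 <;> rcases d3 with d3 | d3 <;>
      simp only [d1, d2, d3] <;> omega
  rw [h4]; ring

theorem theta_sbr (a b : Mat (4 * n + 1)) :
    theta n (sbr a b) = sbr (theta n a) (theta n b) := by
  have hh : ∀ (p : ℕ) (a : Mat (4 * n + 1)), homPart p (theta n a) = theta n (homPart p a) := by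
    intro p a
    rw [homPart_apply, homPart_apply, map_smul, map_add, map_smul, eps_theta]
  simp only [sbr_apply, map_sum, map_sub, map_smul, hh]
  refine Finset.sum_congr rfl fun p _ => Finset.sum_congr rfl fun q _ => ?_
  rw [theta_mul (eps_homPart p a) (eps_homPart q b), theta_mul (eps_homPart q b) (eps_homPart p a),
    smul_neg, smul_smul, ← pow_add, Even.neg_one_pow (n := p * q + q * p) ⟨p * q, by ring⟩, one_smul, sub_neg_eq_add]
  abel

variable (n) in
/-- The ortho-symplectic Lie superalgebra
`𝔬𝔰𝔭(2n+1|2n) = {a ∈ 𝔤𝔩(2n+1|2n) | a^{st} J + J a = 0}`. -/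
def osp : LieSub (4 * n + 1) where
  carrier :=
    { carrier := {a | sTransp a * matJ n + matJ n * a = 0}
      add_mem' := fun {a b} ha hb => by
        simp only [Set.mem_ofPred_eq, osp_iff] at ha hb ⊢
        rw [map_add, ha, hb]
      zero_mem' := by simp
      smul_mem' := fun c a ha => by
        simp only [Set.mem_ofPred_eq, osp_iff] at ha ⊢
        rw [map_smul, ha] }
  graded a ha := by
    change sTransp a * matJ n + matJ n * a = 0 at ha
    change sTransp (eps a) * matJ n + matJ n * eps a = 0
    rw [osp_iff] at ha ⊢
    rw [← eps_theta, ha]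
  bracket a ha b hb := by
    change sTransp a * matJ n + matJ n * a = 0 at ha
    change sTransp b * matJ n + matJ n * b = 0 at hb
    change sTransp (sbr a b) * matJ n + matJ n * sbr a b = 0
    rw [osp_iff] at ha hb ⊢
    rw [theta_sbr, ha, hb]

theorem mem_osp {a : Mat (4 * n + 1)} : a ∈ (osp n).carrier ↔ theta n a = a := osp_iff a

/-- The elements `F_ij = e_ij + θ(e_ij)` spanning `𝔬𝔰𝔭(2n+1|2n)`. -/
def matF (i j : Fin (4 * n + 1)) : Mat (4 * n + 1) :=
  Matrix.single i j 1 + theta n (Matrix.single i j 1)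

variable (n) in
/-- The odd principal nilpotent element `f = ∑_{i=1}^{2n} F_{i+1,i}` (numbering from one). -/
def matf : Mat (4 * n + 1) :=
  ∑ i : Fin (2 * n), matF ⟨i + 1, by omega⟩ ⟨i, by omega⟩

variable (n) in
/-- The diagonal matrix `x` with entries `n, n - 1/2, …, -n`, half of the semisimple element of the
`𝔰𝔩₂`-triple of the principal `𝔬𝔰𝔭(1|2)` which contains `f`; `e_ij` has `ad x`-eigenvalue
`(j - i)/2`. -/
def matx : Mat (4 * n + 1) := Matrix.diagonal fun i => ((2 * n : ℂ) - (i : ℕ)) / 2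

theorem matf_mem : matf n ∈ (osp n).carrier := by
  refine Submodule.sum_mem _ fun i _ => mem_osp.2 ?_
  rw [matF, map_add, theta_theta]
  exact add_comm _ _

theorem matx_mem : matx n ∈ (osp n).carrier := by
  refine mem_osp.2 ?_
  ext k l
  rw [theta_apply]
  by_cases h : k = l
  · subst h
    have h1 : (-1 : ℂ) ^ tauExp n k.rev k.rev = -1 := by
      have : Odd (tauExp n k.rev k.rev) := by
        simp only [tauExp, pI, Nat.odd_iff]
        rcases Nat.mod_two_eq_zero_or_one (k.rev : ℕ) with d | d <;> simp only [d] <;> omega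
      exact this.neg_one_pow
    have h2 : ((k.rev : Fin (4 * n + 1)) : ℕ) = 4 * n - k := by rw [Fin.val_rev]; omega
    have h3 : (k : ℕ) ≤ 4 * n := by omega
    rw [h1, matx, Matrix.diagonal_apply_eq, Matrix.diagonal_apply_eq, h2, Nat.cast_sub h3]
    push_cast
    ring
  · have : l.rev ≠ k.rev := fun h' => h (Fin.rev_injective h').symm
    rw [matx, Matrix.diagonal_apply_ne _ h, Matrix.diagonal_apply_ne _ this, mul_zero]

variable (n) in
/-- `f` as an element of `𝔬𝔰𝔭(2n+1|2n)`. -/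
def fOsp : (osp n).T := (osp n).elt (matf n) matf_mem

variable (n) in
/-- `x` as an element of `𝔬𝔰𝔭(2n+1|2n)`. -/
def xOsp : (osp n).T := (osp n).elt (matx n) matx_mem

variable (n) in
/-- `f` as an element of `𝔤𝔩(2n+1|2n)`. -/
def fGl : (gl (4 * n + 1)).T := (gl (4 * n + 1)).elt (matf n) trivial

variable (n) in
/-- `x` as an element of `𝔤𝔩(2n+1|2n)`. -/
def xGl : (gl (4 * n + 1)).T := (gl (4 * n + 1)).elt (matx n) trivial

end Osp

/-! ### The folding map -/

section Folding

variable (n : ℕ)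

/-- `ℂ[D] ⊗ 𝔤̄` as a subset of `ℂ[D] ⊗ 𝔤𝔩̄`, where `𝔤 = 𝔬𝔰𝔭(2n+1|2n)`. -/
def curG : Set (gl (4 * n + 1)).Cur :=
  {x | ∀ k, (gl (4 * n + 1)).val (x k) ∈ (osp n).carrier}

/-- `ℂ[D] ⊗ 𝔤𝔩̄^{θ̌}` as a subset of `ℂ[D] ⊗ 𝔤𝔩̄`, where `𝔤𝔩^{θ̌}` is the fixed space
of `θ̌ = -θ`. -/
def curC : Set (gl (4 * n + 1)).Cur :=
  {x | ∀ k, -theta n ((gl (4 * n + 1)).val (x k)) = (gl (4 * n + 1)).val (x k)}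

/-- The canonical map `ℂ[D] ⊗ 𝔤𝔩̄ → 𝒱(𝔤𝔩̄)`. -/
abbrev glι : (gl (4 * n + 1)).Cur →ₗ[ℂ] (gl (4 * n + 1)).V := SuperSym.ι (gl (4 * n + 1)).curPar

/-- `S(R)`, for `R = (ℂ[D] ⊗ 𝔤̄) ⊕ (ℂ[D] ⊗ 𝔤𝔩̄^{θ̌})^{⊗ 2}`: the subalgebra of `𝒱(𝔤𝔩̄)` generated by
`ℂ[D] ⊗ 𝔤̄` and the products of two elements of `ℂ[D] ⊗ 𝔤𝔩̄^{θ̌}`. -/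
def SR : Subalgebra ℂ (gl (4 * n + 1)).V :=
  Algebra.adjoin ℂ ({s | ∃ x ∈ curG n, s = glι n x} ∪
    {s | ∃ u ∈ curC n, ∃ v ∈ curC n, s = glι n u * glι n v})

/-- The subspace `(ℂ[D] ⊗ 𝔤𝔩̄^{θ̌}) S(R)` of `𝒱(𝔤𝔩̄)`. -/
def SRodd : Submodule ℂ (gl (4 * n + 1)).V :=
  Submodule.span ℂ {z | ∃ u ∈ curC n, ∃ s ∈ SR n, z = glι n u * s}

/-- `θ` as an operator of `𝔤𝔩`. -/
def thetaT : (gl (4 * n + 1)).T →ₗ[ℂ] (gl (4 * n + 1)).T :=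
  (gl (4 * n + 1)).corestrict (theta n ∘ₗ (gl (4 * n + 1)).val) fun _ => trivial

theorem parOp_thetaT (a : (gl (4 * n + 1)).T) :
    (gl (4 * n + 1)).parOp (thetaT n a) = thetaT n ((gl (4 * n + 1)).parOp a) :=
  LieSub.val_injective _ (eps_theta _)

/-- The automorphism of `𝒱(𝔤𝔩̄)` induced by `θ`. -/
def thetaV : (gl (4 * n + 1)).V →ₐ[ℂ] (gl (4 * n + 1)).V :=
  LieSub.Vmap (thetaT n) (parOp_thetaT n)

variable {n}

theorem thetaV_curG {x : (gl (4 * n + 1)).Cur} (hx : x ∈ curG n) :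
    thetaV n (glι n x) = glι n x := by
  rw [thetaV, LieSub.Vmap_ι]
  congr 1
  ext k : 1
  exact LieSub.val_injective _ (mem_osp.1 (hx k))

theorem thetaV_curC {x : (gl (4 * n + 1)).Cur} (hx : x ∈ curC n) :
    thetaV n (glι n x) = -glι n x := by
  rw [thetaV, LieSub.Vmap_ι, ← map_neg]
  congr 1
  ext k : 1
  exact LieSub.val_injective _ (neg_eq_iff_eq_neg.1 (hx k))

theorem thetaV_SR {s : (gl (4 * n + 1)).V} (hs : s ∈ SR n) : thetaV n s = s := by
  induction hs using Algebra.adjoin_induction with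
  | mem x hx =>
    rcases hx with ⟨x, hx, rfl⟩ | ⟨u, hu, v, hv, rfl⟩
    · exact thetaV_curG hx
    · rw [map_mul, thetaV_curC hu, thetaV_curC hv, neg_mul_neg]
  | algebraMap r => exact AlgHom.commutes _ r
  | add x y _ _ hx hy => rw [map_add, hx, hy]
  | mul x y _ _ hx hy => rw [map_mul, hx, hy]

theorem thetaV_SRodd {s : (gl (4 * n + 1)).V} (hs : s ∈ SRodd n) : thetaV n s = -s := by
  induction hs using Submodule.span_induction with
  | mem x hx =>
    obtain ⟨u, hu, s, hs, rfl⟩ := hx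
    rw [map_mul, thetaV_curC hu, thetaV_SR hs, neg_mul]
  | zero => rw [map_zero, neg_zero]
  | add x y _ _ hx hy => rw [map_add, hx, hy, neg_add]
  | smul c x _ hx => rw [map_smul, hx, smul_neg]

theorem cur_decomp (x : (gl (4 * n + 1)).Cur) : ∃ y ∈ curG n, ∃ z ∈ curC n, x = y + z := by
  refine ⟨(2⁻¹ : ℂ) • (x + LieSub.curMap (thetaT n) x), fun k => mem_osp.2 ?_,
    (2⁻¹ : ℂ) • (x - LieSub.curMap (thetaT n) x), fun k => ?_, ?_⟩
  · change theta n ((2⁻¹ : ℂ) • ((gl (4 * n + 1)).val (x k)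
      + theta n ((gl (4 * n + 1)).val (x k)))) = (2⁻¹ : ℂ) • ((gl (4 * n + 1)).val (x k)
      + theta n ((gl (4 * n + 1)).val (x k)))
    rw [map_smul, map_add, theta_theta, add_comm (theta n _)]
  · change -theta n ((2⁻¹ : ℂ) • ((gl (4 * n + 1)).val (x k)
      - theta n ((gl (4 * n + 1)).val (x k)))) = (2⁻¹ : ℂ) • ((gl (4 * n + 1)).val (x k)
      - theta n ((gl (4 * n + 1)).val (x k)))
    rw [map_smul, map_sub, theta_theta, ← smul_neg, neg_sub]
  · rw [← smul_add, add_add_sub_cancel, ← two_smul ℂ x, smul_smul]; norm_num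

theorem curPar_curC {x : (gl (4 * n + 1)).Cur} (hx : x ∈ curC n) :
    (gl (4 * n + 1)).curPar x ∈ curC n := by
  have h : LieSub.curMap (thetaT n) x = -x := by
    ext k : 1
    exact LieSub.val_injective _ (neg_eq_iff_eq_neg.1 (hx k))
  have h1 := LieSub.curPar_curMap (thetaT n) (parOp_thetaT n) x
  rw [h, map_neg] at h1
  intro k
  have h2 := congrArg (gl (4 * n + 1)).val (DFunLike.congr_fun h1 k)
  rw [LieSub.curMap_apply, Finsupp.neg_apply, map_neg] at h2
  change -((gl (4 * n + 1)).val (thetaT n _)) = _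
  rw [← h2, neg_neg]

theorem curD_curC {x : (gl (4 * n + 1)).Cur} (hx : x ∈ curC n) :
    (gl (4 * n + 1)).curD x ∈ curC n := by
  have h : LieSub.curMap (thetaT n) x = -x := by
    ext k : 1
    exact LieSub.val_injective _ (neg_eq_iff_eq_neg.1 (hx k))
  have h1 := LieSub.curD_curMap (thetaT n) x
  rw [h, map_neg] at h1
  intro k
  have h2 := congrArg (gl (4 * n + 1)).val (DFunLike.congr_fun h1 k)
  rw [LieSub.curMap_apply, Finsupp.neg_apply, map_neg] at h2
  change -((gl (4 * n + 1)).val (thetaT n _)) = _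
  rw [← h2, neg_neg]

theorem curD_curG {x : (gl (4 * n + 1)).Cur} (hx : x ∈ curG n) :
    (gl (4 * n + 1)).curD x ∈ curG n := by
  have h : LieSub.curMap (thetaT n) x = x := by
    ext k : 1
    exact LieSub.val_injective _ (mem_osp.1 (hx k))
  have h1 := LieSub.curD_curMap (thetaT n) x
  rw [h] at h1
  intro k
  rw [mem_osp]
  have h2 := congrArg (gl (4 * n + 1)).val (DFunLike.congr_fun h1 k)
  rw [LieSub.curMap_apply] at h2
  exact h2.symm

theorem glι_curG_mem {x : (gl (4 * n + 1)).Cur} (hx : x ∈ curG n) : glι n x ∈ SR n :=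
  Algebra.subset_adjoin (Or.inl ⟨x, hx, rfl⟩)

theorem glι_curC_mem {u v : (gl (4 * n + 1)).Cur} (hu : u ∈ curC n) (hv : v ∈ curC n) :
    glι n u * glι n v ∈ SR n :=
  Algebra.subset_adjoin (Or.inr ⟨u, hu, v, hv, rfl⟩)

theorem curG_of_hom {x : (gl (4 * n + 1)).Cur} (hx : x ∈ curG n) :
    ∃ y ∈ curG n, ∃ z ∈ curG n, x = y + z ∧ HasParity (gl (4 * n + 1)).curPar 0 y ∧
      HasParity (gl (4 * n + 1)).curPar 1 z := by
  have hp : (gl (4 * n + 1)).curPar x ∈ curG n := by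
    have h : LieSub.curMap (thetaT n) x = x := by
      ext k : 1
      exact LieSub.val_injective _ (mem_osp.1 (hx k))
    have h1 := LieSub.curPar_curMap (thetaT n) (parOp_thetaT n) x
    rw [h] at h1
    intro k
    rw [mem_osp]
    have h2 := congrArg (gl (4 * n + 1)).val (DFunLike.congr_fun h1 k)
    rw [LieSub.curMap_apply] at h2
    exact h2.symm
  have he := (gl (4 * n + 1)).curPar_curPar
  refine ⟨(2⁻¹ : ℂ) • (x + (gl (4 * n + 1)).curPar x), fun k => ?_,
    (2⁻¹ : ℂ) • (x - (gl (4 * n + 1)).curPar x), fun k => ?_, ?_, ?_, ?_⟩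
  · exact (osp n).carrier.smul_mem _ ((osp n).carrier.add_mem (hx k) (hp k))
  · exact (osp n).carrier.smul_mem _ ((osp n).carrier.sub_mem (hx k) (hp k))
  · rw [← smul_add, add_add_sub_cancel, ← two_smul ℂ x, smul_smul]; norm_num
  · simp only [HasParity, map_smul, map_add, he, pow_zero, one_smul]; congr 1; exact add_comm _ _
  · simp only [HasParity, map_smul, map_sub, he, pow_one, neg_one_smul]
    rw [← smul_neg, neg_sub]

variable (n) in
/-- The decomposition `S(ℂ[D] ⊗ 𝔤𝔩̄) = S(R) ⊕ (ℂ[D] ⊗ 𝔤𝔩̄^{θ̌}) S(R)`. -/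
theorem isCompl_SR : IsCompl (Subalgebra.toSubmodule (SR n)) (SRodd n) := by
  constructor
  · rw [Submodule.disjoint_def]
    intro s hs hs'
    have h1 := thetaV_SR (n := n) hs
    rw [thetaV_SRodd hs'] at h1
    have h2 : s + s = 0 := by
      nth_rewrite 1 [← h1]
      exact neg_add_cancel s
    rw [← one_smul ℂ s, show (1 : ℂ) = 2⁻¹ * 2 by norm_num, mul_smul, two_smul, h2, smul_zero]
  · rw [codisjoint_iff, Submodule.eq_top_iff']
    set N := Subalgebra.toSubmodule (SR n) ⊔ SRodd n with hN
    have hE : ∀ s ∈ SR n, s ∈ N := fun s hs => Submodule.mem_sup_left hs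
    have hO : ∀ u ∈ curC n, ∀ s ∈ SR n, glι n u * s ∈ N := fun u hu s hs =>
      Submodule.mem_sup_right (Submodule.subset_span ⟨u, hu, s, hs, rfl⟩)
    have ind : ∀ w : (gl (4 * n + 1)).V, (∀ s ∈ SR n, w * s ∈ N) →
        (∀ u ∈ curC n, ∀ s ∈ SR n, w * (glι n u * s) ∈ N) → ∀ t ∈ N, w * t ∈ N := by
      intro w h1 h2 t ht
      obtain ⟨s, hs, z, hz, rfl⟩ := Submodule.mem_sup.1 ht
      rw [mul_add]
      refine N.add_mem (h1 s hs) ?_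
      induction hz using Submodule.span_induction with
      | mem z hz => obtain ⟨u, hu, s, hs, rfl⟩ := hz; exact h2 u hu s hs
      | zero => rw [mul_zero]; exact N.zero_mem
      | add a b _ _ ha hb =>
        rw [mul_add]
        exact N.add_mem (ha (Submodule.add_mem _ ht ht |> fun _ => by
          exact Submodule.mem_sup.2 ⟨s, hs, a, by assumption, rfl⟩))
          (hb (Submodule.mem_sup.2 ⟨s, hs, b, by assumption, rfl⟩))
      | smul c a _ ha =>
        rw [mul_smul_comm]
        exact N.smul_mem c (ha (Submodule.mem_sup.2 ⟨s, hs, a, by assumption, rfl⟩))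
    have main : ∀ w : (gl (4 * n + 1)).V, ∀ t ∈ N, w * t ∈ N := by
      intro w
      induction w using SuperSym.induction with
      | algebraMap r => intro t ht; rw [← Algebra.smul_def]; exact N.smul_mem r ht
      | ι x =>
        obtain ⟨y, hy, z, hz, rfl⟩ := cur_decomp x
        obtain ⟨y0, hy0, y1, hy1, rfl, p0, p1⟩ := curG_of_hom hy
        have hG : ∀ (x : (gl (4 * n + 1)).Cur) (j : ℕ), x ∈ curG n →
            HasParity (gl (4 * n + 1)).curPar j x → ∀ t ∈ N, glι n x * t ∈ N := by
          intro x j hx hj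
          refine ind _ (fun s hs => hE _ ((SR n).mul_mem (glι_curG_mem hx) hs)) ?_
          intro u hu s hs
          have h2 : ∃ u' ∈ curC n, glι n x * glι n u = glι n u' * glι n x := by
            have h3 := SuperSym.ι_mul (gl (4 * n + 1)).curPar_curPar hj (glι n u)
            have h4 : ∀ j : ℕ, ∃ u' ∈ curC n,
                (SuperSym.par (gl (4 * n + 1)).curPar ^ j) (glι n u) = glι n u' := by
              intro j
              induction j with
              | zero => exact ⟨u, hu, rfl⟩
              | succ j ih =>
                obtain ⟨u', hu', h⟩ := ih
                exact ⟨_, curPar_curC hu', by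
                  rw [pow_succ', AlgHom.mul_apply, h, SuperSym.par_ι]⟩
            obtain ⟨u', hu', h⟩ := h4 j
            exact ⟨u', hu', by rw [h3, h]⟩
          obtain ⟨u', hu', h⟩ := h2
          rw [← mul_assoc, h, mul_assoc]
          exact hO u' hu' _ ((SR n).mul_mem (glι_curG_mem hx) hs)
        have hC : ∀ t ∈ N, glι n z * t ∈ N := by
          refine ind _ (fun s hs => hO z hz s hs) ?_
          intro u hu s hs
          rw [← mul_assoc]
          exact hE _ ((SR n).mul_mem (glι_curC_mem hz hu) hs)
        intro t ht
        rw [map_add, map_add, add_mul, add_mul]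
        exact N.add_mem (N.add_mem (hG y0 0 hy0 p0 t ht) (hG y1 1 hy1 p1 t ht)) (hC t ht)
      | mul a b ha hb => intro t ht; rw [mul_assoc]; exact ha _ (hb t ht)
      | add a b ha hb => intro t ht; rw [add_mul]; exact N.add_mem (ha t ht) (hb t ht)
    intro w
    rw [← mul_one w]
    exact main w 1 (hE 1 (SR n).one_mem)

variable (n) in
/-- The projection `π₁ : S(ℂ[D] ⊗ 𝔤𝔩̄) → S(R)` along `(ℂ[D] ⊗ 𝔤𝔩̄^{θ̌}) S(R)`. -/
def pi1 : (gl (4 * n + 1)).V →ₗ[ℂ] SR n :=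
  Submodule.projectionOnto (Subalgebra.toSubmodule (SR n)) (SRodd n) (isCompl_SR n)

theorem par_SR {s : (gl (4 * n + 1)).V} (hs : s ∈ SR n) :
    SuperSym.par (gl (4 * n + 1)).curPar s ∈ SR n := by
  induction hs using Algebra.adjoin_induction with
  | mem x hx =>
    rcases hx with ⟨x, hx, rfl⟩ | ⟨u, hu, v, hv, rfl⟩
    · obtain ⟨y, hy, z, hz, rfl, h0, h1⟩ := curG_of_hom hx
      rw [SuperSym.par_ι, map_add, h0, h1, map_add, map_smul, map_smul]
      exact (SR n).add_mem ((SR n).smul_mem (glι_curG_mem hy) _)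
        ((SR n).smul_mem (glι_curG_mem hz) _)
    · rw [map_mul, SuperSym.par_ι, SuperSym.par_ι]
      exact glι_curC_mem (curPar_curC hu) (curPar_curC hv)
  | algebraMap r => rw [AlgHom.commutes]; exact (SR n).algebraMap_mem r
  | add x y _ _ hx hy => rw [map_add]; exact (SR n).add_mem hx hy
  | mul x y _ _ hx hy => rw [map_mul]; exact (SR n).mul_mem hx hy

theorem D_SR {s : (gl (4 * n + 1)).V} (hs : s ∈ SR n) : (gl (4 * n + 1)).D s ∈ SR n := by
  induction hs using Algebra.adjoin_induction with
  | mem x hx =>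
    rcases hx with ⟨x, hx, rfl⟩ | ⟨u, hu, v, hv, rfl⟩
    · rw [LieSub.D_ι]
      exact glι_curG_mem (curD_curG hx)
    · rw [LieSub.D_mul, LieSub.D_ι, LieSub.D_ι, SuperSym.par_ι]
      exact (SR n).add_mem (glι_curC_mem (curD_curC hu) hv)
        (glι_curC_mem (curPar_curC hu) (curD_curC hv))
  | algebraMap r => rw [LieSub.D_algebraMap]; exact (SR n).zero_mem
  | add x y _ _ hx hy => rw [map_add]; exact (SR n).add_mem hx hy
  | mul x y hx' _ hx hy =>
    rw [LieSub.D_mul]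
    rename_i hy'
    exact (SR n).add_mem ((SR n).mul_mem hx hy') ((SR n).mul_mem (par_SR hx') hy)

variable (n) in
/-- The derivation `D` of `S(R)`. -/
def DSR (s : SR n) : SR n := ⟨(gl (4 * n + 1)).D s, D_SR s.2⟩

variable (n) in
/-- The differential algebra ideal `ℳ` of `S(R)` generated by `(ℂ[D] ⊗ 𝔤𝔩̄^{θ̌})^{⊗ 2}`. -/
def idealM : TwoSidedIdeal (SR n) :=
  sInf {I | (∀ (u v : (gl (4 * n + 1)).Cur) (hu : u ∈ curC n) (hv : v ∈ curC n),
    (⟨glι n u * glι n v, glι_curC_mem hu hv⟩ : SR n) ∈ I) ∧ ∀ s ∈ I, DSR n s ∈ I}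

variable (n) in
/-- The quotient map `ψ : S(R) → S(R) / ℳ`. -/
def psi : SR n →ₐ[ℂ] (idealM n).ringCon.Quotient := (idealM n).ringCon.mkₐ (α := ℂ)

variable (n) in
/-- The inclusion `𝔬𝔰𝔭(2n+1|2n) ⊂ 𝔤𝔩(2n+1|2n)`. -/
def inclT : (osp n).T →ₗ[ℂ] (gl (4 * n + 1)).T :=
  (gl (4 * n + 1)).corestrict (osp n).val fun _ => trivial

theorem parOp_inclT (a : (osp n).T) :
    (gl (4 * n + 1)).parOp (inclT n a) = inclT n ((osp n).parOp a) := rfl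

variable (n) in
/-- The algebra homomorphism `S(ℂ[D] ⊗ 𝔤̄) → S(R)` given by the inclusion `𝔤 ⊂ 𝔤𝔩`. -/
def inclSR : (osp n).V →ₐ[ℂ] SR n :=
  (LieSub.Vmap (inclT n) parOp_inclT).codRestrict (SR n) fun s => by
    induction s using SuperSym.induction with
    | algebraMap r => rw [AlgHom.commutes]; exact (SR n).algebraMap_mem r
    | ι x =>
      rw [LieSub.Vmap_ι]
      exact glι_curG_mem fun k => (osp n).val_mem (x k)
    | mul a b ha hb => rw [map_mul]; exact (SR n).mul_mem ha hb
    | add a b ha hb => rw [map_add]; exact (SR n).add_mem ha hb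

variable (n) in
/-- The projection of `𝔤𝔩` onto `𝔤` along `𝔤𝔩^{θ̌}`. -/
def projT : (gl (4 * n + 1)).T →ₗ[ℂ] (osp n).T :=
  (osp n).corestrict
    (((2⁻¹ : ℂ) • (LinearMap.id + theta n)) ∘ₗ (gl (4 * n + 1)).val) fun a => mem_osp.2 (by
      simp only [LinearMap.comp_apply, LinearMap.smul_apply, LinearMap.add_apply,
        LinearMap.id_apply, map_smul, map_add, theta_theta]
      congr 1
      exact add_comm _ _)

theorem parOp_projT (a : (gl (4 * n + 1)).T) :
    (osp n).parOp (projT n a) = projT n ((gl (4 * n + 1)).parOp a) := by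
  refine LieSub.val_injective _ ?_
  change eps ((2⁻¹ : ℂ) • ((gl (4 * n + 1)).val a + theta n ((gl (4 * n + 1)).val a)))
    = (2⁻¹ : ℂ) • (eps ((gl (4 * n + 1)).val a) + theta n (eps ((gl (4 * n + 1)).val a)))
  rw [map_smul, map_add, eps_theta]

theorem projV_curC {u : (gl (4 * n + 1)).Cur} (hu : u ∈ curC n) :
    LieSub.Vmap (projT n) parOp_projT (glι n u) = 0 := by
  rw [LieSub.Vmap_ι]
  have : LieSub.curMap (projT n) u = 0 := by
    ext k : 1
    refine LieSub.val_injective _ ?_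
    change (2⁻¹ : ℂ) • ((gl (4 * n + 1)).val (u k) + theta n ((gl (4 * n + 1)).val (u k))) = 0
    rw [neg_eq_iff_eq_neg.1 (hu k), add_neg_cancel, smul_zero]
  rw [this, map_zero]

theorem projV_idealM {s : SR n} (hs : s ∈ idealM n) :
    LieSub.Vmap (projT n) parOp_projT (s : (gl (4 * n + 1)).V) = 0 := by
  have h : idealM n ≤ TwoSidedIdeal.ker ((LieSub.Vmap (projT n) parOp_projT).comp (SR n).val) := by
    refine sInf_le ⟨fun u v hu hv => ?_, fun s hs => ?_⟩
    · rw [TwoSidedIdeal.mem_ker]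
      change LieSub.Vmap (projT n) parOp_projT (glι n u * glι n v) = 0
      rw [map_mul, projV_curC hu, zero_mul]
    · rw [TwoSidedIdeal.mem_ker] at hs ⊢
      change LieSub.Vmap (projT n) parOp_projT ((gl (4 * n + 1)).D s) = 0
      rw [LieSub.Vmap_D]
      change (osp n).D (((LieSub.Vmap (projT n) parOp_projT).comp (SR n).val) s) = 0
      rw [hs, map_zero]
  exact (TwoSidedIdeal.mem_ker _).1 (h hs)

theorem projV_incl (s : (osp n).V) :
    LieSub.Vmap (projT n) parOp_projT (inclSR n s : (gl (4 * n + 1)).V) = s := by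
  change LieSub.Vmap (projT n) parOp_projT (LieSub.Vmap (inclT n) parOp_inclT s) = s
  induction s using SuperSym.induction with
  | algebraMap r => rw [AlgHom.commutes, AlgHom.commutes]
  | ι x =>
    rw [LieSub.Vmap_ι, LieSub.Vmap_ι]
    congr 1
    ext k : 1
    refine LieSub.val_injective _ ?_
    change (2⁻¹ : ℂ) • ((osp n).val (x k) + theta n ((osp n).val (x k))) = _
    rw [mem_osp.1 ((osp n).val_mem (x k)), ← two_smul ℂ, smul_smul]
    norm_num
  | mul a b ha hb => rw [map_mul, map_mul, ha, hb]
  | add a b ha hb => rw [map_add, map_add, ha, hb]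

theorem psi_eq_zero {s : SR n} : psi n s = 0 ↔ s ∈ idealM n := by
  rw [TwoSidedIdeal.mem_iff]
  exact RingCon.eq (c := (idealM n).ringCon)

theorem psi_incl_bijective : Function.Bijective ((psi n).comp (inclSR n)) := by
  constructor
  · rw [injective_iff_map_eq_zero]
    intro s hs
    rw [← projV_incl s]
    exact projV_idealM (psi_eq_zero.1 hs)
  · intro q
    obtain ⟨⟨s, hs⟩, rfl⟩ := RingCon.mkₐ_surjective (α := ℂ) (idealM n).ringCon q
    change ∃ a, ((psi n).comp (inclSR n)) a = psi n ⟨s, hs⟩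
    induction hs using Algebra.adjoin_induction with
    | mem x hx =>
      rcases hx with ⟨x, hx, rfl⟩ | ⟨u, hu, v, hv, rfl⟩
      · refine ⟨SuperSym.ι _ (LieSub.curMap (projT n) x), ?_⟩
        change psi n (inclSR n _) = _
        congr 1
        refine Subtype.ext ?_
        change LieSub.Vmap (inclT n) parOp_inclT _ = glι n x
        rw [LieSub.Vmap_ι]
        congr 1
        ext k : 1
        refine LieSub.val_injective _ ?_
        change (2⁻¹ : ℂ) • ((gl (4 * n + 1)).val (x k) + theta n ((gl (4 * n + 1)).val (x k))) = _
        rw [mem_osp.1 (hx k), ← two_smul ℂ, smul_smul]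
        norm_num
      · refine ⟨0, ?_⟩
        rw [map_zero]
        refine (psi_eq_zero.2 ?_).symm
        rw [idealM, TwoSidedIdeal.mem_sInf]
        exact fun I hI => hI.1 u v hu hv
    | algebraMap r =>
      exact ⟨algebraMap ℂ _ r, by rw [AlgHom.commutes]; exact (AlgHom.commutes (psi n) r).symm⟩
    | add x y hx hy h1 h2 =>
      obtain ⟨a, ha⟩ := h1
      obtain ⟨b, hb⟩ := h2
      refine ⟨a + b, (map_add ((psi n).comp (inclSR n)) a b).trans ?_⟩
      rw [ha, hb]
      exact (map_add (psi n) ⟨x, hx⟩ ⟨y, hy⟩).symm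
    | mul x y hx hy h1 h2 =>
      obtain ⟨a, ha⟩ := h1
      obtain ⟨b, hb⟩ := h2
      refine ⟨a * b, (map_mul ((psi n).comp (inclSR n)) a b).trans ?_⟩
      rw [ha, hb]
      exact (map_mul (psi n) ⟨x, hx⟩ ⟨y, hy⟩).symm

variable (n) in
/-- The isomorphism `S(ℂ[D] ⊗ 𝔤̄) ≃ S(R) / ℳ` induced by the inclusion `𝔤 ⊂ 𝔤𝔩`. -/
def quotEquiv : (osp n).V ≃ₐ[ℂ] (idealM n).ringCon.Quotient :=
  AlgEquiv.ofBijective ((psi n).comp (inclSR n)) psi_incl_bijective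

variable (n) in
/-- The folding map `κ : S(ℂ[D] ⊗ 𝔤𝔩̄) → S(R) → S(R) / ℳ ≃ S(ℂ[D] ⊗ 𝔤̄)`. -/
def kappa (w : (gl (4 * n + 1)).V) : (osp n).V := (quotEquiv n).symm (psi n (pi1 n w))

end Folding

/-! ### The row determinant -/

section RowDet

variable {m : ℕ} (g : LieSub m)

namespace LieSub

/-- The left multiplication by `D` on the algebra of differential operators `𝒱(𝔤̄)[D]`, whose
elements `∑ s_k D^k` are stored as `k ↦ s_k`: `D (s D^k) = D(s) D^k + (-1)^{p(s)} s D^{k+1}`. -/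
def opD : Module.End ℂ (ℕ →₀ g.V) :=
  Finsupp.lsum ℂ fun k => Finsupp.lsingle k ∘ₗ g.D
    + Finsupp.lsingle (k + 1) ∘ₗ (SuperSym.par g.curPar).toLinearMap

/-- The product of `𝒱(𝔤̄)[D]`. -/
def opMul (A B : ℕ →₀ g.V) : ℕ →₀ g.V := 
  A.sum fun k s => Finsupp.mapRange.linearMap (LinearMap.mulLeft ℂ s) ((g.opD ^ k) B)

end LieSub

variable (n : ℕ)

/-- The element `\bar{𝐞}^{ij}` of `𝒱(𝔤𝔩̄)`, where `𝐞^{ij} = (-1)^{p(i)} e_ij`. -/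
def barE (i j : Fin (4 * n + 1)) : (gl (4 * n + 1)).V :=
  (gl (4 * n + 1)).bar ((gl (4 * n + 1)).elt ((-1 : ℂ) ^ pI i • Matrix.single i j 1) trivial)

/-- The matrix `𝒜 = ∑_{i ≤ j} e_ij ⊗ (δ_ij D + \bar{𝐞}^{ji}) - f ⊗ 1` with entries
in `𝒱(𝔤𝔩̄)[D]`. -/
def matA (i j : Fin (4 * n + 1)) : ℕ →₀ (gl (4 * n + 1)).V :=
  (if i ≤ j then (if i = j then Finsupp.single 1 1 else 0) + Finsupp.single 0 (barE n j i) else 0)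
    - Finsupp.single 0 (algebraMap ℂ _ (matf n i j))

/-- The product `𝒜_{i_0+1,i_1} 𝒜_{i_1+1,i_2} ⋯ 𝒜_{i_N+1,i_{N+1}}` for the list `i_1, …, i_{N+1}` and
the given initial row `i_0 + 1`. -/
def pathProd : Fin (4 * n + 1) → List (Fin (4 * n + 1)) → (ℕ →₀ (gl (4 * n + 1)).V)
  | _, [] => Finsupp.single 0 1
  | r, j :: l => (gl (4 * n + 1)).opMul (matA n r j) (pathProd (j + 1) l)

/-- The row determinant `∑ (-1)^{n + ∑_{j ∈ J} δ_j} 𝒜_{1,i_1} 𝒜_{i_1+1,i_2} ⋯ 𝒜_{i_N+1,i_{N+1}}`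
of `𝒜`, over all `N` and `0 < i_1 < ⋯ < i_{N+1} = 4n+1`, where `J = {i_1, …, i_{N+1}}`. -/
def rdet : ℕ →₀ (gl (4 * n + 1)).V :=
  ∑ J ∈ Finset.univ.filter fun J : Finset (Fin (4 * n + 1)) => Fin.last (4 * n) ∈ J,
    (-1 : ℂ) ^ (n + ∑ j ∈ J, delta n j) • pathProd n 0 J.sort

/-- The coefficients `w_i` in `rdet(𝒜) = ∑_{i=0}^{4n+1} w_{4n+1-i} D^i`, for `i ≤ 4n+1`. -/
def rdetCoeff (i : ℕ) : (gl (4 * n + 1)).V := rdet n (4 * n + 1 - i)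

end RowDet
end SusyW
end

/-! Write `θ` for the involution of `𝔤𝔩` with fixed space `𝔤 = 𝔬𝔰𝔭`. The proof has two independent
halves: `κ` maps `𝒲(𝔤𝔩̄, f)` into `𝒲(𝔤̄, f)`, and the coefficients of the row determinant lie in
`𝒲(𝔤𝔩̄, f)`.

Folding. The projection `𝔤𝔩 → 𝔤` along `𝔤𝔩^{θ̌}` induces a differential algebra homomorphism `𝒱(𝔤𝔩̄)
→ 𝒱(𝔤̄)`. It kills both `(ℂ[D] ⊗ 𝔤𝔩̄^{θ̌}) S(R)` and `ℳ` and splits the inclusion, so it is `κ`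
(`kappa_eq`). Since `θ` is an automorphism preserving the form, the projection is `𝔤`-equivariant
and `𝔤𝔩^{θ̌}` is orthogonal to `𝔤`. Hence `κ{m̄_χ w} = {m̄_χ κ(w)}` for `m ∈ 𝔤` (`chiBr_projT`). As
`f` and `x` lie in `𝔤`, `κ` also respects `𝒱(𝔭̄)` and `ℑ`, and the positive part of `𝔤` lies in that
of `𝔤𝔩`; this gives `kappa_mem_W`.

Row determinant. Let `𝓛` be the full matrix with entries `δ_ij D + ē^{ji}`. Below the diagonal
`ē^{ji} ≡ -f_ij` modulo `ℑ`, so `𝓛 ≡ 𝒜`. Expanding the determinant along the first step of a path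
gives a column `v` with last entry `1` such that `(𝓛 v)_0` is the determinant up to sign and `(𝓛
v)_i ∈ ℑ` in every later row (`sum_opL_colV_mem`).

Bracketing with `e_kl`, `k < l`, acts on `𝓛` as an infinitesimal gauge transformation (`opBr_opL`),
the central term `χ(a|b)` turning `D` into `D + χ`. Therefore, up to signs, `{e_kl, 𝓛 v}` plus the
row `(𝓛 v)_l` placed in position `k` equals `𝓛_χ u`, where `u` is `{e_kl, v}` with `v_l` added in
position `k`. The lower rows of the left side are in `ℑ` because `ℑ` is stable under brackets with
`𝔫`, and the last entry of `u` vanishes. The invertible subdiagonal of `f` then allows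
back-substitution (`mem_of_opLchi_mem`), so all of `u` is in `ℑ`. Row `0` now says that `e_kl`
annihilates the determinant modulo `ℑ` (`opBr_unitT_mem`). -/

noncomputable section

namespace SusyW

namespace LieSub

/-! ### Sesquilinearity of the `χ`-bracket on all of `𝒱(𝔤̄)` -/

variable {m : ℕ} (g : LieSub m)

/-- The operator `D + χ` of `ℂ[χ] ⊗ 𝒱(𝔤̄)`. -/
def chiT : Module.End ℂ (ℕ →₀ g.V) := SuperSym.chiD g.D + SuperSym.chiMul g.curPar

/-- The relation `Dχ = -χD - 2χ²` says exactly that `D + χ` anticommutes with `χ`; hence one common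
sign `(-1)^k` for both terms. -/
theorem chiT_single (k : ℕ) (s : g.V) :
    g.chiT (Finsupp.single k s)
      = Finsupp.single k ((-1 : ℂ) ^ k • g.D s) + Finsupp.single (k + 1) ((-1 : ℂ) ^ k • s) := by
  rw [chiT, LinearMap.add_apply, SuperSym.chiD_single, SuperSym.chiMul_single,
    ← Finsupp.smul_single ((-1 : ℂ) ^ k) (k + 1) s]
  module

theorem par_D (s : g.V) : SuperSym.par _ (g.D s) = -g.D (SuperSym.par _ s) :=
  SuperSym.par_oddDer s

theorem par_par (s : g.V) : SuperSym.par g.curPar (SuperSym.par _ s) = s :=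
  SuperSym.par_par g.curPar_curPar s

theorem D_par_pow (k : ℕ) (s : g.V) :
    g.D ((SuperSym.par _ ^ k) s) = (-1 : ℂ) ^ k • (SuperSym.par _ ^ k) (g.D s) := by
  induction k with
  | zero => simp
  | succ k ih =>
    have h := g.par_D ((SuperSym.par _ ^ k) s)
    rw [pow_succ', AlgHom.mul_apply, AlgHom.mul_apply, ← neg_eq_iff_eq_neg.2 h, ih, map_smul]
    module

/-- Both `D` and `χ` are odd, so `D + χ` passes `b` with the sign of its parity, leaving the extra
term `D(b)`. The factor `(-1)^p` appears because `chiLeft` carries `(-1)^{p p(b)}` and `D(b)` has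
the opposite parity to `b`. -/
theorem chiT_chiLeft (p : ℕ) (b : g.V) (A : ℕ →₀ g.V) :
    g.chiT (SuperSym.chiLeft _ p b A) = (-1 : ℂ) ^ p • SuperSym.chiLeft _ p (g.D b) A
      + SuperSym.chiLeft _ p (SuperSym.par _ b) (g.chiT A) := by
  induction A using Finsupp.induction_linear with
  | zero => simp
  | add A B hA hB => simp only [map_add, hA, hB, smul_add]; abel
  | single k s =>
    have h : ∀ l, (SuperSym.par g.curPar ^ l) (SuperSym.par _ b)
        = SuperSym.par _ ((SuperSym.par _ ^ l) b) := fun l => by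
      rw [← AlgHom.mul_apply, ← AlgHom.mul_apply, ← pow_succ, ← pow_succ']
    rw [SuperSym.chiLeft_single, SuperSym.chiLeft_single, chiT_single, chiT_single, map_add,
      SuperSym.chiLeft_single, SuperSym.chiLeft_single, D_mul, D_par_pow, h, ← add_assoc p k 1,
      h, pow_succ', AlgHom.mul_apply, par_par, Finsupp.smul_single, mul_smul_comm, mul_smul_comm,
      ← add_assoc, ← Finsupp.single_add, smul_add, smul_mul_assoc, smul_smul, ← pow_add,
      show k + (p + k) = p + 2 * k by ring, pow_add, pow_mul]
    simp

/-- Leibniz rule for `D`; the summand `χ` meets only the left factor and contributes no term in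
`D(c)`. -/
theorem chiT_chiRight (c : g.V) (A : ℕ →₀ g.V) :
    g.chiT (SuperSym.chiRight _ c A)
      = SuperSym.chiRight _ c (g.chiT A) + SuperSym.chiRight _ (g.D c) (SuperSym.chiPar _ A) := by
  have hr : ∀ (c : g.V) k s, SuperSym.chiRight _ c (Finsupp.single k s)
      = Finsupp.single k (s * c) := fun c k s => by simp [SuperSym.chiRight, -Finsupp.single_mul]
  induction A using Finsupp.induction_linear with
  | zero => simp
  | add A B hA hB => simp only [map_add, hA, hB]; abel
  | single k s =>
    rw [hr, chiT_single, chiT_single, map_add, hr, hr, SuperSym.chiPar_single, hr, D_mul,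
      smul_add, Finsupp.single_add, smul_mul_assoc, smul_mul_assoc, smul_mul_assoc]
    abel

/-- The bracket `w ↦ {ā_χ w}` for the component of parity `p` of `a`. -/
def parBr (p : ℕ) (a : g.T) : g.V →ₗ[ℂ] (ℕ →₀ g.V) :=
  SuperSym.chiDer g.curPar_curPar p (g.curBr p a) (g.chiPar_curBr p a)

theorem chiBr_eq (a : g.T) (w : g.V) : g.chiBr a w = g.parBr 0 a w + g.parBr 1 a w := by
  rw [chiBr, LinearMap.sum_apply, Finset.sum_range_succ, Finset.sum_range_one]
  rfl

variable {g}

theorem parBr_ι (p : ℕ) (a : g.T) (x : g.Cur) :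
    g.parBr p a (SuperSym.ι _ x) = g.curBr p a x := SuperSym.chiDer_ι x

theorem parBr_bar (p : ℕ) (a b : g.T) : g.parBr p a (g.bar b) = g.genBr p a b := by
  change g.parBr p a (SuperSym.ι _ (Finsupp.single 0 b)) = _
  rw [parBr_ι, curBr_single, pow_zero]
  rfl

theorem parBr_mul (p : ℕ) (a : g.T) (b c : g.V) :
    g.parBr p a (b * c) = SuperSym.chiLeft _ p b (g.parBr p a c)
      + SuperSym.chiRight _ c (g.parBr p a b) := SuperSym.chiDer_mul b c

theorem parBr_algebraMap (p : ℕ) (a : g.T) (r : ℂ) :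
    g.parBr p a (algebraMap ℂ g.V r) = 0 := SuperSym.skewDer_algebraMap r

theorem curBr_curD (p : ℕ) (a : g.T) (x : g.Cur) :
    g.curBr p a (g.curD x) = (-1 : ℂ) ^ p • g.chiT (g.curBr p a x) := by
  induction x using Finsupp.induction_linear with
  | zero => simp
  | add x y hx hy => simp only [map_add, hx, hy, smul_add]
  | single k b =>
    rw [curD_single, curBr_single, curBr_single, pow_succ', Module.End.mul_apply]
    rfl

theorem chiPar_chiLeft (p : ℕ) (b : g.V) (A : ℕ →₀ g.V) :
    SuperSym.chiPar _ (SuperSym.chiLeft _ p b A)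
      = SuperSym.chiLeft _ p (SuperSym.par _ b) (SuperSym.chiPar _ A) := by
  ext k
  rw [SuperSym.chiPar_apply, SuperSym.chiLeft_apply, SuperSym.chiLeft_apply,
    SuperSym.chiPar_apply, mul_smul_comm, map_mul, ← AlgHom.mul_apply, ← pow_succ', pow_succ]
  rfl

theorem chiPar_chiRight (c : g.V) (A : ℕ →₀ g.V) :
    SuperSym.chiPar _ (SuperSym.chiRight _ c A)
      = SuperSym.chiRight _ (SuperSym.par _ c) (SuperSym.chiPar _ A) := by
  ext k
  rw [SuperSym.chiPar_apply, SuperSym.chiRight_apply, SuperSym.chiRight_apply,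
    SuperSym.chiPar_apply, smul_mul_assoc, map_mul]

/-- The bracket with a component of parity `p` shifts parity by `p`. This supplies the sign of the
term in `D(c)` when sesquilinearity is checked on a product. -/
theorem chiPar_parBr (p : ℕ) (a : g.T) (s : g.V) :
    SuperSym.chiPar _ (g.parBr p a s) = (-1 : ℂ) ^ p • g.parBr p a (SuperSym.par _ s) := by
  induction s using SuperSym.induction with
  | algebraMap r => rw [AlgHom.commutes, parBr_algebraMap, map_zero, smul_zero]
  | ι x => rw [SuperSym.par_ι, parBr_ι, parBr_ι, chiPar_curBr]
  | mul b c hb hc =>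
    rw [parBr_mul, map_add, map_mul, parBr_mul, chiPar_chiLeft, chiPar_chiRight, hb, hc,
      map_smul, map_smul, smul_add]
  | add b c hb hc => simp only [map_add, hb, hc, smul_add]

/-- Sesquilinearity is imposed only on `ℂ[D] ⊗ 𝔤̄`. It extends to products because the Leibniz rules
of `D`, of `D + χ` and of the bracket have matching signs. -/
theorem parBr_D (p : ℕ) (a : g.T) (s : g.V) :
    g.parBr p a (g.D s) = (-1 : ℂ) ^ p • g.chiT (g.parBr p a s) := by
  induction s using SuperSym.induction with
  | algebraMap r => rw [D_algebraMap, parBr_algebraMap]; simp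
  | ι x => rw [D_ι, parBr_ι, parBr_ι, curBr_curD]
  | mul b c hb hc =>
    have h : (-1 : ℂ) ^ p * (-1) ^ p = 1 := by rw [← pow_add, Even.neg_one_pow ⟨_, rfl⟩]
    rw [D_mul, map_add, parBr_mul, parBr_mul, hb, hc, parBr_mul, map_add, chiT_chiLeft,
      chiT_chiRight, chiPar_parBr]
    simp only [map_smul, smul_add, smul_smul, h, one_smul]
    abel
  | add b c hb hc => simp only [map_add, hb, hc, smul_add]

/-! ### Brackets and homomorphisms -/

variable {m' : ℕ} {h : LieSub m'} {φ : g.T →ₗ[ℂ] h.T} {hφ : ∀ a, h.parOp (φ a) = φ (g.parOp a)}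

theorem Vmap_bar (a : g.T) : Vmap φ hφ (g.bar a) = h.bar (φ a) := by
  change Vmap φ hφ (SuperSym.ι _ (Finsupp.single 0 a)) = _
  rw [Vmap_ι, curMap_single]
  rfl

theorem Vmap_par_pow (k : ℕ) (s : g.V) :
    Vmap φ hφ ((SuperSym.par _ ^ k) s) = (SuperSym.par _ ^ k) (Vmap φ hφ s) := by
  induction k with
  | zero => rfl
  | succ k ih => rw [pow_succ', AlgHom.mul_apply, Vmap_par, ih, pow_succ', AlgHom.mul_apply]

variable (φ hφ) in
/-- The map `ℂ[χ] ⊗ 𝒱(𝔤̄) → ℂ[χ] ⊗ 𝒱(𝔥̄)` induced by an even linear map `𝔤 → 𝔥`. -/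
def chiVmap : (ℕ →₀ g.V) →ₗ[ℂ] (ℕ →₀ h.V) :=
  Finsupp.mapRange.linearMap (Vmap φ hφ).toLinearMap

theorem chiVmap_single (k : ℕ) (s : g.V) :
    chiVmap φ hφ (Finsupp.single k s) = Finsupp.single k (Vmap φ hφ s) := by
  simp [chiVmap]

theorem chiVmap_apply (A : ℕ →₀ g.V) (k : ℕ) : chiVmap φ hφ A k = Vmap φ hφ (A k) := rfl

theorem chiVmap_chiT (A : ℕ →₀ g.V) : chiVmap φ hφ (g.chiT A) = h.chiT (chiVmap φ hφ A) := by
  induction A using Finsupp.induction_linear with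
  | zero => simp
  | add A B hA hB => simp only [map_add, hA, hB]
  | single k s =>
    rw [chiT_single, map_add, chiVmap_single, chiVmap_single, chiVmap_single, chiT_single,
      map_smul, map_smul, Vmap_D]

/-- A linear map which is compatible with the brackets by `a` and `a'` of all generators is
compatible with the brackets of all elements. -/
theorem parBr_Vmap {p : ℕ} {a : g.T} {a' : h.T}
    (H : ∀ b, chiVmap φ hφ (g.genBr p a b) = h.genBr p a' (φ b)) (s : g.V) :
    chiVmap φ hφ (g.parBr p a s) = h.parBr p a' (Vmap φ hφ s) := by
  induction s using SuperSym.induction with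
  | algebraMap r => rw [AlgHom.commutes, parBr_algebraMap, parBr_algebraMap, map_zero]
  | ι x =>
    rw [parBr_ι, Vmap_ι, parBr_ι]
    induction x using Finsupp.induction_linear with
    | zero => simp
    | add x y hx hy => simp only [map_add, hx, hy]
    | single k b =>
      -- The bracket with `D^k b̄` is the `k`-th power of `±(D + χ)` applied to the bracket with
      -- `b̄`, and the induced map commutes with `D + χ`.
      have hk : ∀ A, chiVmap φ hφ ((((-1 : ℂ) ^ p • g.chiT) ^ k) A)
          = (((-1 : ℂ) ^ p • h.chiT) ^ k) (chiVmap φ hφ A) := by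
        intro A
        induction k with
        | zero => rfl
        | succ k ih =>
          rw [pow_succ', pow_succ', Module.End.mul_apply, Module.End.mul_apply, ← ih,
            LinearMap.smul_apply, LinearMap.smul_apply, map_smul, chiVmap_chiT]
      rw [curMap_single, curBr_single, curBr_single, ← H]
      exact hk _
  | mul b c hb hc =>
    rw [parBr_mul, map_mul (Vmap φ hφ), parBr_mul, ← hb, ← hc, map_add]
    congr 1
    · ext k
      rw [chiVmap_apply, SuperSym.chiLeft_apply, SuperSym.chiLeft_apply, map_mul, Vmap_par_pow,
        chiVmap_apply]
    · ext k
      rw [chiVmap_apply, SuperSym.chiRight_apply, SuperSym.chiRight_apply, map_mul, chiVmap_apply]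
  | add b c hb hc => simp only [map_add, hb, hc]

/-! ### Behaviour of the grading, of `𝒱(𝔭̄)` and of `ℑ` under homomorphisms -/

theorem bar_sub_mem_idealI {x f a : g.T} (ha : a ∈ g.nPart x) :
    g.bar a - algebraMap ℂ g.V (form (g.val f) (g.val a)) ∈ g.idealI x f := by
  rw [idealI, TwoSidedIdeal.mem_sInf]
  exact fun I hI => hI.1 a ha

theorem D_mem_idealI {x f : g.T} {s : g.V} (hs : s ∈ g.idealI x f) : g.D s ∈ g.idealI x f := by
  rw [idealI, TwoSidedIdeal.mem_sInf] at hs ⊢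
  exact fun I hI => hI.2 s (hs I hI)

/-- To show that the ideal `ℑ` is contained in a `D`-stable ideal, it suffices to consider its
generators. -/
theorem idealI_le {x f : g.T} {I : TwoSidedIdeal g.V}
    (h1 : ∀ a ∈ g.nPart x, g.bar a - algebraMap ℂ g.V (form (g.val f) (g.val a)) ∈ I)
    (h2 : ∀ s ∈ I, g.D s ∈ I) : g.idealI x f ≤ I := sInf_le ⟨h1, h2⟩

/-- The predicate `P` allows one argument to serve both `𝔫` (`0 < k`) and `𝔭` (`k ≤ 0`). -/
theorem gr_induction {x : g.T} {C : g.T → Prop} {P : ℤ → Prop}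
    (mem : ∀ k, P k → ∀ a ∈ g.gr x k, C a)
    (zero : C 0) (add : ∀ a b, C a → C b → C (a + b)) {a : g.T}
    (ha : a ∈ ⨆ k : ℤ, ⨆ _ : P k, g.gr x k) : C a := by
  induction ha using Submodule.iSup_induction' with
  | mem k a ha =>
    by_cases hk : P k
    · rw [iSup_pos hk] at ha
      exact mem k hk a ha
    · rw [iSup_neg hk, Submodule.mem_bot] at ha
      rw [ha]
      exact zero
  | zero => exact zero
  | add a b _ _ ha hb => exact add a b ha hb

theorem gr_map {x : g.T} {x' : h.T} (H : ∀ a, φ (g.ad x a) = h.ad x' (φ a)) {k : ℤ} {a : g.T}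
    (ha : a ∈ g.gr x k) : φ a ∈ h.gr x' k := by
  rw [gr, Module.End.mem_eigenspace_iff] at ha ⊢
  rw [← H, ha, map_smul]

theorem iSup_gr_map {x : g.T} {x' : h.T} (H : ∀ a, φ (g.ad x a) = h.ad x' (φ a)) {P : ℤ → Prop}
    {a : g.T} (ha : a ∈ ⨆ k : ℤ, ⨆ _ : P k, g.gr x k) :
    φ a ∈ ⨆ k : ℤ, ⨆ _ : P k, h.gr x' k := by
  refine gr_induction (C := fun a => φ a ∈ ⨆ k : ℤ, ⨆ _ : P k, h.gr x' k)
    (fun k hk a ha => Submodule.mem_iSup_of_mem k (Submodule.mem_iSup_of_mem hk (gr_map H ha)))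
    ?_ (fun a b ha hb => ?_) ha
  · rw [map_zero]; exact Submodule.zero_mem _
  · rw [map_add]; exact Submodule.add_mem _ ha hb

theorem Vmap_mem_Vp {x : g.T} {x' : h.T} (H : ∀ a, φ (g.ad x a) = h.ad x' (φ a)) {s : g.V}
    (hs : s ∈ g.Vp x) : Vmap φ hφ s ∈ h.Vp x' := by
  induction hs using Algebra.adjoin_induction with
  | mem s hs =>
    obtain ⟨k, a, ha, rfl⟩ := hs
    rw [Vmap_ι, curMap_single]
    exact Algebra.subset_adjoin ⟨k, φ a, iSup_gr_map H ha, rfl⟩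
  | algebraMap r => rw [AlgHom.commutes]; exact Subalgebra.algebraMap_mem _ r
  | add a b _ _ ha hb => rw [map_add]; exact Subalgebra.add_mem _ ha hb
  | mul a b _ _ ha hb => rw [map_mul]; exact Subalgebra.mul_mem _ ha hb

/-- The preimage of the target ideal is a `D`-stable ideal. It contains each generator because `H`
keeps `𝔫` positive and `Hf` matches the constants. -/
theorem Vmap_mem_idealI {x f : g.T} {x' f' : h.T} (H : ∀ a, φ (g.ad x a) = h.ad x' (φ a))
    (Hf : ∀ a, form (h.val f') (h.val (φ a)) = form (g.val f) (g.val a)) {s : g.V}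
    (hs : s ∈ g.idealI x f) : Vmap φ hφ s ∈ h.idealI x' f' := by
  have : g.idealI x f ≤ (h.idealI x' f').comap (Vmap φ hφ) := by
    refine idealI_le (fun a ha => ?_) fun s hs => ?_
    · rw [TwoSidedIdeal.mem_comap, map_sub, Vmap_bar, AlgHom.commutes, ← Hf]
      exact bar_sub_mem_idealI (iSup_gr_map H ha)
    · rw [TwoSidedIdeal.mem_comap] at hs ⊢
      rw [Vmap_D]
      exact D_mem_idealI hs
  exact (TwoSidedIdeal.mem_comap _).1 (this hs)

end LieSub

/-! ### The folding map as the homomorphism induced by the projection `𝔤𝔩 → 𝔤` -/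

section Folding

section Form

variable {m : ℕ}

/-- A nonzero entry `a_ij` forces `p(i) + p(j) ≡ p`, so interchanging the summation indices in the
supertrace costs the sign `(-1)^p`. -/
theorem form_comm_of_hom {p q : ℕ} {a b : Mat m} (ha : eps a = (-1 : ℂ) ^ p • a)
    (hb : eps b = (-1 : ℂ) ^ q • b) : form b a = (-1 : ℂ) ^ (p * q) * form a b := by
  have h1 : form a b = (-1 : ℂ) ^ p * form b a := by
    have key : ∀ i j, (-1 : ℂ) ^ pI i * a i j = (-1) ^ p * ((-1) ^ pI j * a i j) := fun i j => by
      have h : (-1 : ℂ) ^ (pI i + pI j) * a i j = (-1) ^ p * a i j := congrFun (congrFun ha i) j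
      have h2 : (-1 : ℂ) ^ pI j * (-1) ^ pI j = 1 := by rw [← pow_add, Even.neg_one_pow ⟨_, rfl⟩]
      rw [pow_add] at h
      linear_combination (-1 : ℂ) ^ pI j * h - (-1) ^ pI i * a i j * h2
    simp only [form, str, LinearMap.coe_mk, AddHom.coe_mk, Matrix.mul_apply, Finset.mul_sum]
    rw [Finset.sum_comm]
    refine Finset.sum_congr rfl fun j _ => Finset.sum_congr rfl fun i _ => ?_
    linear_combination b j i * key i j
  have h2 : form b a = (-1 : ℂ) ^ (p + q) * form b a := by
    conv_lhs => rw [form, ← str_eps, eps_mul, ha, hb]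
    rw [smul_mul_smul_comm, map_smul, ← pow_add, add_comm, smul_eq_mul, form]
  -- For even `p + q` the exponents `p` and `pq` have the same parity and `h1` suffices; for odd `p
  -- + q` the form vanishes by `h2`.
  rcases Nat.even_or_odd (p + q) with h | h
  · rw [h1, ← mul_assoc, ← pow_add, Even.neg_one_pow, one_mul]
    rw [Nat.even_add] at h ⊢
    rw [Nat.even_mul]
    tauto
  · rw [h.neg_one_pow] at h2
    have h3 : form b a = 0 := by linear_combination h2 / 2
    rw [h1, h3]
    simp

theorem eps_single (i j : Fin m) :
    eps (Matrix.single i j (1 : ℂ)) = (-1 : ℂ) ^ (pI i + pI j) • Matrix.single i j 1 := by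
  ext k l
  simp only [eps, LinearMap.coe_mk, AddHom.coe_mk, Matrix.of_apply, Matrix.smul_apply,
    Matrix.single_apply, smul_eq_mul]
  by_cases hkl : i = k ∧ j = l
  · obtain ⟨rfl, rfl⟩ := hkl; rfl
  · simp [hkl]

end Form

variable {n : ℕ}

/-- On the diagonal `θ(e_ii) = -e_{i'i'}`, and `i'` has the parity of `i`. -/
theorem str_theta (a : Mat (4 * n + 1)) : str (theta n a) = -str a := by
  simp only [str, LinearMap.coe_mk, AddHom.coe_mk]
  rw [← Equiv.sum_comp Fin.revPerm, ← Finset.sum_neg_distrib]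
  refine Finset.sum_congr rfl fun k _ => ?_
  have h1 : (-1 : ℂ) ^ tauExp n k k = -1 := by
    have : Odd (tauExp n k k) := by
      simp only [tauExp, pI, Nat.odd_iff]
      rcases Nat.mod_two_eq_zero_or_one (k : ℕ) with d | d <;> simp only [d] <;> omega
    exact this.neg_one_pow
  rw [Fin.revPerm_apply, theta_apply, Fin.rev_rev, h1, pI_rev]
  ring

/-- Take the supertrace of `θ(ba) = -(-1)^{pq} θ(a)θ(b)`: the minus sign cancels that of `str ∘ θ =
-str`, and the remaining sign is the supersymmetry of the form. -/
theorem form_theta {p q : ℕ} {a b : Mat (4 * n + 1)} (ha : eps a = (-1 : ℂ) ^ p • a)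
    (hb : eps b = (-1 : ℂ) ^ q • b) : form (theta n a) (theta n b) = form a b := by
  have h := str_theta (n := n) (b * a)
  rw [theta_mul hb ha, map_neg, map_smul, neg_inj, smul_eq_mul] at h
  change _ * form (theta n a) (theta n b) = form b a at h
  rw [form_comm_of_hom ha hb, mul_comm q p] at h
  exact mul_left_cancel₀ (pow_ne_zero _ (neg_ne_zero.2 one_ne_zero)) h

theorem theta_homPart (p : ℕ) (a : Mat (4 * n + 1)) :
    theta n (homPart p a) = homPart p (theta n a) := by
  rw [homPart_apply, homPart_apply, map_smul, map_add, map_smul, eps_theta]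

theorem val_projT (a : (gl (4 * n + 1)).T) : (osp n).val (projT n a)
    = (2⁻¹ : ℂ) • ((gl (4 * n + 1)).val a + theta n ((gl (4 * n + 1)).val a)) := rfl

theorem val_inclT (a : (osp n).T) : (gl (4 * n + 1)).val (inclT n a) = (osp n).val a := rfl

theorem theta_val (a : (osp n).T) : theta n ((osp n).val a) = (osp n).val a :=
  mem_osp.1 ((osp n).val_mem a)

/-- The projection of `𝔤𝔩` onto `𝔤` is `𝔤`-equivariant. -/
theorem projT_ad (m : (osp n).T) (a : (gl (4 * n + 1)).T) :
    projT n ((gl (4 * n + 1)).ad (inclT n m) a) = (osp n).ad m (projT n a) := by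
  refine LieSub.val_injective _ ?_
  change (2⁻¹ : ℂ) • (sbr ((osp n).val m) ((gl (4 * n + 1)).val a)
    + theta n (sbr ((osp n).val m) ((gl (4 * n + 1)).val a)))
    = sbr ((osp n).val m) ((osp n).val (projT n a))
  rw [theta_sbr, theta_val, val_projT, map_smul, map_add]

theorem part_projT (q : ℕ) (a : (gl (4 * n + 1)).T) :
    (osp n).part q (projT n a) = projT n ((gl (4 * n + 1)).part q a) := by
  refine LieSub.val_injective _ ?_
  change homPart q ((2⁻¹ : ℂ) • ((gl (4 * n + 1)).val a + theta n ((gl (4 * n + 1)).val a)))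
    = (2⁻¹ : ℂ) • (homPart q ((gl (4 * n + 1)).val a) + theta n (homPart q
      ((gl (4 * n + 1)).val a)))
  rw [map_smul, map_add, theta_homPart]

/-- Since `θ` preserves the form and fixes `m`, `(m|θ(a)) = (m|a)`: thus `𝔤𝔩^{θ̌}` is orthogonal to
`𝔤`, and pairing with `m` factors through the projection. -/
theorem form_projT {p : ℕ} {m : (osp n).T} (hm : eps ((osp n).val m) = (-1 : ℂ) ^ p • (osp n).val m)
    (q : ℕ) (a : (gl (4 * n + 1)).T) :
    form ((osp n).val m) ((osp n).val (projT n ((gl (4 * n + 1)).part q a)))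
      = form ((osp n).val m) ((gl (4 * n + 1)).val ((gl (4 * n + 1)).part q a)) := by
  have h := form_theta (n := n) hm (eps_homPart q ((gl (4 * n + 1)).val a))
  rw [theta_val] at h
  change form _ ((2⁻¹ : ℂ) • (homPart q ((gl (4 * n + 1)).val a) + theta n (homPart q
      ((gl (4 * n + 1)).val a)))) = form _ (homPart q ((gl (4 * n + 1)).val a))
  simp only [form, mul_smul_comm, mul_add, map_smul, map_add, smul_eq_mul] at h ⊢
  rw [h]
  ring

/-- Equivariance of the projection handles the term `[m, a]`, orthogonality the term `χ(m|a)`. The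
bracketing element must lie in `𝔤`. -/
theorem genBr_projT (p : ℕ) (m : (osp n).T) (a : (gl (4 * n + 1)).T) :
    LieSub.chiVmap (projT n) parOp_projT ((gl (4 * n + 1)).genBr p (inclT n m) a)
      = (osp n).genBr p m (projT n a) := by
  rw [LieSub.genBr_apply, LieSub.genBr_apply, map_sum]
  refine Finset.sum_congr rfl fun q _ => ?_
  have hp : (gl (4 * n + 1)).part p (inclT n m) = inclT n ((osp n).part p m) := rfl
  rw [map_add, map_smul, LieSub.chiVmap_single, LieSub.chiVmap_single, LieSub.Vmap_bar,
    AlgHom.commutes, hp, projT_ad, part_projT, form_projT (eps_homPart p _), val_inclT]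

theorem chiBr_projT (m : (osp n).T) (w : (gl (4 * n + 1)).V) :
    LieSub.chiVmap (projT n) parOp_projT ((gl (4 * n + 1)).chiBr (inclT n m) w)
      = (osp n).chiBr m (LieSub.Vmap (projT n) parOp_projT w) := by
  rw [LieSub.chiBr_eq, LieSub.chiBr_eq, map_add, LieSub.parBr_Vmap (genBr_projT 0 m),
    LieSub.parBr_Vmap (genBr_projT 1 m)]

/-- Any `s ∈ S(R)` is congruent modulo `ℳ` to an element coming from `𝒱(𝔤̄)`; the induced
homomorphism kills `ℳ` and restricts to the identity on such elements. -/
theorem quotEquiv_symm_psi (s : SR n) : (quotEquiv n).symm (psi n s)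
    = LieSub.Vmap (projT n) parOp_projT (s : (gl (4 * n + 1)).V) := by
  obtain ⟨t, ht⟩ := (quotEquiv n).surjective (psi n s)
  rw [← ht, AlgEquiv.symm_apply_apply]
  have h1 : psi n (inclSR n t) = psi n s := ht
  have h2 := projV_idealM (psi_eq_zero.1 ((map_sub (psi n) _ _).trans (sub_eq_zero.2 h1)))
  rw [AddSubgroupClass.coe_sub, map_sub, projV_incl, sub_eq_zero] at h2
  exact h2

/-- The folding map is the algebra homomorphism induced by the projection of `𝔤𝔩` onto `𝔤`. -/
theorem kappa_eq (w : (gl (4 * n + 1)).V) :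
    kappa n w = LieSub.Vmap (projT n) parOp_projT w := by
  rw [kappa, quotEquiv_symm_psi]
  -- The remainder lies in the kernel of `π₁`. Each of its spanning products has a factor from `ℂ[D]
  -- ⊗ 𝔤𝔩̄^{θ̌}`, which the projection sends to zero.
  have hw : w - (pi1 n w : (gl (4 * n + 1)).V) ∈ SRodd n := by
    rw [← Submodule.ker_projectionOnto (isCompl_SR n), LinearMap.mem_ker, map_sub, sub_eq_zero]
    exact (Submodule.projectionOnto_apply_left (isCompl_SR n) (pi1 n w)).symm
  rw [eq_comm, ← sub_eq_zero, ← map_sub]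
  generalize w - (pi1 n w : (gl (4 * n + 1)).V) = z at hw
  induction hw using Submodule.span_induction with
  | mem z hz =>
    obtain ⟨u, hu, s, -, rfl⟩ := hz
    rw [map_mul, projV_curC hu, zero_mul]
  | zero => rw [map_zero]
  | add x y _ _ hx hy => rw [map_add, hx, hy, add_zero]
  | smul c x _ hx => rw [map_smul, hx, smul_zero]

theorem projT_ad_xGl (a : (gl (4 * n + 1)).T) :
    projT n ((gl (4 * n + 1)).ad (xGl n) a) = (osp n).ad (xOsp n) (projT n a) :=
  projT_ad (xOsp n) a

theorem eps_matf : eps (matf n) = (-1 : ℂ) ^ 1 • matf n := by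
  have h : ∀ i j : Fin (4 * n + 1), (i : ℕ) = j + 1 → eps (Matrix.single i j (1 : ℂ))
      = (-1 : ℂ) ^ 1 • Matrix.single i j 1 := by
    intro i j hij
    have : Odd (pI i + pI j) := by simp only [pI, hij, Nat.odd_iff]; omega
    rw [eps_single, this.neg_one_pow, pow_one]
  rw [matf, map_sum, Finset.smul_sum]
  refine Finset.sum_congr rfl fun i _ => ?_
  rw [matF, map_add, eps_theta, h _ _ rfl, map_smul, smul_add]

/-- Orthogonality is available for homogeneous components only, so `a` is split into its even and
odd parts; `f` itself is odd. -/
theorem form_fOsp (a : (gl (4 * n + 1)).T) :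
    form ((osp n).val (fOsp n)) ((osp n).val (projT n a))
      = form ((gl (4 * n + 1)).val (fGl n)) ((gl (4 * n + 1)).val a) := by
  have ha : a = (gl (4 * n + 1)).part 0 a + (gl (4 * n + 1)).part 1 a := by
    refine LieSub.val_injective _ ?_
    change _ = homPart 0 _ + homPart 1 _
    simp only [homPart_apply]
    module
  have hf : eps ((osp n).val (fOsp n)) = (-1 : ℂ) ^ 1 • (osp n).val (fOsp n) := eps_matf
  have h0 := form_projT hf 0 a
  have h1 := form_projT hf 1 a
  rw [ha, map_add, map_add, map_add]
  simp only [form, mul_add, map_add] at h0 h1 ⊢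
  rw [h0, h1]
  rfl

/-- For `a` in the positive part of `𝔤`, the bracket with `κ(w)` is the image of the bracket with
`w`, whose coefficients are in the ideal of `𝔤𝔩`; the induced map carries that ideal into the one of
`𝔤`. -/
theorem kappa_mem_W {w : (gl (4 * n + 1)).V} (hw : w ∈ (gl (4 * n + 1)).W (xGl n) (fGl n)) :
    kappa n w ∈ (osp n).W (xOsp n) (fOsp n) := by
  rw [kappa_eq]
  refine ⟨LieSub.Vmap_mem_Vp projT_ad_xGl hw.1, fun a ha k => ?_⟩
  rw [← chiBr_projT]
  refine LieSub.Vmap_mem_idealI projT_ad_xGl form_fOsp (hw.2 (inclT n a) ?_ k)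
  -- Both gradings come from the same matrix `x`, so the inclusion `𝔤 ⊂ 𝔤𝔩` commutes with `ad x` by
  -- definition.
  exact LieSub.iSup_gr_map (φ := inclT n) (x := xOsp n) (x' := xGl n) (fun _ => rfl) ha

end Folding

theorem single_mem_submodule {E : Type} [AddCommGroup E] [Module ℂ E] {P : Submodule ℂ E} (k : ℕ)
    {s : E} (hs : s ∈ P) : Finsupp.single k s ∈ Finsupp.submodule fun _ : ℕ => P := by
  classical
  intro l
  rw [Finsupp.single_apply]
  split_ifs
  exacts [hs, P.zero_mem]

namespace LieSub

variable {m : ℕ} {g : LieSub m}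

/-! ### Linearity of the bracket in the first argument -/

theorem ad_add (a b c : g.T) : g.ad (a + b) c = g.ad a c + g.ad b c := by
  refine g.val_injective ?_
  change sbr (g.val a + g.val b) (g.val c) = sbr (g.val a) (g.val c) + sbr (g.val b) (g.val c)
  simp only [sbr_apply, map_add, add_mul, mul_add, smul_add, ← Finset.sum_add_distrib]
  refine Finset.sum_congr rfl fun _ _ => Finset.sum_congr rfl fun _ _ => ?_
  abel

theorem genBr_add (p : ℕ) (a b : g.T) : g.genBr p (a + b) = g.genBr p a + g.genBr p b := by
  refine LinearMap.ext fun c => ?_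
  simp only [LinearMap.add_apply, genBr_apply, map_add, ad_add, form, add_mul, smul_add,
    Finsupp.single_add, ← Finset.sum_add_distrib]
  refine Finset.sum_congr rfl fun _ _ => ?_
  abel

theorem genBr_smul (p : ℕ) (r : ℂ) (a : g.T) : g.genBr p (r • a) = r • g.genBr p a := by
  refine LinearMap.ext fun c => ?_
  simp only [LinearMap.smul_apply, genBr_apply, map_smul, ad_smul, form, smul_mul_assoc,
    Finset.smul_sum, smul_add, smul_eq_mul, Finsupp.smul_single]
  refine Finset.sum_congr rfl fun _ _ => ?_
  simp only [Algebra.algebraMap_eq_smul_one, smul_smul, mul_comm]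

theorem curBr_add (p : ℕ) (a b : g.T) : g.curBr p (a + b) = g.curBr p a + g.curBr p b := by
  refine Finsupp.lhom_ext fun k c => ?_
  rw [LinearMap.add_apply, curBr_single, curBr_single, curBr_single, genBr_add,
    LinearMap.add_apply, map_add]

theorem curBr_smul (p : ℕ) (r : ℂ) (a : g.T) : g.curBr p (r • a) = r • g.curBr p a := by
  refine Finsupp.lhom_ext fun k c => ?_
  rw [LinearMap.smul_apply, curBr_single, curBr_single, genBr_smul, LinearMap.smul_apply, map_smul]

theorem parBr_add (p : ℕ) (a b : g.T) (s : g.V) :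
    g.parBr p (a + b) s = g.parBr p a s + g.parBr p b s := by
  induction s using SuperSym.induction with
  | algebraMap r => simp only [parBr_algebraMap, add_zero]
  | ι x => simp only [parBr_ι, curBr_add, LinearMap.add_apply]
  | mul s t hs ht => simp only [parBr_mul, hs, ht, map_add]; abel
  | add s t hs ht => simp only [map_add, hs, ht]; abel

theorem parBr_smul (p : ℕ) (r : ℂ) (a : g.T) (s : g.V) :
    g.parBr p (r • a) s = r • g.parBr p a s := by
  induction s using SuperSym.induction with
  | algebraMap r => simp only [parBr_algebraMap, smul_zero]
  | ι x => simp only [parBr_ι, curBr_smul, LinearMap.smul_apply]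
  | mul s t hs ht => simp only [parBr_mul, hs, ht, map_smul, smul_add]
  | add s t hs ht => simp only [map_add, hs, ht, smul_add]

theorem part_of_hom {p q : ℕ} {a : g.T} (ha : g.parOp a = (-1 : ℂ) ^ q • a) :
    g.part p a = if Even (p + q) then a else 0 := by
  have h : g.part p a = (2⁻¹ : ℂ) • (a + (-1 : ℂ) ^ p • g.parOp a) := g.val_injective rfl
  rw [h, ha, smul_smul, ← pow_add]
  split_ifs with hpq
  · rw [hpq.neg_one_pow]; module
  · rw [(Nat.not_even_iff_odd.1 hpq).neg_one_pow]; module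

theorem genBr_eq_zero {p q : ℕ} {a : g.T} (ha : g.parOp a = (-1 : ℂ) ^ q • a)
    (hpq : ¬Even (p + q)) : g.genBr p a = 0 := by
  refine LinearMap.ext fun b => ?_
  have h0 : ∀ b, g.ad 0 b = 0 := fun b => by simpa using ad_smul g 0 0 b
  simp [genBr_apply, part_of_hom ha, hpq, h0, form]

/-- `parBr p` sees only the component of parity `p`. A matrix unit therefore needs to be treated for
one class of `p` modulo two. -/
theorem parBr_eq_zero {p q : ℕ} {a : g.T} (ha : g.parOp a = (-1 : ℂ) ^ q • a)
    (hpq : ¬Even (p + q)) (s : g.V) : g.parBr p a s = 0 := by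
  induction s using SuperSym.induction with
  | algebraMap r => rw [parBr_algebraMap]
  | ι x =>
    rw [parBr_ι]
    induction x using Finsupp.induction_linear with
    | zero => rw [map_zero]
    | add x y hx hy => rw [map_add, hx, hy, add_zero]
    | single k b => rw [curBr_single, genBr_eq_zero ha hpq, LinearMap.zero_apply, map_zero]
  | mul s t hs ht => rw [parBr_mul, hs, ht, map_zero, map_zero, add_zero]
  | add s t hs ht => rw [map_add, hs, ht, add_zero]

theorem genBr_of_hom {p q : ℕ} {a b : g.T} (ha : g.parOp a = (-1 : ℂ) ^ p • a)
    (hb : g.parOp b = (-1 : ℂ) ^ q • b) :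
    g.genBr p a b = (-1 : ℂ) ^ (p * (q + 1)) • Finsupp.single 0 (g.bar (g.ad a b))
      + Finsupp.single 1 (algebraMap ℂ g.V (form (g.val a) (g.val b))) := by
  have hf : form (g.val a) 0 = 0 := by simp [form]
  rw [genBr_apply, part_of_hom ha, if_pos ⟨p, rfl⟩, Finset.sum_range_succ, Finset.sum_range_one,
    part_of_hom hb, part_of_hom hb]
  rcases Nat.even_or_odd q with h | h
  · have h1 : (-1 : ℂ) ^ (p * (q + 1)) = (-1) ^ p := by
      rw [mul_add, pow_add, (h.mul_left p).neg_one_pow, one_mul, mul_one]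
    have h2 : ¬Even (1 + q) := by rw [Nat.even_add]; simp [h]
    rw [if_pos (by simpa using h), if_neg h2, h1, map_zero, map_zero, map_zero, hf]
    simp
  · have h1 : (-1 : ℂ) ^ (p * (q + 1)) = 1 := ((h.add_one).mul_left p).neg_one_pow
    have h3 : (-1 : ℂ) ^ (p * (1 + 1)) = 1 := Even.neg_one_pow ⟨p, by ring⟩
    have h2 : ¬Even (0 + q) := by rw [zero_add, Nat.not_even_iff_odd]; exact h
    rw [if_neg h2, if_pos (show Even (1 + q) by rw [add_comm]; exact h.add_one), h1, h3, map_zero, map_zero,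
      map_zero, hf]
    simp

/-! ### Brackets with differential operators -/

variable (g) in
/-- The operator `D + χ` of `ℂ[χ] ⊗ 𝒱(𝔤̄)[D]`, whose elements `∑ A_k D^k` are stored
as `k ↦ A_k`. -/
def opX : Module.End ℂ (ℕ →₀ ℕ →₀ g.V) :=
  Finsupp.lsum ℂ fun k => Finsupp.lsingle k ∘ₗ g.chiT
    + Finsupp.lsingle (k + 1) ∘ₗ SuperSym.chiPar g.curPar

/-- The coefficientwise bracket with `a` on `𝒱(𝔤̄)[D]`. -/
def opBr (p : ℕ) (a : g.T) : (ℕ →₀ g.V) →ₗ[ℂ] (ℕ →₀ ℕ →₀ g.V) :=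
  Finsupp.mapRange.linearMap (g.parBr p a)

/-- The left multiplication by `s` on `𝒱(𝔤̄)[D]`. -/
def opMulLeft (s : g.V) : Module.End ℂ (ℕ →₀ g.V) :=
  Finsupp.mapRange.linearMap (LinearMap.mulLeft ℂ s)

/-- The left multiplication by `s` on `ℂ[χ] ⊗ 𝒱(𝔤̄)[D]`, multiplied by `(-1)^{p p(s)}`. -/
def opLeft (p : ℕ) (s : g.V) : Module.End ℂ (ℕ →₀ ℕ →₀ g.V) :=
  Finsupp.mapRange.linearMap (SuperSym.chiLeft g.curPar p s)

/-- The product `B ↦ A B` for `A ∈ ℂ[χ] ⊗ 𝒱(𝔤̄)`. -/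
def opRight (A : ℕ →₀ g.V) : (ℕ →₀ g.V) →ₗ[ℂ] (ℕ →₀ ℕ →₀ g.V) :=
  Finsupp.mapRange.linearMap ((SuperSym.chiRight g.curPar).flip A)

variable (g) in
/-- The inclusion `𝒱(𝔤̄)[D] ⊂ ℂ[χ] ⊗ 𝒱(𝔤̄)[D]`. -/
def opConst : (ℕ →₀ g.V) →ₗ[ℂ] (ℕ →₀ ℕ →₀ g.V) :=
  Finsupp.mapRange.linearMap (Finsupp.lsingle 0)

theorem opX_single (k : ℕ) (A : ℕ →₀ g.V) : g.opX (Finsupp.single k A)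
    = Finsupp.single k (g.chiT A) + Finsupp.single (k + 1) (SuperSym.chiPar g.curPar A) := by
  rw [opX, Finsupp.lsum_single]
  rfl

theorem opD_single (k : ℕ) (s : g.V) : g.opD (Finsupp.single k s)
    = Finsupp.single k (g.D s) + Finsupp.single (k + 1) (SuperSym.par g.curPar s) := by
  rw [opD, Finsupp.lsum_single]
  rfl

theorem opBr_single (p : ℕ) (a : g.T) (k : ℕ) (s : g.V) :
    opBr p a (Finsupp.single k s) = Finsupp.single k (g.parBr p a s) := by
  simp [opBr]

/-- Sesquilinearity applied coefficientwise: passing the bracket through the symbol `D` replaces it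
by `D + χ`. -/
theorem opBr_opD (p : ℕ) (a : g.T) (B : ℕ →₀ g.V) :
    opBr p a (g.opD B) = (-1 : ℂ) ^ p • g.opX (opBr p a B) := by
  induction B using Finsupp.induction_linear with
  | zero => simp
  | add A B hA hB => simp only [map_add, hA, hB, smul_add]
  | single k s =>
    have h : (-1 : ℂ) ^ p * (-1) ^ p = 1 := by rw [← pow_add, Even.neg_one_pow ⟨_, rfl⟩]
    rw [opD_single, map_add, opBr_single, opBr_single, opBr_single, opX_single, parBr_D,
      chiPar_parBr, smul_add, Finsupp.smul_single, Finsupp.smul_single, smul_smul, h, one_smul]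

theorem opBr_opMulLeft (p : ℕ) (a : g.T) (s : g.V) (B : ℕ →₀ g.V) :
    opBr p a (opMulLeft s B) = opLeft p s (opBr p a B) + opRight (g.parBr p a s) B := by
  ext1 k
  exact parBr_mul p a s (B k)

/-- The second summand is `χB`, since `opRight (Finsupp.single 1 1)` is left multiplication by `χ`.
It is this term that the level-one part of the bracket compensates. -/
theorem opX_opConst (B : ℕ →₀ g.V) :
    g.opX (g.opConst B) = g.opConst (g.opD B) + opRight (Finsupp.single 1 1) B := by
  induction B using Finsupp.induction_linear with
  | zero => simp
  | add A B hA hB => simp only [map_add, hA, hB]; abel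
  | single k s =>
    have h : ∀ k s, g.opConst (Finsupp.single k s) = Finsupp.single k (Finsupp.single 0 s) :=
      fun k s => by simp [opConst]
    have h2 : opRight (Finsupp.single 1 1) (Finsupp.single k s)
        = Finsupp.single k (Finsupp.single 1 s) := by
      simp [opRight, SuperSym.chiRight, -Finsupp.single_mul]
    rw [h, opX_single, chiT_single, SuperSym.chiPar_single, h2, opD_single, map_add, h, h,
      Finsupp.single_add]
    simp only [pow_zero, one_smul, zero_add]
    abel

theorem opRight_single_zero (s : g.V) (B : ℕ →₀ g.V) :
    opRight (Finsupp.single 0 s) B = g.opConst (opMulLeft s B) := by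
  ext1 k
  change SuperSym.chiRight g.curPar (B k) (Finsupp.single 0 s) = Finsupp.single 0 (s * B k)
  simp [SuperSym.chiRight, -Finsupp.single_mul]

theorem opRight_add (A A' : ℕ →₀ g.V) (B : ℕ →₀ g.V) :
    opRight (A + A') B = opRight A B + opRight A' B := by
  ext1 k
  exact map_add (SuperSym.chiRight g.curPar (B k)) A A'

theorem opRight_smul (r : ℂ) (A : ℕ →₀ g.V) (B : ℕ →₀ g.V) :
    opRight (r • A) B = r • opRight A B := by
  ext1 k
  exact map_smul (SuperSym.chiRight g.curPar (B k)) r A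

theorem opLeft_opConst (p : ℕ) (s : g.V) (B : ℕ →₀ g.V) :
    opLeft p s (g.opConst B) = g.opConst (opMulLeft ((SuperSym.par _ ^ p) s) B) := by
  ext1 k
  change SuperSym.chiLeft g.curPar p s (Finsupp.single 0 (B k)) = _
  rw [SuperSym.chiLeft_single]
  rfl

theorem opMulLeft_add (s t : g.V) (B : ℕ →₀ g.V) :
    opMulLeft (s + t) B = opMulLeft s B + opMulLeft t B := by
  ext1 k
  exact add_mul s t (B k)

theorem opMulLeft_smul (r : ℂ) (s : g.V) (B : ℕ →₀ g.V) :
    opMulLeft (r • s) B = r • opMulLeft s B := by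
  ext1 k
  exact smul_mul_assoc r s (B k)

theorem opMulLeft_algebraMap (r : ℂ) (B : ℕ →₀ g.V) :
    opMulLeft (algebraMap ℂ g.V r) B = r • B := by
  ext1 k
  exact (Algebra.smul_def r (B k)).symm

theorem opLeft_add (p : ℕ) (s t : g.V) (C : ℕ →₀ ℕ →₀ g.V) :
    opLeft p (s + t) C = opLeft p s C + opLeft p t C := by
  ext1 k
  change SuperSym.chiLeft g.curPar p (s + t) (C k) = _
  rw [map_add]
  rfl

theorem opLeft_algebraMap (p : ℕ) (r : ℂ) (C : ℕ →₀ ℕ →₀ g.V) :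
    opLeft p (algebraMap ℂ g.V r) C = r • C := by
  ext1 k
  change SuperSym.chiLeft g.curPar p (algebraMap ℂ g.V r) (C k) = _
  rw [AlgHom.commutes]
  rfl

theorem opMul_add_left (A A' B : ℕ →₀ g.V) :
    g.opMul (A + A') B = g.opMul A B + g.opMul A' B := by
  rw [opMul, opMul, opMul, Finsupp.sum_add_index']
  · intro k; ext1 l; exact zero_mul _
  · intro k s t; ext1 l; exact add_mul _ _ _

theorem opMul_single (k : ℕ) (s : g.V) (B : ℕ →₀ g.V) :
    g.opMul (Finsupp.single k s) B = opMulLeft s ((g.opD ^ k) B) := by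
  rw [opMul, Finsupp.sum_single_index]
  · rfl
  · ext1 l; exact zero_mul _

/-! ### Differential operators with coefficients in an ideal -/

/-- The subspace underlying an ideal of `𝒱(𝔤̄)`. -/
def idealSub (I : TwoSidedIdeal g.V) : Submodule ℂ g.V where
  carrier := {s | s ∈ I}
  add_mem' := I.add_mem
  zero_mem' := I.zero_mem
  smul_mem' r s hs := by
    change r • s ∈ I
    rw [Algebra.smul_def]
    exact I.mul_mem_left _ _ hs

/-- The elements of `𝒱(𝔤̄)[D]`, or of `ℂ[χ] ⊗ 𝒱(𝔤̄)`, with coefficients in the ideal `I`. -/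
abbrev opIdeal (I : TwoSidedIdeal g.V) : Submodule ℂ (ℕ →₀ g.V) :=
  Finsupp.submodule fun _ : ℕ => idealSub I

/-- The elements of `ℂ[χ] ⊗ 𝒱(𝔤̄)[D]` with coefficients in the ideal `I`. -/
abbrev opChiIdeal (I : TwoSidedIdeal g.V) : Submodule ℂ (ℕ →₀ ℕ →₀ g.V) :=
  Finsupp.submodule fun _ : ℕ => opIdeal I

variable {I : TwoSidedIdeal g.V}

theorem par_pow_mem (hpar : ∀ s ∈ I, SuperSym.par _ s ∈ I) (k : ℕ) {s : g.V} (hs : s ∈ I) :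
    (SuperSym.par _ ^ k) s ∈ I := by
  induction k with
  | zero => exact hs
  | succ k ih => rw [pow_succ', AlgHom.mul_apply]; exact hpar _ ih

theorem chiT_mem (hD : ∀ s ∈ I, g.D s ∈ I) {A : ℕ →₀ g.V} (hA : A ∈ opIdeal I) :
    g.chiT A ∈ opIdeal I := by
  induction A using Finsupp.induction with
  | zero => rw [map_zero]; exact Submodule.zero_mem _
  | single_add k s A hk _ ih =>
    have hs : s ∈ idealSub I := by
      have := hA k
      rwa [Finsupp.add_apply, Finsupp.single_eq_same, Finsupp.notMem_support_iff.1 hk,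
        add_zero] at this
    have hA' : A ∈ opIdeal I := by
      simpa using Submodule.sub_mem _ hA (single_mem_submodule k hs)
    rw [map_add, chiT_single]
    refine Submodule.add_mem _ (Submodule.add_mem _ (single_mem_submodule _ ?_)
      (single_mem_submodule _ (Submodule.smul_mem _ _ hs))) (ih hA')
    exact Submodule.smul_mem _ _ (hD s hs)

theorem chiPar_mem (hpar : ∀ s ∈ I, SuperSym.par _ s ∈ I) {A : ℕ →₀ g.V} (hA : A ∈ opIdeal I) :
    SuperSym.chiPar _ A ∈ opIdeal I := by
  intro k
  rw [SuperSym.chiPar_apply]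
  exact Submodule.smul_mem _ _ (hpar _ (hA k))

theorem chiLeft_mem (p : ℕ) (s : g.V) {A : ℕ →₀ g.V} (hA : A ∈ opIdeal I) :
    SuperSym.chiLeft _ p s A ∈ opIdeal I := by
  intro k
  rw [SuperSym.chiLeft_apply]
  exact I.mul_mem_left _ _ (hA k)

/-- Moving `s` past `χ^k` twists it by a power of the parity automorphism, which is why the ideal
has to be parity-stable. -/
theorem chiLeft_mem' (hpar : ∀ s ∈ I, SuperSym.par _ s ∈ I) (p : ℕ) {s : g.V} (hs : s ∈ I)
    (A : ℕ →₀ g.V) : SuperSym.chiLeft _ p s A ∈ opIdeal I := by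
  intro k
  rw [SuperSym.chiLeft_apply]
  exact I.mul_mem_right _ _ (par_pow_mem hpar _ hs)

theorem chiRight_mem (s : g.V) {A : ℕ →₀ g.V} (hA : A ∈ opIdeal I) :
    SuperSym.chiRight _ s A ∈ opIdeal I := by
  intro k
  rw [SuperSym.chiRight_apply]
  exact I.mul_mem_right _ _ (hA k)

theorem chiRight_mem' {s : g.V} (hs : s ∈ I) (A : ℕ →₀ g.V) :
    SuperSym.chiRight _ s A ∈ opIdeal I := by
  intro k
  rw [SuperSym.chiRight_apply]
  exact I.mul_mem_left _ _ hs

theorem opX_mem (hpar : ∀ s ∈ I, SuperSym.par _ s ∈ I) (hD : ∀ s ∈ I, g.D s ∈ I)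
    {C : ℕ →₀ ℕ →₀ g.V} (hC : C ∈ opChiIdeal I) : g.opX C ∈ opChiIdeal I := by
  rw [opX, Finsupp.lsum_apply]
  exact Submodule.sum_mem _ fun k _ => Submodule.add_mem _
    (single_mem_submodule _ (chiT_mem hD (hC k))) (single_mem_submodule _ (chiPar_mem hpar (hC k)))

theorem opConst_mem {B : ℕ →₀ g.V} (hB : B ∈ opIdeal I) : g.opConst B ∈ opChiIdeal I :=
  fun k => single_mem_submodule 0 (hB k)

theorem opLeft_mem (p : ℕ) (s : g.V) {C : ℕ →₀ ℕ →₀ g.V} (hC : C ∈ opChiIdeal I) :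
    opLeft p s C ∈ opChiIdeal I := fun k => chiLeft_mem p s (hC k)

theorem opLeft_mem' (hpar : ∀ s ∈ I, SuperSym.par _ s ∈ I) (p : ℕ) {s : g.V} (hs : s ∈ I)
    (C : ℕ →₀ ℕ →₀ g.V) : opLeft p s C ∈ opChiIdeal I := fun k => chiLeft_mem' hpar p hs (C k)

theorem opMulLeft_mem {s : g.V} (hs : s ∈ I) (B : ℕ →₀ g.V) :
    opMulLeft s B ∈ opIdeal I := fun k => I.mul_mem_right _ (B k) hs

/-- The ideal `ℑ` is stable under the parity operator, if `f` is odd. -/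
theorem par_mem_idealI {x f : g.T} (hf : g.parOp f = -f) (hn : ∀ a ∈ g.nPart x, g.parOp a ∈ g.nPart x)
    {s : g.V} (hs : s ∈ g.idealI x f) : SuperSym.par _ s ∈ g.idealI x f := by
  have : g.idealI x f ≤ (g.idealI x f).comap (SuperSym.par g.curPar) := by
    refine idealI_le (fun a ha => ?_) fun s hs => ?_
    -- Oddness of `f` gives `(f|εa) = -(f|a)`, where `ε` is the parity operator. This matches the
    -- sign in `par ā = -\overline{εa}`, so a generator goes to minus a generator.
    · have h : form (g.val f) (g.val (g.parOp a)) = -form (g.val f) (g.val a) := by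
        have h1 : g.val f = -eps (g.val f) := by
          rw [← neg_eq_iff_eq_neg, ← map_neg, ← hf]; rfl
        conv_lhs => rw [h1]
        change str (-eps (g.val f) * eps (g.val a)) = -str (g.val f * g.val a)
        rw [neg_mul, map_neg, ← eps_mul, str_eps]
      have h2 := bar_sub_mem_idealI (f := f) (hn a ha)
      rw [h] at h2
      rw [TwoSidedIdeal.mem_comap, map_sub, par_bar, AlgHom.commutes]
      have h3 := (g.idealI x f).neg_mem h2
      rwa [map_neg, sub_neg_eq_add, neg_add, ← sub_eq_add_neg] at h3
    · rw [TwoSidedIdeal.mem_comap] at hs ⊢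
      rw [par_D]
      exact (g.idealI x f).neg_mem (D_mem_idealI hs)
  exact (TwoSidedIdeal.mem_comap _).1 (this hs)

/-- The ideal `ℑ` is stable under the bracket with `a` if the brackets of its generators are
contained in it. -/
theorem parBr_mem_idealI {x f : g.T} (hpar : ∀ s ∈ g.idealI x f, SuperSym.par _ s ∈ g.idealI x f)
    {p : ℕ} {a : g.T} (ha : ∀ b ∈ g.nPart x, g.genBr p a b ∈ opIdeal (g.idealI x f))
    {s : g.V} (hs : s ∈ g.idealI x f) : g.parBr p a s ∈ opIdeal (g.idealI x f) := by
  -- By the Leibniz rule and sesquilinearity, the elements of `ℑ` whose bracket with `a` stays in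
  -- `ℑ` form a `D`-stable ideal; hence testing generators is enough.
  let K : TwoSidedIdeal g.V := TwoSidedIdeal.mk'
    {s | s ∈ g.idealI x f ∧ g.parBr p a s ∈ opIdeal (g.idealI x f)}
    ⟨TwoSidedIdeal.zero_mem _, by rw [map_zero]; exact Submodule.zero_mem _⟩
    (fun h h' => ⟨TwoSidedIdeal.add_mem _ h.1 h'.1, by
      rw [map_add]; exact Submodule.add_mem _ h.2 h'.2⟩)
    (fun h => ⟨TwoSidedIdeal.neg_mem _ h.1, by
      rw [map_neg]; exact Submodule.neg_mem _ h.2⟩)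
    (fun {t s} h => ⟨TwoSidedIdeal.mul_mem_left _ _ _ h.1, by
      rw [parBr_mul]
      exact Submodule.add_mem _ (chiLeft_mem p t h.2) (chiRight_mem' h.1 _)⟩)
    (fun {s t} h => ⟨TwoSidedIdeal.mul_mem_right _ _ _ h.1, by
      rw [parBr_mul]
      exact Submodule.add_mem _ (chiLeft_mem' hpar p h.1 _) (chiRight_mem t h.2)⟩)
  have hK : ∀ s, s ∈ K ↔ s ∈ g.idealI x f ∧ g.parBr p a s ∈ opIdeal (g.idealI x f) :=
    fun s => TwoSidedIdeal.mem_mk' _ _ _ _ _ _ _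
  have : g.idealI x f ≤ K := by
    refine idealI_le (fun b hb => ?_) fun s hs => ?_
    · rw [hK, map_sub, parBr_algebraMap, sub_zero, parBr_bar]
      exact ⟨bar_sub_mem_idealI hb, ha b hb⟩
    · rw [hK] at hs ⊢
      rw [parBr_D]
      exact ⟨D_mem_idealI hs.1,
        Submodule.smul_mem _ _ (chiT_mem (fun _ => D_mem_idealI) hs.2)⟩
  exact ((hK s).1 (this hs)).2

end LieSub

section GlIdeal

/-! ### Upper triangular matrices -/

section Upper

variable {m : ℕ}

/-- `a_ij = 0` unless `j ≥ i + d`. -/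
def IsUpper (d : ℕ) (a : Mat m) : Prop := ∀ i j : Fin m, (j : ℕ) < i + d → a i j = 0

theorem IsUpper.mul {d d' : ℕ} {a b : Mat m} (ha : IsUpper d a) (hb : IsUpper d' b) :
    IsUpper (d + d') (a * b) := by
  intro i j hij
  rw [Matrix.mul_apply]
  refine Finset.sum_eq_zero fun k _ => ?_
  by_cases h : (k : ℕ) < i + d
  · rw [ha i k h, zero_mul]
  · rw [hb k j (by omega), mul_zero]

theorem IsUpper.eps {d : ℕ} {a : Mat m} (ha : IsUpper d a) : IsUpper d (eps a) := fun i j hij => by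
  simp [SusyW.eps, ha i j hij]

theorem IsUpper.homPart {d p : ℕ} {a : Mat m} (ha : IsUpper d a) : IsUpper d (homPart p a) :=
  fun i j hij => by simp [homPart_apply, ha i j hij, ha.eps i j hij]

theorem IsUpper.sbr {d d' : ℕ} {a b : Mat m} (ha : IsUpper d a) (hb : IsUpper d' b) :
    IsUpper (d + d') (sbr a b) := by
  intro i j hij
  rw [sbr_apply, Matrix.sum_apply]
  refine Finset.sum_eq_zero fun p _ => ?_
  rw [Matrix.sum_apply]
  refine Finset.sum_eq_zero fun q _ => ?_
  rw [Matrix.sub_apply, Matrix.smul_apply, (ha.homPart.mul hb.homPart) i j hij,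
    (hb.homPart.mul ha.homPart) i j (by omega), smul_zero, sub_zero]

theorem str_apply (a : Mat m) : str a = ∑ i, (-1 : ℂ) ^ pI i * a i i := rfl

theorem IsUpper.str {a : Mat m} (ha : IsUpper 1 a) : str a = 0 := by
  rw [str_apply]
  exact Finset.sum_eq_zero fun i _ => by rw [ha i i (by omega), mul_zero]

theorem IsUpper.mono {d d' : ℕ} (h : d' ≤ d) {a : Mat m} (ha : IsUpper d a) : IsUpper d' a :=
  fun i j hij => ha i j (by omega)

theorem sbr_of_hom {p q : ℕ} {a b : Mat m} (ha : eps a = (-1 : ℂ) ^ p • a)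
    (hb : eps b = (-1 : ℂ) ^ q • b) : sbr a b = a * b - (-1 : ℂ) ^ (p * q) • (b * a) := by
  have key : ∀ {q : ℕ} {b : Mat m} (r : ℕ), eps b = (-1 : ℂ) ^ q • b →
      homPart r b = if Even (r + q) then b else 0 := by
    intro q b r hb
    rw [homPart_apply, hb, smul_smul, ← pow_add]
    split_ifs with h
    · rw [h.neg_one_pow]; module
    · rw [(Nat.not_even_iff_odd.1 h).neg_one_pow]; module
  rw [sbr_apply]
  simp only [key _ ha, key _ hb, Finset.sum_range_succ, Finset.range_zero, Finset.sum_empty]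
  rcases Nat.even_or_odd p with h | h <;> rcases Nat.even_or_odd q with h' | h' <;>
    simp [h, h', parity_simps, Nat.not_even_iff_odd.2, Odd.neg_one_pow, Odd.mul]

theorem sbr_single (k l i j : Fin m) :
    sbr (Matrix.single k l 1) (Matrix.single j i 1)
      = (if l = j then Matrix.single k i (1 : ℂ) else 0)
        - (-1 : ℂ) ^ ((pI k + pI l) * (pI j + pI i)) •
          (if i = k then Matrix.single j l 1 else 0) := by
  rw [sbr_of_hom (eps_single k l) (eps_single j i)]
  congr 2
  · split_ifs with h
    · subst h; simp
    · simp [h]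
  · split_ifs with h
    · subst h; simp
    · simp [h]

theorem form_single (k l i j : Fin m) :
    form (Matrix.single k l (1 : ℂ)) (Matrix.single j i 1)
      = if l = j ∧ i = k then (-1 : ℂ) ^ pI k else 0 := by
  rw [form]
  by_cases h : l = j
  · subst h
    rw [Matrix.single_mul_single_same, str]
    simp only [LinearMap.coe_mk, AddHom.coe_mk, Matrix.single_apply, true_and, mul_one]
    split_ifs with h
    · subst h
      rw [Finset.sum_eq_single i] <;> simp +contextual [eq_comm]
    · refine Finset.sum_eq_zero fun t _ => ?_
      rw [if_neg, mul_zero]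
      rintro ⟨rfl, h'⟩
      exact h h'
  · simp [h]

end Upper

/-! ### The generators of the ideal `ℑ` for `𝔤𝔩(2n+1|2n)` -/

variable {n : ℕ}

/-- In the numbering from zero, the units `e_{t+1,t}` fill the subdiagonal columns `j < 2n` with
`1`, and their `θ`-images fill the columns `j = 4n - 1 - t ≥ 2n` with the signs `τ(t+1,t)`. These
signs are `(-1)^{δ_j}`, and they are what the signs in the row determinant are designed to cancel.
-/
theorem matf_apply (i j : Fin (4 * n + 1)) :
    matf n i j = if (i : ℕ) = j + 1 then (-1 : ℂ) ^ delta n j else 0 := by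
  have key : ∀ t : Fin (2 * n), matF (n := n) ⟨t + 1, by omega⟩ ⟨t, by omega⟩ i j
      = (if (i : ℕ) = t + 1 ∧ (j : ℕ) = t then 1 else 0)
        + (if (i : ℕ) = 4 * n - t ∧ (j : ℕ) + 1 = 4 * n - t then (-1 : ℂ) ^ delta n j else 0) := by
    intro t
    have ht := t.2
    rw [matF, theta_single, Matrix.add_apply, Matrix.smul_apply, Matrix.single_apply,
      Matrix.single_apply]
    simp only [Fin.ext_iff, Fin.val_rev]
    congr 1
    · refine if_congr (by omega) rfl rfl
    · by_cases h : (i : ℕ) = 4 * n - t ∧ (j : ℕ) + 1 = 4 * n - t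
      · rw [if_pos h, if_pos (by omega), smul_eq_mul, mul_one, neg_one_pow_eq_pow_mod_two,
          neg_one_pow_eq_pow_mod_two (n := delta n j)]
        congr 1
        simp only [tauExp, pI, delta]
        rcases Nat.mod_two_eq_zero_or_one (t : ℕ) with d | d
        · have d' : ((t : ℕ) + 1) % 2 = 1 := by omega
          rw [d, d']
          split_ifs <;> omega
        · have d' : ((t : ℕ) + 1) % 2 = 0 := by omega
          rw [d, d']
          split_ifs <;> omega
      · rw [if_neg h, if_neg (by omega), smul_zero]
  rw [matf, Matrix.sum_apply]
  simp only [key]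
  split_ifs with h
  · have hi := i.2
    by_cases hj : (j : ℕ) < 2 * n
    · rw [Finset.sum_eq_single ⟨j, hj⟩]
      · rw [if_pos ⟨h, rfl⟩, if_neg (by simp only; omega), add_zero, delta, if_neg (by omega),
          pow_zero]
      · intro t _ ht
        have := t.2
        rw [Ne, Fin.ext_iff] at ht
        simp only at ht
        rw [if_neg (by omega), if_neg (by omega), add_zero]
      · simp
    -- For `j ≥ 2n` only the `θ`-image for `t = 4n - 1 - j` reaches column `j`.
    · rw [Finset.sum_eq_single ⟨4 * n - 1 - j, by omega⟩]
      · rw [if_neg (by simp only; omega), if_pos (by simp only; omega), zero_add]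
      · intro t _ ht
        have := t.2
        rw [Ne, Fin.ext_iff] at ht
        simp only at ht
        rw [if_neg (by omega), if_neg (by omega), add_zero]
      · simp
  · refine Finset.sum_eq_zero fun t _ => ?_
    have := t.2
    rw [if_neg (by omega), if_neg (by omega), add_zero]

/-- The matrix `f` lives on the first subdiagonal, hence pairs only with the first superdiagonal. -/
theorem form_matf_of_isUpper {a : Mat (4 * n + 1)} (ha : IsUpper 2 a) : form (matf n) a = 0 := by
  rw [form, str_apply]
  refine Finset.sum_eq_zero fun i _ => ?_
  rw [Matrix.mul_apply, Finset.sum_eq_zero, mul_zero]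
  intro j _
  rw [matf_apply]
  split_ifs with h
  · rw [ha j i (by omega), mul_zero]
  · rw [zero_mul]

theorem form_matf_single (i j : Fin (4 * n + 1)) :
    form (matf n) (Matrix.single j i 1) = (-1 : ℂ) ^ pI i * matf n i j := by
  rw [form, str]
  simp only [LinearMap.coe_mk, AddHom.coe_mk]
  rw [Finset.sum_eq_single i]
  · simp
  · intro b _ hb
    simp [hb]
  · simp

/-- The element `e_ij` of `𝔤𝔩`. -/
def unitT (i j : Fin (4 * n + 1)) : (gl (4 * n + 1)).T :=
  (gl (4 * n + 1)).elt (Matrix.single i j 1) trivial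

theorem val_unitT (i j : Fin (4 * n + 1)) :
    (gl (4 * n + 1)).val (unitT i j) = Matrix.single i j 1 := rfl

theorem isUpper_unitT {i j : Fin (4 * n + 1)} (h : i < j) :
    IsUpper 1 ((gl (4 * n + 1)).val (unitT i j)) := fun k l hkl => by
  rw [Fin.lt_def] at h
  rw [val_unitT, Matrix.single_apply, if_neg]
  rintro ⟨rfl, rfl⟩
  omega

theorem parOp_unitT (i j : Fin (4 * n + 1)) :
    (gl (4 * n + 1)).parOp (unitT i j) = (-1 : ℂ) ^ (pI i + pI j) • unitT i j :=
  LieSub.val_injective _ (eps_single i j)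

theorem eq_sum_unitT (a : (gl (4 * n + 1)).T) :
    a = ∑ i, ∑ j, (gl (4 * n + 1)).val a i j • unitT i j := by
  refine LieSub.val_injective _ ?_
  simp only [map_sum, map_smul, val_unitT]
  conv_lhs => rw [Matrix.matrix_eq_sum_single ((gl (4 * n + 1)).val a)]
  simp

/-- As `x` is even, its supercommutator is the ordinary commutator with a diagonal matrix, so
entries are weight vectors. -/
theorem sbr_matx (b : Mat (4 * n + 1)) (i j : Fin (4 * n + 1)) :
    sbr (matx n) b i j = ((j : ℂ) - i) / 2 * b i j := by
  have hx : eps (matx n) = (-1 : ℂ) ^ 0 • matx n := by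
    ext i j
    by_cases h : i = j
    · subst h
      simp [eps, ← two_mul]
    · simp [eps, matx, h]
  have hb : b = homPart 0 b + homPart 1 b := by
    simp only [homPart_apply]; module
  have h : sbr (matx n) b = matx n * b - b * matx n := by
    rw [hb, map_add, sbr_of_hom hx (eps_homPart 0 b), sbr_of_hom hx (eps_homPart 1 b), mul_add,
      add_mul]
    simp only [zero_mul, pow_zero, one_smul]
    abel
  rw [h, matx, Matrix.sub_apply, Matrix.diagonal_mul, Matrix.mul_diagonal]
  ring

theorem unitT_mem_gr (i j : Fin (4 * n + 1)) :
    unitT i j ∈ (gl (4 * n + 1)).gr (xGl n) ((j : ℤ) - i) := by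
  rw [LieSub.gr, Module.End.mem_eigenspace_iff]
  refine LieSub.val_injective _ ?_
  ext k l
  change sbr (matx n) (Matrix.single i j 1) k l = _ * Matrix.single i j (1 : ℂ) k l
  rw [sbr_matx, Matrix.single_apply]
  split_ifs with h
  · rw [h.1, h.2]; push_cast; rfl
  · rw [mul_zero, mul_zero]

/-- The weight `(j - i)/2` of position `(i, j)` is positive exactly above the diagonal. -/
theorem mem_nPart_iff {a : (gl (4 * n + 1)).T} :
    a ∈ (gl (4 * n + 1)).nPart (xGl n) ↔ IsUpper 1 ((gl (4 * n + 1)).val a) := by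
  constructor
  · refine LieSub.gr_induction (C := fun a => IsUpper 1 ((gl (4 * n + 1)).val a))
      (fun k hk a ha i j hij => ?_) (fun _ _ _ => by rw [map_zero]; rfl)
      fun a b ha hb i j hij => by
        rw [map_add, Matrix.add_apply, ha i j hij, hb i j hij, add_zero]
    rw [LieSub.gr, Module.End.mem_eigenspace_iff] at ha
    have h : sbr (matx n) ((gl (4 * n + 1)).val a) i j = (k : ℂ) / 2 * (gl (4 * n + 1)).val a i j :=
      congrFun (congrFun (congrArg (gl (4 * n + 1)).val ha) i) j
    rw [sbr_matx, ← sub_eq_zero, ← sub_mul] at h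
    refine (mul_eq_zero.1 h).resolve_left fun h0 => ?_
    have h1 : (((j : ℤ) - (i : ℤ) - k : ℤ) : ℂ) = 0 := by
      push_cast
      linear_combination 2 * h0
    have h2 : (j : ℤ) - (i : ℤ) - k = 0 := by exact_mod_cast h1
    omega
  · intro h
    rw [eq_sum_unitT a]
    refine Submodule.sum_mem _ fun i _ => Submodule.sum_mem _ fun j _ => ?_
    by_cases hij : (j : ℕ) < i + 1
    · rw [h i j hij, zero_smul]
      exact Submodule.zero_mem _
    · refine Submodule.smul_mem _ _ (Submodule.mem_iSup_of_mem ((j : ℤ) - i) ?_)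
      exact Submodule.mem_iSup_of_mem (by omega) (unitT_mem_gr i j)

theorem unitT_mem_pPart {i j : Fin (4 * n + 1)} (h : i ≤ j) :
    unitT j i ∈ (gl (4 * n + 1)).pPart (xGl n) := by
  rw [Fin.le_def] at h
  exact Submodule.mem_iSup_of_mem ((i : ℤ) - j)
    (Submodule.mem_iSup_of_mem (by omega) (unitT_mem_gr j i))

variable (n) in
/-- The ideal `ℑ` of `𝒱(𝔤𝔩̄)`. -/
abbrev glIdeal : TwoSidedIdeal (gl (4 * n + 1)).V := (gl (4 * n + 1)).idealI (xGl n) (fGl n)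

theorem par_mem_glIdeal {s : (gl (4 * n + 1)).V} (hs : s ∈ glIdeal n) :
    SuperSym.par _ s ∈ glIdeal n := by
  refine LieSub.par_mem_idealI ?_ (fun a ha => ?_) hs
  · refine LieSub.val_injective _ ?_
    have h := eps_matf (n := n)
    rw [pow_one, neg_one_smul] at h
    exact h
  · rw [mem_nPart_iff] at ha ⊢
    exact ha.eps

theorem bar_mem_glIdeal {a : (gl (4 * n + 1)).T} (ha : IsUpper 2 ((gl (4 * n + 1)).val a)) :
    (gl (4 * n + 1)).bar a ∈ glIdeal n := by
  have h := LieSub.bar_sub_mem_idealI (f := fGl n) (mem_nPart_iff.2 (ha.mono one_le_two))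
  have h0 : form ((gl (4 * n + 1)).val (fGl n)) ((gl (4 * n + 1)).val a) = 0 :=
    form_matf_of_isUpper ha
  rwa [h0, map_zero, sub_zero] at h

/-- For two strictly upper triangular matrices the supercommutator has degree at least two in the
matrix grading, where `(f|·)` vanishes, so its bar lies in `ℑ`; their product has zero supertrace,
so there is no `χ`-term. -/
theorem parBr_mem_glIdeal (p : ℕ) {a : (gl (4 * n + 1)).T}
    (ha : IsUpper 1 ((gl (4 * n + 1)).val a)) {s : (gl (4 * n + 1)).V} (hs : s ∈ glIdeal n) :
    (gl (4 * n + 1)).parBr p a s ∈ LieSub.opIdeal (glIdeal n) := by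
  refine LieSub.parBr_mem_idealI (fun _ => par_mem_glIdeal) (fun b hb => ?_) hs
  rw [mem_nPart_iff] at hb
  rw [LieSub.genBr_apply]
  refine Submodule.sum_mem _ fun q _ => ?_
  have h1 : IsUpper 1 ((gl (4 * n + 1)).val ((gl (4 * n + 1)).part p a)) := ha.homPart
  have h2 : IsUpper 1 ((gl (4 * n + 1)).val ((gl (4 * n + 1)).part q b)) := hb.homPart
  have h0 : form ((gl (4 * n + 1)).val ((gl (4 * n + 1)).part p a))
      ((gl (4 * n + 1)).val ((gl (4 * n + 1)).part q b)) = 0 := ((h1.mul h2).mono one_le_two).str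
  rw [h0, map_zero, Finsupp.single_zero, add_zero]
  exact Submodule.smul_mem _ _ (single_mem_submodule 0 (bar_mem_glIdeal (h1.sbr h2)))

theorem barE_eq (i j : Fin (4 * n + 1)) :
    barE n i j = (-1 : ℂ) ^ pI i • (gl (4 * n + 1)).bar (unitT i j) := by
  rw [← map_smul]
  rfl

/-- Modulo `ℑ`, `ē^{ji}` becomes `(-1)^{p(j)} (f|e_ji) = (-1)^{p(i)+p(j)} f_ij`, which is `-f_ij`
because `f` is odd. Thus `𝓛` agrees with `𝒜` below the diagonal. -/
theorem barE_add_mem_glIdeal {i j : Fin (4 * n + 1)} (h : j < i) :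
    barE n j i + algebraMap ℂ _ (matf n i j) ∈ glIdeal n := by
  have h1 := LieSub.bar_sub_mem_idealI (f := fGl n) (a := unitT j i) (x := xGl n)
    (mem_nPart_iff.2 (isUpper_unitT h))
  have h2 : form ((gl (4 * n + 1)).val (fGl n)) ((gl (4 * n + 1)).val (unitT j i))
      = (-1 : ℂ) ^ pI i * matf n i j := form_matf_single i j
  have h3 : (-1 : ℂ) ^ pI j * ((-1) ^ pI i * matf n i j) = -matf n i j := by
    rw [matf_apply]
    split_ifs with hij
    · rw [← mul_assoc, ← pow_add, Odd.neg_one_pow, neg_one_mul]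
      simp only [pI, hij, Nat.odd_iff]
      omega
    · simp
  have h4 := (LieSub.idealSub (glIdeal n)).smul_mem ((-1 : ℂ) ^ pI j) h1
  rw [h2, smul_sub, ← barE_eq, Algebra.algebraMap_eq_smul_one, smul_smul, h3, neg_smul,
    sub_neg_eq_add, ← Algebra.algebraMap_eq_smul_one] at h4
  exact h4

end GlIdeal

section LaxMatrix

variable {n : ℕ}

/-! ### The matrix `𝓛 = D + ∑ e_ij ⊗ ē^{ji}` -/

/-- The left multiplication by the entry `δ_ij D + ē^{ji}` of the matrix `𝓛`. -/
def opL (i j : Fin (4 * n + 1)) : Module.End ℂ (ℕ →₀ (gl (4 * n + 1)).V) :=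
  (if i = j then (gl (4 * n + 1)).opD else 0) + LieSub.opMulLeft (barE n j i)

/-- The left multiplication by the entry `δ_ij (D + χ) + ē^{ji}` of `𝓛`, multiplied by
`(-1)^{p (p(i) + p(j) + 1)}`. -/
def opLchi (p : ℕ) (i j : Fin (4 * n + 1)) : Module.End ℂ (ℕ →₀ ℕ →₀ (gl (4 * n + 1)).V) :=
  (if i = j then (-1 : ℂ) ^ p • (gl (4 * n + 1)).opX else 0) + LieSub.opLeft p (barE n j i)

theorem par_barE (i j : Fin (4 * n + 1)) :
    SuperSym.par _ (barE n j i) = (-1 : ℂ) ^ (pI i + pI j + 1) • barE n j i := by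
  rw [barE_eq, map_smul, LieSub.par_bar, parOp_unitT, map_smul]
  module

theorem par_pow_barE (p : ℕ) (i j : Fin (4 * n + 1)) :
    (SuperSym.par _ ^ p) (barE n j i) = (-1 : ℂ) ^ (p * (pI i + pI j + 1)) • barE n j i := by
  induction p with
  | zero => simp
  | succ p ih =>
    rw [pow_succ', AlgHom.mul_apply, ih, map_smul, par_barE, smul_smul]
    congr 1; ring

theorem neg_one_pow_congr {a b : ℕ} (h : a % 2 = b % 2) : (-1 : ℂ) ^ a = (-1) ^ b := by
  rw [neg_one_pow_eq_pow_mod_two, h, ← neg_one_pow_eq_pow_mod_two]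

/-- This is `[e_kl, e_ji] = δ_lj e_ki ∓ δ_ik e_jl` together with the central term `χ(e_kl|e_ji)`.
The `δ_ik` term is kept on the left, so that the right side is what `𝓛_χ` applied to a column will
produce. -/
theorem parBr_barE_add {p : ℕ} {k l : Fin (4 * n + 1)} (hp : p % 2 = (pI k + pI l) % 2)
    (i j : Fin (4 * n + 1)) :
    (gl (4 * n + 1)).parBr p (unitT k l) (barE n j i)
        + (if i = k then (-1 : ℂ) ^ p • Finsupp.single 0 (barE n j l) else 0)
      = (if j = l then (-1 : ℂ) ^ (p * (pI i + pI k + 1)) • Finsupp.single 0 (barE n k i) else 0)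
        + (if j = l ∧ i = k then (-1 : ℂ) ^ p • Finsupp.single 1 1 else 0) := by
  have hk : (gl (4 * n + 1)).parOp (unitT k l) = (-1 : ℂ) ^ p • unitT k l := by
    rw [parOp_unitT, neg_one_pow_congr hp]
  have had : (gl (4 * n + 1)).ad (unitT k l) (unitT j i) = (if j = l then unitT k i else 0)
      - (-1 : ℂ) ^ (p * (pI j + pI i)) • (if i = k then unitT j l else 0) := by
    refine LieSub.val_injective _ ?_
    rw [map_sub, map_smul, apply_ite (gl (4 * n + 1)).val, apply_ite (gl (4 * n + 1)).val, map_zero]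
    refine (sbr_single k l i j).trans ?_
    rw [pow_mul, pow_mul, neg_one_pow_congr hp]
    simp only [eq_comm (a := l)]
    rfl
  rw [barE_eq, map_smul, LieSub.parBr_bar, LieSub.genBr_of_hom hk (parOp_unitT j i), had,
    val_unitT, val_unitT, form_single]
  have k1 : p % 2 = 0 ∨ p % 2 = 1 := by omega
  -- `e1`, `e2` and `e3` reconcile the signs of the `δ_jl` term, the `δ_ik` term and the central
  -- term, with `p ≡ p(k) + p(l)`.
  have e1 : j = l → (-1 : ℂ) ^ pI j * (-1) ^ (p * (pI j + pI i + 1))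
      = (-1 : ℂ) ^ (p * (pI i + pI k + 1)) * (-1) ^ pI k := by
    rintro rfl
    rw [← pow_add, ← pow_add]
    refine neg_one_pow_congr ?_
    rw [Nat.add_mod, Nat.mul_mod, Nat.add_mod (p * _), Nat.mul_mod p]
    simp only [pI] at hp ⊢
    rcases k1 with h | h <;> rw [h] <;> omega
  have e2 : (-1 : ℂ) ^ pI j * ((-1) ^ (p * (pI j + pI i + 1)) * (-1) ^ (p * (pI j + pI i)))
      = (-1 : ℂ) ^ p * (-1) ^ pI j := by
    rw [← pow_add, ← pow_add, ← pow_add]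
    refine neg_one_pow_congr ?_
    rw [show pI j + (p * (pI j + pI i + 1) + p * (pI j + pI i))
      = p + pI j + 2 * (p * (pI j + pI i)) by ring]
    omega
  have e3 : j = l → i = k → (-1 : ℂ) ^ pI j * (-1) ^ pI k = (-1) ^ p := by
    rintro rfl rfl
    rw [← pow_add]
    exact neg_one_pow_congr (by omega)
  simp only [eq_comm (a := l), barE_eq]
  split_ifs with h1 h2 h3 h4 <;> simp_all [Algebra.algebraMap_eq_smul_one, smul_smul, smul_sub,
    map_sub, Finsupp.single_sub]
  abel

/-- The bracket of a product with an entry of `𝓛`. -/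
theorem opBr_opL {p : ℕ} {k l : Fin (4 * n + 1)} (hp : p % 2 = (pI k + pI l) % 2)
    (i j : Fin (4 * n + 1)) (B : ℕ →₀ (gl (4 * n + 1)).V) :
    LieSub.opBr p (unitT k l) (opL i j B)
      + (if i = k then (-1 : ℂ) ^ p • (gl (4 * n + 1)).opConst (opL l j B) else 0)
      = opLchi p i j (LieSub.opBr p (unitT k l) B)
        + (if j = l then opLchi p i k ((gl (4 * n + 1)).opConst B) else 0) := by
  have h1 : LieSub.opRight ((gl (4 * n + 1)).parBr p (unitT k l) (barE n j i)) B
      + (if i = k then (-1 : ℂ) ^ p • (gl (4 * n + 1)).opConst (opL l j B) else 0)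
      = (if j = l then opLchi p i k ((gl (4 * n + 1)).opConst B) else 0) := by
    have h0 : LieSub.opRight (0 : ℕ →₀ (gl (4 * n + 1)).V) B = 0 := by
      rw [← zero_smul ℂ (0 : ℕ →₀ (gl (4 * n + 1)).V), LieSub.opRight_smul, zero_smul]
    have h2 := congrArg (fun A => LieSub.opRight A B) (parBr_barE_add hp i j)
    simp only [LieSub.opRight_add] at h2
    simp only [opL, opLchi, LinearMap.add_apply, LieSub.opLeft_opConst, par_pow_barE,
      LieSub.opMulLeft_smul, map_smul, map_add, smul_add]
    by_cases hj : j = l <;> by_cases hi : i = k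
    -- Only here do both deltas hold: the central term `χB` is exactly the difference between `(D +
    -- χ)B` and `DB`.
    · subst hj hi
      simp only [if_true, and_self, LieSub.opRight_smul, LieSub.opRight_single_zero] at h2
      simp only [if_true, LinearMap.smul_apply, LieSub.opX_opConst, smul_add]
      rw [add_left_comm, h2]
      abel
    · simp only [hj, hi, if_true, if_false, and_false, h0, add_zero, LieSub.opRight_smul,
        LieSub.opRight_single_zero, LinearMap.zero_apply, zero_add] at h2 ⊢
      exact h2
    · have hj' : ¬l = j := fun h => hj h.symm
      simp only [hj, hj', hi, if_true, if_false, false_and, h0, add_zero, LieSub.opRight_smul,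
        LieSub.opRight_single_zero, LinearMap.zero_apply, map_zero, smul_zero, zero_add] at h2 ⊢
      exact h2
    · simp only [hj, hi, if_false, and_false, h0, add_zero] at h2 ⊢
      exact h2
  have h2 : LieSub.opBr p (unitT k l) (opL i j B) = opLchi p i j (LieSub.opBr p (unitT k l) B)
      + LieSub.opRight ((gl (4 * n + 1)).parBr p (unitT k l) (barE n j i)) B := by
    rw [opL, opLchi, LinearMap.add_apply, LinearMap.add_apply, map_add, LieSub.opBr_opMulLeft,
      ← add_assoc]
    congr 2
    split_ifs
    · rw [LieSub.opBr_opD, LinearMap.smul_apply]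
    · rw [LinearMap.zero_apply, LinearMap.zero_apply, map_zero]
  rw [h2, add_assoc, h1]

theorem mem_of_add_mem {E : Type} [AddCommMonoid E] [Module ℂ E] {P : Submodule ℂ E} {x y : E}
    (hx : x ∈ P) (h : x + y ∈ P) : y ∈ P := by
  have h0 : x + (-1 : ℂ) • x = 0 := by
    nth_rewrite 1 [← one_smul ℂ x]
    rw [← add_smul, add_neg_cancel, zero_smul]
  have h1 := P.add_mem h (P.smul_mem (-1) hx)
  rwa [add_right_comm, h0, zero_add] at h1

theorem opLchi_mem (p : ℕ) (i j : Fin (4 * n + 1)) {C : ℕ →₀ ℕ →₀ (gl (4 * n + 1)).V}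
    (hC : C ∈ LieSub.opChiIdeal (glIdeal n)) : opLchi p i j C ∈ LieSub.opChiIdeal (glIdeal n) := by
  rw [opLchi, LinearMap.add_apply]
  refine Submodule.add_mem _ ?_ (LieSub.opLeft_mem p _ hC)
  split_ifs
  · exact Submodule.smul_mem _ _ (LieSub.opX_mem (fun _ => par_mem_glIdeal)
      (fun _ => LieSub.D_mem_idealI) hC)
  · exact Submodule.zero_mem _

theorem opLchi_add_mem (p : ℕ) {i j : Fin (4 * n + 1)} (h : j < i)
    (C : ℕ →₀ ℕ →₀ (gl (4 * n + 1)).V) :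
    opLchi p i j C + matf n i j • C ∈ LieSub.opChiIdeal (glIdeal n) := by
  rw [opLchi, if_neg h.ne', zero_add, ← LieSub.opLeft_algebraMap p, ← LieSub.opLeft_add]
  exact LieSub.opLeft_mem' (fun _ => par_mem_glIdeal) p (barE_add_mem_glIdeal h) C

theorem opL_add_mem {i j : Fin (4 * n + 1)} (h : j < i) (B : ℕ →₀ (gl (4 * n + 1)).V) :
    opL i j B + matf n i j • B ∈ LieSub.opIdeal (glIdeal n) := by
  rw [opL, if_neg h.ne', zero_add, ← LieSub.opMulLeft_algebraMap, ← LieSub.opMulLeft_add]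
  exact LieSub.opMulLeft_mem (barE_add_mem_glIdeal h) B

theorem matf_eq_zero {i j : Fin (4 * n + 1)} (h : (i : ℕ) ≠ j + 1) : matf n i j = 0 := by
  rw [matf_apply, if_neg h]

theorem matf_ne_zero {i j : Fin (4 * n + 1)} (h : (i : ℕ) = j + 1) : matf n i j ≠ 0 := by
  rw [matf_apply, if_pos h]
  exact pow_ne_zero _ (neg_ne_zero.2 one_ne_zero)

/-- Modulo the ideal `ℑ`, the lower rows of `𝓛` determine a column from its last entry. -/
theorem mem_of_opLchi_mem {p : ℕ} {u : Fin (4 * n + 1) → ℕ →₀ ℕ →₀ (gl (4 * n + 1)).V}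
    (hlast : u (Fin.last _) ∈ LieSub.opChiIdeal (glIdeal n))
    (hu : ∀ i ≠ 0, ∑ j, opLchi p i j (u j) ∈ LieSub.opChiIdeal (glIdeal n)) (j) :
    u j ∈ LieSub.opChiIdeal (glIdeal n) := by
  -- Back-substitution from the last entry upwards: `d` bounds the distance of `j` from the last
  -- index.
  suffices h : ∀ d : ℕ, ∀ j : Fin (4 * n + 1), 4 * n ≤ j + d →
      u j ∈ LieSub.opChiIdeal (glIdeal n) from h (4 * n) j (by omega)
  intro d
  induction d with
  | zero =>
    intro j hj
    rwa [show j = Fin.last _ from Fin.ext (by rw [Fin.val_last]; omega)]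
  | succ d ih =>
    intro j hj
    by_cases hjl : (j : ℕ) = 4 * n
    · rwa [show j = Fin.last _ from Fin.ext hjl]
    let i : Fin (4 * n + 1) := ⟨j + 1, by omega⟩
    have hij : (i : ℕ) = j + 1 := rfl
    -- Row `i = j + 1` of `(𝓛_χ + f)u` lies in `ℑ`: to the left of the diagonal the coefficient
    -- itself is in `ℑ`, and from the diagonal on `u_t` is already known to be. Removing row `i` of
    -- `𝓛_χ u` leaves only `f_ij u_j`.
    have h1 : ∑ t, (opLchi p i t (u t) + matf n i t • u t) ∈ LieSub.opChiIdeal (glIdeal n) := by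
      refine Submodule.sum_mem _ fun t _ => ?_
      by_cases ht : t < i
      · exact opLchi_add_mem p ht _
      · rw [Fin.lt_def] at ht
        rw [matf_eq_zero (by omega), zero_smul, add_zero]
        exact opLchi_mem p i t (ih t (by omega))
    rw [Finset.sum_add_distrib] at h1
    have hi : i ≠ 0 := fun h => by
      have := congrArg Fin.val h
      rw [hij] at this
      exact absurd this (Nat.succ_ne_zero _)
    have h2 := mem_of_add_mem (hu i hi) h1
    rw [Finset.sum_eq_single j (fun t _ ht => ?_) (fun h => absurd (Finset.mem_univ _) h)] at h2
    -- The subdiagonal entry of `f` is a sign, hence invertible.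
    · exact (Submodule.smul_mem_iff _ (matf_ne_zero hij)).1 h2
    · rw [matf_eq_zero, zero_smul]
      rw [Ne, Fin.ext_iff] at ht
      omega

/-- If the lower rows of `𝓛 v` vanish modulo `ℑ` and the last entry of `v` is `1`, then `e_kl`,
`k < l`, annihilates the first row modulo `ℑ`. -/
theorem opBr_unitT_mem {p : ℕ} {k l : Fin (4 * n + 1)} (hp : p % 2 = (pI k + pI l) % 2)
    (hkl : k < l) {v : Fin (4 * n + 1) → ℕ →₀ (gl (4 * n + 1)).V}
    (hlast : v (Fin.last _) = Finsupp.single 0 1)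
    (hv : ∀ i ≠ 0, ∑ j, opL i j (v j) ∈ LieSub.opIdeal (glIdeal n)) :
    LieSub.opBr p (unitT k l) (∑ j, opL 0 j (v j)) ∈ LieSub.opChiIdeal (glIdeal n) := by
  -- The gauge variation of `v`: the `δ_jl` terms of the variation of `𝓛` act on `v_l` through
  -- column `k`, so they are absorbed by adding `v_l` in position `k`.
  let u : Fin (4 * n + 1) → ℕ →₀ ℕ →₀ (gl (4 * n + 1)).V := fun j =>
    LieSub.opBr p (unitT k l) (v j) + if j = k then (gl (4 * n + 1)).opConst (v l) else 0
  -- Since `k < l`, row `l` is one of the lower rows, so the correction term `(𝓛 v)_l` is in `ℑ`.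
  have hl : l ≠ 0 := fun h => by rw [h] at hkl; exact absurd hkl (Fin.not_lt_zero k)
  have key : ∀ i, LieSub.opBr p (unitT k l) (∑ j, opL i j (v j))
      + (if i = k then (-1 : ℂ) ^ p • (gl (4 * n + 1)).opConst (∑ j, opL l j (v j)) else 0)
      = ∑ j, opLchi p i j (u j) := by
    intro i
    have h1 : (if i = k then (-1 : ℂ) ^ p • (gl (4 * n + 1)).opConst (∑ j, opL l j (v j)) else 0)
        = ∑ j, if i = k then (-1 : ℂ) ^ p • (gl (4 * n + 1)).opConst (opL l j (v j)) else 0 := by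
      split_ifs
      · rw [map_sum, Finset.smul_sum]
      · rw [Finset.sum_const_zero]
    rw [h1, map_sum, ← Finset.sum_add_distrib]
    simp only [u, map_add, opBr_opL hp, Finset.sum_add_distrib, apply_ite (opLchi p i _), map_zero]
    rw [Finset.sum_eq_single l (fun t _ ht => if_neg ht) (fun h => absurd (Finset.mem_univ _) h),
      Finset.sum_eq_single k (fun t _ ht => if_neg ht) (fun h => absurd (Finset.mem_univ _) h),
      if_pos rfl, if_pos rfl]
  have hc : ∀ i : Fin (4 * n + 1), (if i = k then (-1 : ℂ) ^ p •
      (gl (4 * n + 1)).opConst (∑ j, opL l j (v j)) else 0) ∈ LieSub.opChiIdeal (glIdeal n) := by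
    intro i
    split_ifs
    · exact Submodule.smul_mem _ _ (LieSub.opConst_mem (hv l hl))
    · exact Submodule.zero_mem _
  have hu : ∀ j, u j ∈ LieSub.opChiIdeal (glIdeal n) := by
    refine mem_of_opLchi_mem (p := p) ?_ fun i hi => ?_
    -- The last entry of `u` vanishes: the constant `1` has zero bracket, and `k < l` keeps the
    -- added `v_l` out of that position.
    · have hk : Fin.last (4 * n) ≠ k := (hkl.trans_le (Fin.le_last l)).ne'
      have h1 : (gl (4 * n + 1)).parBr p (unitT k l) 1 = 0 := by
        have := LieSub.parBr_algebraMap p (unitT k l) 1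
        rwa [map_one] at this
      change _ + ite _ _ _ ∈ _
      rw [if_neg hk, add_zero, hlast, LieSub.opBr_single, h1, Finsupp.single_zero]
      exact Submodule.zero_mem _
    · rw [← key]
      refine Submodule.add_mem _ (fun t => ?_) (hc i)
      exact parBr_mem_glIdeal p (isUpper_unitT hkl) (hv i hi t)
  -- In row `0` the identity `key` expresses the desired bracket as `(𝓛_χ u)_0` minus a correction,
  -- and both are now known to lie in `ℑ`.
  refine mem_of_add_mem (hc 0) ?_
  rw [(add_comm _ _).trans (key 0)]
  exact Submodule.sum_mem _ fun j _ => opLchi_mem p 0 j (hu j)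

end LaxMatrix

section RowDet

/-! ### Stability of `𝒱(𝔭̄)` under parity and `D` -/

namespace LieSub

variable {m : ℕ} {g : LieSub m}

theorem par_mem_Vp {x : g.T} (hx : g.parOp x = x) {s : g.V} (hs : s ∈ g.Vp x) :
    SuperSym.par _ s ∈ g.Vp x := by
  have H : ∀ a, g.parOp (g.ad x a) = g.ad x (g.parOp a) := fun a => by rw [parOp_ad, hx]
  induction hs using Algebra.adjoin_induction with
  | mem s hs =>
    obtain ⟨k, a, ha, rfl⟩ := hs
    rw [SuperSym.par_ι, curPar_single]
    exact Algebra.subset_adjoin ⟨k, _, Submodule.smul_mem _ _ (iSup_gr_map H ha), rfl⟩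
  | algebraMap r => rw [AlgHom.commutes]; exact Subalgebra.algebraMap_mem _ r
  | add a b _ _ ha hb => rw [map_add]; exact Subalgebra.add_mem _ ha hb
  | mul a b _ _ ha hb => rw [map_mul]; exact Subalgebra.mul_mem _ ha hb

theorem D_mem_Vp {x : g.T} (hx : g.parOp x = x) {s : g.V} (hs : s ∈ g.Vp x) :
    g.D s ∈ g.Vp x := by
  induction hs using Algebra.adjoin_induction with
  | mem s hs =>
    obtain ⟨k, a, ha, rfl⟩ := hs
    rw [D_ι, curD_single]
    exact Algebra.subset_adjoin ⟨k + 1, a, ha, rfl⟩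
  | algebraMap r => rw [D_algebraMap]; exact Subalgebra.zero_mem _
  | add a b _ _ ha hb => rw [map_add]; exact Subalgebra.add_mem _ ha hb
  | mul a b ha' hb' ha hb =>
    rw [D_mul]
    exact Subalgebra.add_mem _ (Subalgebra.mul_mem _ ha hb')
      (Subalgebra.mul_mem _ (par_mem_Vp hx ha') hb)

/-- The differential operators with coefficients in `𝒱(𝔭̄)`. -/
abbrev opVp (x : g.T) : Submodule ℂ (ℕ →₀ g.V) :=
  Finsupp.submodule fun _ : ℕ => Subalgebra.toSubmodule (g.Vp x)

theorem opD_mem_opVp {x : g.T} (hx : g.parOp x = x) {B : ℕ →₀ g.V} (hB : B ∈ opVp x) :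
    g.opD B ∈ opVp x := by
  rw [opD, Finsupp.lsum_apply]
  exact Submodule.sum_mem _ fun k _ => Submodule.add_mem _
    (single_mem_submodule _ (D_mem_Vp hx (hB k))) (single_mem_submodule _ (par_mem_Vp hx (hB k)))

end LieSub

variable {n : ℕ}

/-! ### The row determinant as the first row of `𝓛 v` -/

theorem opMul_matA {i j : Fin (4 * n + 1)} (h : i ≤ j) (B : ℕ →₀ (gl (4 * n + 1)).V) :
    (gl (4 * n + 1)).opMul (matA n i j) B = opL i j B := by
  have h1 : ∀ B : ℕ →₀ (gl (4 * n + 1)).V, LieSub.opMulLeft 1 B = B := fun B => by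
    ext1 k
    exact one_mul _
  have hf : matf n i j = 0 := matf_eq_zero (by rw [Fin.le_def] at h; omega)
  rw [matA, if_pos h, hf, map_zero, Finsupp.single_zero, sub_zero, LieSub.opMul_add_left, opL,
    LinearMap.add_apply, LieSub.opMul_single, pow_zero, Module.End.one_apply]
  congr 1
  split_ifs
  · rw [LieSub.opMul_single, h1, pow_one]
  · rw [LieSub.opMul, Finsupp.sum_zero_index, LinearMap.zero_apply]

/-- The signed sum of the products along all paths which start in the row `r`. -/
def rowSum (r : Fin (4 * n + 1)) : ℕ →₀ (gl (4 * n + 1)).V :=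
  ∑ J ∈ (Finset.Ici r).powerset.filter fun J => Fin.last (4 * n) ∈ J,
    (-1 : ℂ) ^ (∑ j ∈ J, delta n j) • pathProd n r J.sort

/-- The signed sum of the products along all paths which start in the row after `j`. -/
def tailSum (j : Fin (4 * n + 1)) : ℕ →₀ (gl (4 * n + 1)).V :=
  ∑ J ∈ (Finset.Ioi j).powerset.filter fun J => Fin.last (4 * n) ∈ insert j J,
    (-1 : ℂ) ^ (∑ t ∈ J, delta n t) • pathProd n (j + 1) J.sort

/-- Every index set lies in the interval starting at `0`, so the path sums agree; only the global
sign `(-1)^n` is split off. -/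
theorem rdet_eq : rdet n = (-1 : ℂ) ^ n • rowSum 0 := by
  rw [rdet, rowSum, Finset.smul_sum]
  refine Finset.sum_congr ?_ fun J _ => by rw [smul_smul, pow_add]
  ext J
  simp only [Finset.mem_filter, Finset.mem_univ, true_and, Finset.mem_powerset]
  exact ⟨fun h => ⟨fun j _ => Finset.mem_Ici.2 (Fin.zero_le j), h⟩, fun h => h.2⟩

/-- Only the empty continuation remains. The row `j + 1` wraps around to `0` here, harmlessly,
because the empty path ignores its starting row. -/
theorem tailSum_last : tailSum (Fin.last (4 * n)) = Finsupp.single 0 1 := by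
  have h : (Finset.Ioi (Fin.last (4 * n))).powerset.filter
      (fun J => Fin.last (4 * n) ∈ insert (Fin.last (4 * n)) J) = {∅} := by
    ext J
    have h0 : Finset.Ioi (Fin.last (4 * n)) = ∅ := Finset.Ioi_top
    simp [h0]
  rw [tailSum, h, Finset.sum_singleton, Finset.sum_empty, pow_zero, one_smul, Finset.sort_empty,
    pathProd]

theorem tailSum_eq {i j : Fin (4 * n + 1)} (h : (i : ℕ) = j + 1) : tailSum j = rowSum i := by
  have hj : (j : ℕ) < 4 * n := by omega
  have hij : j + 1 = i := Fin.ext (by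
    rw [Fin.val_add_one_of_lt (by rw [Fin.lt_def, Fin.val_last]; exact hj), h])
  rw [tailSum, rowSum, hij]
  refine Finset.sum_congr ?_ fun _ _ => rfl
  ext J
  have h1 : Finset.Ioi j = Finset.Ici i := by
    ext t
    rw [Finset.mem_Ioi, Finset.mem_Ici, Fin.lt_def, Fin.le_def]
    omega
  have h2 : Fin.last (4 * n) ≠ j := fun h => by rw [← h, Fin.val_last] at hj; omega
  rw [Finset.mem_filter, Finset.mem_filter, h1, Finset.mem_insert, or_iff_right h2]

/-- Expansion by the first step: the smallest index `j` of the path selects the entry in column `j`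
of row `r`, and the rest is a path starting in the row after `j`. -/
theorem rowSum_eq (r : Fin (4 * n + 1)) :
    rowSum r = ∑ j ∈ Finset.Ici r, opL r j ((-1 : ℂ) ^ delta n j • tailSum j) := by
  simp only [rowSum, tailSum, Finset.smul_sum, map_sum]
  rw [Finset.sum_sigma']
  symm
  -- A set of indices corresponds to its minimum together with the remaining elements, all of them
  -- larger.
  refine Finset.sum_bij (fun q _ => insert q.1 q.2) ?_ ?_ ?_ ?_
  · rintro ⟨j, J⟩ hq
    simp only [Finset.mem_sigma, Finset.mem_filter, Finset.mem_powerset, Finset.mem_Ici] at hq ⊢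
    refine ⟨Finset.insert_subset (Finset.mem_Ici.2 hq.1) fun t ht => ?_, hq.2.2⟩
    exact Finset.mem_Ici.2 (hq.1.trans (Finset.mem_Ioi.1 (hq.2.1 ht)).le)
  · rintro ⟨j, J⟩ hq ⟨j', J'⟩ hq' h
    simp only [Finset.mem_sigma, Finset.mem_filter, Finset.mem_powerset] at hq hq' h
    have hJ : j ∉ J := fun h => lt_irrefl j (Finset.mem_Ioi.1 (hq.2.1 h))
    have hJ' : j' ∉ J' := fun h => lt_irrefl j' (Finset.mem_Ioi.1 (hq'.2.1 h))
    have key : ∀ {j j' : Fin (4 * n + 1)} {J J' : Finset (Fin (4 * n + 1))}, J' ⊆ Finset.Ioi j' →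
        insert j J = insert j' J' → j' ≤ j := by
      intro j j' J J' hJ h
      have h1 : j ∈ insert j' J' := h ▸ Finset.mem_insert_self j J
      rcases Finset.mem_insert.1 h1 with h2 | h2
      · exact h2.ge
      · exact (Finset.mem_Ioi.1 (hJ h2)).le
    obtain rfl : j = j' := le_antisymm (key hq.2.1 h.symm) (key hq'.2.1 h)
    have h2 := congrArg (Finset.erase · j) h
    simp only [Finset.erase_insert hJ, Finset.erase_insert hJ'] at h2
    rw [h2]
  · intro J hJ
    simp only [Finset.mem_filter, Finset.mem_powerset] at hJ
    have hne : J.Nonempty := ⟨_, hJ.2⟩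
    refine ⟨⟨J.min' hne, J.erase (J.min' hne)⟩, ?_, Finset.insert_erase (J.min'_mem hne)⟩
    simp only [Finset.mem_sigma, Finset.mem_filter, Finset.mem_powerset]
    refine ⟨hJ.1 (J.min'_mem hne), fun t ht => Finset.mem_Ioi.2 (J.min'_lt_of_mem_erase_min' hne ht),
      ?_⟩
    rw [Finset.insert_erase (J.min'_mem hne)]
    exact hJ.2
  · rintro ⟨j, J⟩ hq
    simp only [Finset.mem_sigma, Finset.mem_filter, Finset.mem_powerset, Finset.mem_Ici] at hq ⊢
    have hJ : j ∉ J := fun h => lt_irrefl j (Finset.mem_Ioi.1 (hq.2.1 h))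
    rw [Finset.sum_insert hJ, Finset.sort_insert _ (fun t ht => (Finset.mem_Ioi.1 (hq.2.1 ht)).le) hJ,
      pathProd, opMul_matA hq.1, pow_add, mul_smul, map_smul, map_smul]

variable (n) in
/-- The column `v` with `(𝓛 v)_i ∈ ℑ` for `i > 1`. -/
def colV (j : Fin (4 * n + 1)) : ℕ →₀ (gl (4 * n + 1)).V := (-1 : ℂ) ^ delta n j • tailSum j

/-- The last index is the even number `4n` when numbering from zero, so its sign exponent vanishes.
-/
theorem colV_last : colV n (Fin.last (4 * n)) = Finsupp.single 0 1 := by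
  rw [colV, tailSum_last, delta, if_neg, pow_zero, one_smul]
  rw [Fin.val_last]
  omega

theorem sum_opL_colV_zero : ∑ j, opL 0 j (colV n j) = rowSum 0 := by
  rw [rowSum_eq]
  refine (Finset.sum_congr ?_ fun _ _ => rfl).symm
  ext j
  simp

/-- Below the diagonal `𝓛` reduces to `-f`, leaving `-f_{i,i-1} v_{i-1}`; this cancels the part of
row `i` from the diagonal on, by the recursion that defines `v`. -/
theorem sum_opL_colV_mem (i : Fin (4 * n + 1)) (hi : i ≠ 0) :
    ∑ j, opL i j (colV n j) ∈ LieSub.opIdeal (glIdeal n) := by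
  have hi' : (i : ℕ) ≠ 0 := fun h => hi (Fin.ext h)
  let k : Fin (4 * n + 1) := ⟨i - 1, by omega⟩
  have hk : (i : ℕ) = k + 1 := by simp only [k]; omega
  -- The sign in `v_k` squares away against `f_ik = (-1)^{δ_k}`, and the tail after `k = i - 1` is
  -- the path sum of row `i`.
  have h1 : ∑ j, matf n i j • colV n j = ∑ j ∈ Finset.Ici i, opL i j (colV n j) := by
    rw [Finset.sum_eq_single k (fun j _ hj => ?_) (fun h => absurd (Finset.mem_univ _) h)]
    · rw [matf_apply, if_pos hk, colV, smul_smul, ← pow_add, Even.neg_one_pow ⟨_, rfl⟩, one_smul,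
        tailSum_eq hk, rowSum_eq]
      rfl
    · rw [matf_eq_zero, zero_smul]
      rw [Ne, Fin.ext_iff] at hj
      omega
  -- By `h1` the entries from the diagonal on may be traded for `f v`, so the whole row is a sum of
  -- `(𝓛_ij + f_ij) v_j` over `j < i`, termwise in `ℑ`.
  have h2 : ∑ j, opL i j (colV n j)
      = ∑ j ∈ Finset.univ.filter (· < i), (opL i j (colV n j) + matf n i j • colV n j) := by
    have h3 : ∑ j, matf n i j • colV n j
        = ∑ j ∈ Finset.univ.filter (· < i), matf n i j • colV n j := by
      refine (Finset.sum_filter_of_ne fun j _ hj => ?_).symm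
      by_contra h
      rw [Fin.lt_def] at h
      exact hj (by rw [matf_eq_zero (by omega), zero_smul])
    rw [Finset.sum_add_distrib, ← h3, h1, ← Finset.sum_filter_add_sum_filter_not Finset.univ (· < i)]
    congr 2
    ext j
    simp
  rw [h2]
  exact Submodule.sum_mem _ fun j hj => opL_add_mem (Finset.mem_filter.1 hj).2 _

/-! ### The coefficients of the row determinant lie in `𝒲(𝔤𝔩̄, f)` -/

theorem parBr_rowSum_mem (p : ℕ) {a : (gl (4 * n + 1)).T}
    (ha : a ∈ (gl (4 * n + 1)).nPart (xGl n)) (k : ℕ) :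
    (gl (4 * n + 1)).parBr p a (rowSum 0 k) ∈ LieSub.opIdeal (glIdeal n) := by
  -- Linearity in `a` reduces the claim from `𝔫` to the matrix units above the diagonal.
  let φ : (gl (4 * n + 1)).T →ₗ[ℂ] (ℕ →₀ (gl (4 * n + 1)).V) :=
    { toFun := fun a => (gl (4 * n + 1)).parBr p a (rowSum 0 k)
      map_add' := fun a b => LieSub.parBr_add p a b _
      map_smul' := fun r a => LieSub.parBr_smul p r a _ }
  change a ∈ (LieSub.opIdeal (glIdeal n)).comap φ
  rw [mem_nPart_iff] at ha
  rw [eq_sum_unitT a]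
  refine Submodule.sum_mem _ fun i _ => Submodule.sum_mem _ fun j _ => ?_
  by_cases hij : i < j
  · refine Submodule.smul_mem _ _ ?_
    change (gl (4 * n + 1)).parBr p (unitT i j) (rowSum 0 k) ∈ LieSub.opIdeal (glIdeal n)
    -- If `p` is not the parity of `e_ij`, then its component of parity `p`, and with it the
    -- bracket, is zero.
    by_cases hp : Even (p + (pI i + pI j))
    · have h := opBr_unitT_mem (p := p) (k := i) (l := j)
        (by rw [Nat.even_iff] at hp; omega) hij colV_last sum_opL_colV_mem
      rw [sum_opL_colV_zero] at h
      exact h k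
    · rw [LieSub.parBr_eq_zero (parOp_unitT i j) hp]
      exact Submodule.zero_mem _
  · rw [Fin.lt_def] at hij
    rw [ha i j (by omega), zero_smul]
    exact Submodule.zero_mem _

theorem parOp_xGl : (gl (4 * n + 1)).parOp (xGl n) = xGl n := by
  refine LieSub.val_injective _ ?_
  ext i j
  change (-1 : ℂ) ^ (pI i + pI j) * matx n i j = matx n i j
  by_cases h : i = j
  · rw [h, Even.neg_one_pow ⟨_, rfl⟩, one_mul]
  · rw [matx, Matrix.diagonal_apply_ne _ h, mul_zero]

theorem barE_mem_Vp {i j : Fin (4 * n + 1)} (h : i ≤ j) :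
    barE n j i ∈ (gl (4 * n + 1)).Vp (xGl n) := by
  have h1 : (gl (4 * n + 1)).bar (unitT j i) ∈ (gl (4 * n + 1)).Vp (xGl n) :=
    Algebra.subset_adjoin ⟨0, unitT j i, unitT_mem_pPart h, rfl⟩
  rw [barE_eq]
  exact Subalgebra.smul_mem _ h1 _

theorem opL_mem_opVp {i j : Fin (4 * n + 1)} (h : i ≤ j) {B : ℕ →₀ (gl (4 * n + 1)).V}
    (hB : B ∈ LieSub.opVp (xGl n)) : opL i j B ∈ LieSub.opVp (xGl n) := by
  rw [opL, LinearMap.add_apply]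
  refine Submodule.add_mem _ ?_ fun k => Subalgebra.mul_mem _ (barE_mem_Vp h) (hB k)
  split_ifs
  · exact LieSub.opD_mem_opVp parOp_xGl hB
  · exact Submodule.zero_mem _

/-- Paths use only entries on or above the diagonal of `𝓛`, that is `D` and bars of units of
nonpositive degree. The induction runs from the last row upwards along the expansion by the first
step. -/
theorem rowSum_mem_opVp (r : Fin (4 * n + 1)) : rowSum r ∈ LieSub.opVp (xGl n) := by
  suffices h : ∀ d : ℕ, ∀ r : Fin (4 * n + 1), 4 * n ≤ r + d →
      rowSum r ∈ LieSub.opVp (xGl n) from h (4 * n) r (by omega)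
  intro d
  induction d with
  | zero =>
    intro r hr
    rw [rowSum_eq]
    refine Submodule.sum_mem _ fun j hj => opL_mem_opVp (Finset.mem_Ici.1 hj) ?_
    rw [Finset.mem_Ici, Fin.le_def] at hj
    rw [show j = Fin.last _ from Fin.ext (by rw [Fin.val_last]; omega), tailSum_last]
    exact Submodule.smul_mem _ _ (single_mem_submodule 0 (Subalgebra.one_mem _))
  | succ d ih =>
    intro r hr
    rw [rowSum_eq]
    refine Submodule.sum_mem _ fun j hj => opL_mem_opVp (Finset.mem_Ici.1 hj)
      (Submodule.smul_mem _ _ ?_)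
    rw [Finset.mem_Ici, Fin.le_def] at hj
    by_cases hjl : (j : ℕ) = 4 * n
    · rw [show j = Fin.last _ from Fin.ext hjl, tailSum_last]
      exact single_mem_submodule 0 (Subalgebra.one_mem _)
    · rw [tailSum_eq (i := ⟨j + 1, by omega⟩) rfl]
      exact ih _ (by simp only; omega)

/-- The coefficients of the row determinant belong to `𝒲(𝔤𝔩̄, f)`. -/
theorem rdetCoeff_mem_W (i : ℕ) : rdetCoeff n i ∈ (gl (4 * n + 1)).W (xGl n) (fGl n) := by
  rw [rdetCoeff, rdet_eq]
  refine ⟨Subalgebra.smul_mem _ (rowSum_mem_opVp 0 _) _, fun a ha k => ?_⟩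
  -- The full bracket is the sum of the brackets with the even and the odd component of `a`, each of
  -- which has been treated separately.
  rw [Finsupp.smul_apply, map_smul, LieSub.chiBr_eq]
  exact Submodule.smul_mem (LieSub.opIdeal (glIdeal n)) _
    (Submodule.add_mem _ (parBr_rowSum_mem 0 ha _) (parBr_rowSum_mem 1 ha _)) k

end RowDet

end SusyW
end

theorem mainTheorem9 (n : ℕ) (hn : 1 ≤ n) :
    (∀ w ∈ (SusyW.gl (4 * n + 1)).W (SusyW.xGl n) (SusyW.fGl n),
      SusyW.kappa n w ∈ (SusyW.osp n).W (SusyW.xOsp n) (SusyW.fOsp n)) ∧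
    ∀ i : ℕ, 1 ≤ i → i ≤ 4 * n + 1 →
      SusyW.kappa n (SusyW.rdetCoeff n i) ∈ (SusyW.osp n).W (SusyW.xOsp n) (SusyW.fOsp n) := by
  exact ⟨fun w hw => SusyW.kappa_mem_W hw,
    fun i _ _ => SusyW.kappa_mem_W (SusyW.rdetCoeff_mem_W i)⟩
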